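/- Let $p$ be a prime. A *discrete $p$-toral group* is a group $G$ with a normal subgroup $G_0\cong(\mathbb{Z}/p^\infty)^n$ (for some finite $n\ge 0$) such that $G/G_0$ is a finite $p$-group; its *order* is $|G|=(n,|G/G_0|)\in\mathbb{N}^2$, and orders are compared lexicographically. Subgroups of a discrete $p$-toral group are again discrete $p$-toral. A *fusion system* $\mathcal F$ over a discrete $p$-toral group $S$ is a category whose objects are the subgroups of $S$, such that (with composition of homomorphisms) $\mathrm{Hom}_S(P,R)\subseteq \mathrm{Hom}_{\mathcal F}(P,R)\subseteq \mathrm{Inj}(P,R)$ for all $P,R\le S$, where $\mathrm{Hom}_S(P,R)$ is the set of homomorphisms $c_g\colon x\mapsto gxg^{-1}$ with $g\in S$ and $gPg^{-1}\le R$, and $\mathrm{Inj}(P,R)$ is the set of injective homomorphisms, and such that every morphism of $\mathcal F$ is an isomorphism in $\mathcal F$ followed by an inclusion. Subgroups isomorphic in $\mathcal F$ are called $\mathcal F$-conjugate. A subgroup $P\le S$ is *fully centralized* (resp. *fully normalized*) in $\mathcal F$ if $|C_S(P)|\ge |C_S(R)|$ (resp. $|N_S(P)|\ge|N_S(R)|$)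 for every $R$ which is $\mathcal F$-conjugate to $P$. Write $\mathrm{Aut}_S(P)$ for the group of automorphisms $c_g$ of $P$ with $g\in N_S(P)$, $\mathrm{Aut}_{\mathcal F}(P)$ for the automorphism group of $P$ in $\mathcal F$, $\mathrm{Out}_{\mathcal F}(P)=\mathrm{Aut}_{\mathcal F}(P)/\mathrm{Inn}(P)$ and $\mathrm{Out}_S(P)=\mathrm{Aut}_S(P)/\mathrm{Inn}(P)$. The fusion system $\mathcal F$ is *saturated* if: (I) for each fully normalized $P\le S$, $P$ is fully centralized, $\mathrm{Out}_{\mathcal F}(P)$ is finite, and $\mathrm{Out}_S(P)\in \mathrm{Syl}_p(\mathrm{Out}_{\mathcal F}(P))$; (II) if $P\le S$ and $\varphi\in\mathrm{Hom}_{\mathcal F}(P,S)$ are such that $\varphi(P)$ is fully centralized, then there is $\bar\varphi\in\mathrm{Hom}_{\mathcal F}(N_\varphi,S)$ with $\bar\varphi|_P=\varphi$, where $N_\varphi=\{g\in N_S(P)\mid \varphi c_g\varphi^{-1}\in\mathrm{Aut}_S(\varphi(P))\}$; (III) if $P_1\le P_2\le\cdots$ are subgroups of $S$ with union $P_\infty$,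 and $\varphi\in\mathrm{Hom}(P_\infty,S)$ satisfies $\varphi|_{P_n}\in\mathrm{Hom}_{\mathcal F}(P_n,S)$ for all $n$, then $\varphi\in\mathrm{Hom}_{\mathcal F}(P_\infty,S)$. For $Q\le S$ and $K\le\mathrm{Aut}(Q)$, let $N_S^K(Q)=\{x\in N_S(Q)\mid c_x|_Q\in K\}$. Call $Q$ *fully $K$-normalized* in $\mathcal F$ if $|N_S^K(Q)|\ge |N_S^{\varphi K\varphi^{-1}}(\varphi(Q))|$ for each $\varphi\in\mathrm{Hom}_{\mathcal F}(Q,S)$, where $\varphi K\varphi^{-1}=\{\varphi\alpha\varphi^{-1}\mid\alpha\in K\}\le\mathrm{Aut}(\varphi(Q))$. Let $N_{\mathcal F}^K(Q)$ be the fusion system over $N_S^K(Q)$ in which, for $P,R\le N_S^K(Q)$, $\mathrm{Hom}_{N_{\mathcal F}^K(Q)}(P,R)$ is the set of those $\varphi\in\mathrm{Hom}_{\mathcal F}(P,R)$ for which there is $\bar\varphi\in\mathrm{Hom}_{\mathcal F}(PQ,RQ)$ with $\bar\varphi|_P=\varphi$, $\bar\varphi(Q)=Q$ and $\bar\varphi|_Q\in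 K$. **Theorem 2.3.** Let $\mathcal F$ be a saturated fusion system over a discrete $p$-toral group $S$, and let $Q\le S$ and $K\le\mathrm{Aut}(Q)$ be such that $Q$ is fully $K$-normalized in $\mathcal F$. Then $N_S^K(Q)$ is a discrete $p$-toral group, and $N_{\mathcal F}^K(Q)$ is a saturated fusion system over $N_S^K(Q)$. -/

import Mathlib

/-- The quasi-cyclic group `ℤ/p^∞`, as the `p`-primary component of `ℚ/ℤ`. -/
abbrev QuasiCyclic (p : ℕ) : Type :=
  AddCommGroup.primaryComponent (AddCircle (1 : ℚ)) p

/-- `G` is a discrete `p`-torus of rank `n`, that is, `G ≅ (ℤ/p^∞)^n`. -/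
def IsDiscretePTorusOfRank (p : ℕ) (G : Type*) [Group G] (n : ℕ) : Prop :=
  Nonempty (G ≃* Multiplicative (Fin n → QuasiCyclic p))

/-- `T` is a normal discrete `p`-torus of rank `n` in `G` such that `G/T` is a finite `p`-group
(equivalently, for `p` prime, the index of `T` is a power of `p`; recall that the index of a
subgroup of infinite index is `0`). -/
structure IsIdentityComponent (p : ℕ) {G : Type*} [Group G] (T : Subgroup G) (n : ℕ) : Prop where
  normal : T.Normal
  torus : IsDiscretePTorusOfRank p T n
  index_eq : ∃ k : ℕ, T.index = p ^ k

/-- Discrete `p`-toral groups. -/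
def IsDiscretePToral (p : ℕ) (G : Type*) [Group G] : Prop :=
  ∃ (T : Subgroup G) (n : ℕ), IsIdentityComponent p T n

/-- The order `(rk G, |π₀ G|)` of a discrete `p`-toral group, in `ℕ × ℕ` with the lexicographic
order. The identity component and its rank are unique, so for a discrete `p`-toral group each of
the two sets below has exactly one element, and `sInf` picks this element. -/
noncomputable def pToralOrder (p : ℕ) (G : Type*) [Group G] : ℕ ×ₗ ℕ :=
  toLex (sInf {n | ∃ T : Subgroup G, IsIdentityComponent p T n},
    sInf {m | ∃ (T : Subgroup G) (n : ℕ), IsIdentityComponent p T n ∧ T.index = m})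

/-- The homomorphism `c_g : P → Q`, `x ↦ g x g⁻¹`, for `g` with `g P g⁻¹ ≤ Q`. -/
def conjHom {S : Type*} [Group S] {P Q : Subgroup S} (g : S)
    (hg : ∀ x ∈ P, g * x * g⁻¹ ∈ Q) : P →* Q where
  toFun x := ⟨g * x * g⁻¹, hg x x.2⟩
  map_one' := by ext; simp
  map_mul' x y := by ext; simp

/-- A fusion system over `S`: a category whose objects are the subgroups of `S`, whose morphisms
are injective homomorphisms (composed as such) and include those induced by conjugation in `S`
(in particular identities and inclusions), and in which every morphism is an isomorphism of the
category followed by an inclusion. -/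
structure FusionSystem (S : Type*) [Group S] where
  hom : ∀ P Q : Subgroup S, Set (P →* Q)
  comp_mem : ∀ {P Q R : Subgroup S} {φ : P →* Q} {ψ : Q →* R},
    φ ∈ hom P Q → ψ ∈ hom Q R → ψ.comp φ ∈ hom P R
  conj_mem : ∀ {P Q : Subgroup S} (g : S) (hg : ∀ x ∈ P, g * x * g⁻¹ ∈ Q),
    conjHom g hg ∈ hom P Q
  injective : ∀ {P Q : Subgroup S} {φ : P →* Q}, φ ∈ hom P Q → Function.Injective φ
  exists_iso : ∀ {P Q : Subgroup S} {φ : P →* Q}, φ ∈ hom P Q →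
    ∃ (R : Subgroup S) (hR : R ≤ Q) (e : P ≃* R),
      e.toMonoidHom ∈ hom P R ∧ e.symm.toMonoidHom ∈ hom R P ∧
        φ = (Subgroup.inclusion hR).comp e.toMonoidHom

namespace FusionSystem

variable {S : Type*} [Group S]

/-- The `K`-normalizer `N_S^K(Q)`: all `g` in `N_S(Q)` such that `c_g ∈ Aut(Q)` lies in `K`. -/
def kNormalizer (Q : Subgroup S) (K : Subgroup (MulAut Q)) : Subgroup S :=
  (K.comap Q.normalizerMonoidHom).map (Subgroup.normalizer (Q : Set S)).subtype

/-- `Aut_S(P)`. -/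
def autS (P : Subgroup S) : Subgroup (MulAut P) :=
  P.normalizerMonoidHom.range

/-- For an injective homomorphism `φ : P → S`, the isomorphism `P ≅ φ(P)`. The target of `φ` is
the object `S` of a fusion system, that is, the subgroup `⊤`. -/
noncomputable def isoImage {P : Subgroup S} (φ : P →* (⊤ : Subgroup S))
    (hφ : Function.Injective φ) : P ≃* ((⊤ : Subgroup S).subtype.comp φ).range :=
  MonoidHom.ofInjective (f := (⊤ : Subgroup S).subtype.comp φ)
    ((⊤ : Subgroup S).subtype_injective.comp hφ)

/-- For an isomorphism `e : P ≅ R`, the subgroup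
`N_e = {g ∈ N_S(P) | e c_g e⁻¹ ∈ Aut_S(R)}` of `S`. -/
def extender {P R : Subgroup S} (e : P ≃* R) : Subgroup S :=
  kNormalizer P ((autS R).comap (MulAut.congr e).toMonoidHom)

lemma le_extender {P R : Subgroup S} (e : P ≃* R) : P ≤ extender e := by
  intro x hx
  refine ⟨⟨x, Subgroup.le_normalizer hx⟩, ?_, rfl⟩
  refine ⟨⟨e ⟨x, hx⟩, Subgroup.le_normalizer (e ⟨x, hx⟩).2⟩, ?_⟩
  ext y
  have h : (P.normalizerMonoidHom ⟨x, Subgroup.le_normalizer hx⟩) (e.symm y)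
      = ⟨x, hx⟩ * e.symm y * ⟨x, hx⟩⁻¹ := rfl
  change ((e ⟨x, hx⟩ : S) * y * (e ⟨x, hx⟩ : S)⁻¹)
    = (e (P.normalizerMonoidHom ⟨x, Subgroup.le_normalizer hx⟩ (e.symm y)) : S)
  rw [h]
  simp

variable (F : FusionSystem S)

/-- `Aut_F(P)`: the automorphisms of `P` in the category `F`. -/
def autF (P : Subgroup S) : Subgroup (MulAut P) where
  carrier := {α | α.toMonoidHom ∈ F.hom P P ∧ α.symm.toMonoidHom ∈ F.hom P P}
  one_mem' := by
    have h : (1 : MulAut P).toMonoidHom ∈ F.hom P P := by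
      have h1 := F.conj_mem (P := P) (Q := P) 1 (by simp)
      convert h1
      ext x
      simp [conjHom]
    exact ⟨h, h⟩
  mul_mem' ha hb := ⟨F.comp_mem hb.1 ha.1, F.comp_mem ha.2 hb.2⟩
  inv_mem' ha := ⟨ha.2, ha.1⟩

/-- `Inn(P)`. -/
def inn (P : Subgroup S) : Subgroup (MulAut P) :=
  (MulAut.conj : P →* MulAut P).range

instance inn_normal (P : Subgroup S) : (inn P).Normal where
  conj_mem := by
    rintro _ ⟨x, rfl⟩ α
    refine ⟨α x, ?_⟩
    ext y
    simp [MulAut.mul_apply]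

/-- `Out_F(P) = Aut_F(P) / Inn(P)`. -/
abbrev OutF (P : Subgroup S) : Type _ :=
  F.autF P ⧸ (inn P).subgroupOf (F.autF P)

/-- `Out_S(P) = Aut_S(P) / Inn(P)`, as a subgroup of `Out_F(P)`. -/
def outS (P : Subgroup S) : Subgroup (F.OutF P) :=
  ((autS P).subgroupOf (F.autF P)).map (QuotientGroup.mk' ((inn P).subgroupOf (F.autF P)))

/-- `P` and `Q` are isomorphic in the category `F`. -/
def IsConj (P Q : Subgroup S) : Prop :=
  ∃ e : P ≃* Q, e.toMonoidHom ∈ F.hom P Q ∧ e.symm.toMonoidHom ∈ F.hom Q P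

/-- `P` is fully centralized in `F`. -/
def IsFullyCentralized (p : ℕ) (P : Subgroup S) : Prop :=
  ∀ Q : Subgroup S, F.IsConj P Q →
    pToralOrder p (Subgroup.centralizer (Q : Set S)) ≤
      pToralOrder p (Subgroup.centralizer (P : Set S))

/-- `P` is fully normalized in `F`. -/
def IsFullyNormalized (p : ℕ) (P : Subgroup S) : Prop :=
  ∀ Q : Subgroup S, F.IsConj P Q →
    pToralOrder p (Subgroup.normalizer (Q : Set S)) ≤
      pToralOrder p (Subgroup.normalizer (P : Set S))

/-- Saturated fusion systems (over a discrete `p`-toral group). -/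
structure IsSaturated (p : ℕ) : Prop where
  /-- axiom (I) -/
  sylow : ∀ P : Subgroup S, F.IsFullyNormalized p P →
    F.IsFullyCentralized p P ∧ Finite (F.OutF P) ∧
      ∃ T : Sylow p (F.OutF P), (T : Subgroup (F.OutF P)) = F.outS P
  /-- axiom (II) -/
  extend : ∀ (P : Subgroup S) (φ : P →* (⊤ : Subgroup S)) (hφ : φ ∈ F.hom P ⊤),
    F.IsFullyCentralized p ((⊤ : Subgroup S).subtype.comp φ).range →
      ∃ ψ ∈ F.hom (extender (isoImage φ (F.injective hφ))) ⊤,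
        ψ.comp (Subgroup.inclusion (le_extender (isoImage φ (F.injective hφ)))) = φ
  /-- axiom (III); the supremum of an increasing sequence of subgroups is its union -/
  union : ∀ (P : ℕ → Subgroup S), Monotone P →
    ∀ φ : (⨆ n, P n : Subgroup S) →* (⊤ : Subgroup S),
      (∀ n, φ.comp (Subgroup.inclusion (le_iSup P n)) ∈ F.hom (P n) ⊤) →
        φ ∈ F.hom (⨆ n, P n) ⊤

/-- `Q` is fully `K`-normalized in `F`: for each `φ ∈ Hom_F(Q, S)`,
`|N_S^K(Q)| ≥ |N_S^{φKφ⁻¹}(φ(Q))|`. -/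
def IsFullyKNormalized (p : ℕ) (Q : Subgroup S) (K : Subgroup (MulAut Q)) : Prop :=
  ∀ (φ : Q →* (⊤ : Subgroup S)) (hφ : φ ∈ F.hom Q ⊤),
    pToralOrder p (kNormalizer ((⊤ : Subgroup S).subtype.comp φ).range
        (K.map (MulAut.congr (isoImage φ (F.injective hφ))).toMonoidHom)) ≤
      pToralOrder p (kNormalizer Q K)

/-- A homomorphism between subgroups of a subgroup `H ≤ S`, regarded as a homomorphism between
subgroups of `S`. -/
noncomputable def liftHom {H : Subgroup S} {P R : Subgroup H} (φ : P →* R) :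
    P.map H.subtype →* R.map H.subtype :=
  ((R.equivMapOfInjective H.subtype H.subtype_injective).toMonoidHom.comp φ).comp
    (P.equivMapOfInjective H.subtype H.subtype_injective).symm.toMonoidHom

/-- `φ ∈ Hom_F(P, R)` belongs to the normalizer subsystem `N_F^K(Q)` if some
`ψ ∈ Hom_F(PQ, RQ)` restricts to `φ` on `P` and to an element of `K` on `Q`. Here `P, R` are
subgroups of `N_S^K(Q)`; so they normalize `Q`, and the joins below are the products `PQ`, `RQ`. -/
def normalizerHom (Q : Subgroup S) (K : Subgroup (MulAut Q)) (P R : Subgroup (kNormalizer Q K)) :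
    Set (P →* R) :=
  {φ | liftHom φ ∈ F.hom (P.map (kNormalizer Q K).subtype) (R.map (kNormalizer Q K).subtype) ∧
    ∃ ψ ∈ F.hom (P.map (kNormalizer Q K).subtype ⊔ Q) (R.map (kNormalizer Q K).subtype ⊔ Q),
      (∀ x : P.map (kNormalizer Q K).subtype,
        (ψ (Subgroup.inclusion le_sup_left x) : S) = liftHom φ x) ∧
      ∃ α ∈ K, ∀ y : Q, (ψ (Subgroup.inclusion le_sup_right y) : S) = α y}

lemma inclusion_mem {P Q : Subgroup S} (h : P ≤ Q) : Subgroup.inclusion h ∈ F.hom P Q := by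
  have h1 := F.conj_mem (P := P) (Q := Q) 1 (by simpa using fun x hx => h hx)
  convert h1
  ext x
  simp [conjHom]

lemma mem_of_restrict {P Q P' Q' : Subgroup S} {φ : P →* Q} (hφ : φ ∈ F.hom P Q) (hP : P' ≤ P)
    (θ : P' →* Q') (h : ∀ x : P', (θ x : S) = φ (Subgroup.inclusion hP x)) :
    θ ∈ F.hom P' Q' := by
  obtain ⟨R, hR, e, he, -, h2⟩ := F.exists_iso (F.comp_mem (F.inclusion_mem hP) hφ)
  have key : ∀ x : P', (e x : S) = θ x := fun x => by
    rw [h x]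
    exact congrArg (fun f : P' →* Q => (f x : S)) h2.symm
  have hRQ : R ≤ Q' := fun r hr => by
    have h3 : r = θ (e.symm ⟨r, hr⟩) := by
      rw [← key, e.apply_symm_apply]
    rw [h3]
    exact (θ _).2
  convert F.comp_mem he (F.inclusion_mem hRQ)
  ext x
  exact (key x).symm

lemma symm_mem {P Q : Subgroup S} {e : P ≃* Q} (he : e.toMonoidHom ∈ F.hom P Q) :
    e.symm.toMonoidHom ∈ F.hom Q P := by
  obtain ⟨R, hR, e', -, he', h2⟩ := F.exists_iso he
  have key : ∀ x : P, (e x : S) = e' x := fun x =>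
    congrArg (fun f : P →* Q => (f x : S)) h2
  have hQR : Q ≤ R := fun y hy => by
    have h3 : y = e' (e.symm ⟨y, hy⟩) := by
      rw [← key, e.apply_symm_apply]
    rw [h3]
    exact (e' _).2
  refine F.mem_of_restrict he' hQR _ fun y => ?_
  congr 1
  change e.symm y = e'.symm _
  rw [MulEquiv.eq_symm_apply]
  ext
  rw [← key, e.apply_symm_apply]
  rfl

lemma coe_liftHom {H : Subgroup S} {P R : Subgroup H} (φ : P →* R)
    (x : P.map H.subtype) (y : P) (h : (x : S) = (y : H)) : (liftHom φ x : S) = (φ y : H) := by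
  have hx : x = P.equivMapOfInjective H.subtype H.subtype_injective y := Subtype.ext h
  simp [liftHom, hx]

lemma exists_coe_eq {H : Subgroup S} {P : Subgroup H} (x : P.map H.subtype) :
    ∃ y : P, (x : S) = (y : H) := by
  obtain ⟨_, y, hy, rfl⟩ := x
  exact ⟨⟨y, hy⟩, rfl⟩

lemma sup_conj_mem {Q P R : Subgroup S} {g : S} (hP : ∀ x ∈ P, g * x * g⁻¹ ∈ R)
    (hQ : ∀ x ∈ Q, g * x * g⁻¹ ∈ Q) : ∀ x ∈ P ⊔ Q, g * x * g⁻¹ ∈ R ⊔ Q := by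
  have h : P ⊔ Q ≤ (R ⊔ Q).comap (MulAut.conj g).toMonoidHom :=
    sup_le (fun x hx => Subgroup.mem_sup_left (hP x hx))
      (fun x hx => Subgroup.mem_sup_right (hQ x hx))
  exact fun x hx => h hx

lemma normalizer_range {P R Q : Subgroup S} {T : Subgroup S} (ψ : (P ⊔ Q : Subgroup S) →* T)
    (hP : ∀ x : P, (ψ (Subgroup.inclusion le_sup_left x) : S) ∈ R)
    (hQ : ∀ x : Q, (ψ (Subgroup.inclusion le_sup_right x) : S) ∈ Q)
    (x : (P ⊔ Q : Subgroup S)) : (ψ x : S) ∈ R ⊔ Q := by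
  have h : P ⊔ Q ≤ ((R ⊔ Q).comap (T.subtype.comp ψ)).map (P ⊔ Q).subtype :=
    sup_le (fun x hx => ⟨⟨x, Subgroup.mem_sup_left hx⟩, Subgroup.mem_sup_left (hP ⟨x, hx⟩), rfl⟩)
      (fun x hx => ⟨⟨x, Subgroup.mem_sup_right hx⟩, Subgroup.mem_sup_right (hQ ⟨x, hx⟩), rfl⟩)
  obtain ⟨y, hy, hxy⟩ := h x.2
  have : y = x := Subtype.ext hxy
  exact this ▸ hy

/-- The normalizer fusion system `N_F^K(Q)` over `N_S^K(Q)`. -/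
noncomputable def normalizer (Q : Subgroup S) (K : Subgroup (MulAut Q)) :
    FusionSystem (kNormalizer Q K) where
  hom := F.normalizerHom Q K
  comp_mem := by
    rintro P R T φ χ ⟨h1, ψ, hψ, hψP, α, hα, hψQ⟩ ⟨h2, ω, hω, hωP, β, hβ, hωQ⟩
    have hc : liftHom (χ.comp φ) = (liftHom χ).comp (liftHom φ) := by
      ext x
      obtain ⟨y, hy⟩ := exists_coe_eq x
      rw [coe_liftHom _ x y hy]
      exact (coe_liftHom χ _ _ (coe_liftHom φ x y hy)).symm
    refine ⟨hc ▸ F.comp_mem h1 h2, ω.comp ψ, F.comp_mem hψ hω, fun x => ?_, β * α,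
      K.mul_mem hβ hα, fun y => ?_⟩
    · have : ψ (Subgroup.inclusion le_sup_left x) = Subgroup.inclusion le_sup_left (liftHom φ x) :=
        Subtype.ext (hψP x)
      rw [hc, MonoidHom.comp_apply, this, hωP]
      rfl
    · have : ψ (Subgroup.inclusion le_sup_right y) = Subgroup.inclusion le_sup_right (α y) :=
        Subtype.ext (hψQ y)
      rw [MonoidHom.comp_apply, this, hωQ]
      rfl
  conj_mem := by
    rintro P R g hg
    have hg' : ∀ x ∈ P.map (kNormalizer Q K).subtype,
        (g : S) * x * (g : S)⁻¹ ∈ R.map (kNormalizer Q K).subtype := by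
      rintro _ ⟨x, hx, rfl⟩
      exact ⟨_, hg x hx, rfl⟩
    have hc : liftHom (conjHom g hg) = conjHom (g : S) hg' := by
      ext x
      obtain ⟨y, hy⟩ := exists_coe_eq x
      rw [coe_liftHom _ x y hy]
      simp [conjHom, hy]
    obtain ⟨⟨a, ha⟩, haK, hga⟩ := g.2
    have hag : a = g := hga
    have hQ : ∀ x ∈ Q, (g : S) * x * (g : S)⁻¹ ∈ Q := fun x hx => by
      rw [← hag]
      exact (Subgroup.mem_normalizer_iff.1 ha x).1 hx
    refine ⟨hc ▸ F.conj_mem _ _, conjHom (g : S) (sup_conj_mem hg' hQ), F.conj_mem _ _,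
      fun x => ?_, _, haK, fun y => ?_⟩
    · rw [hc]
      rfl
    · change (g : S) * y * (g : S)⁻¹ = a * y * a⁻¹
      rw [hag]
  injective := by
    rintro P R φ ⟨h1, -⟩ x y hxy
    let E := P.equivMapOfInjective (kNormalizer Q K).subtype (kNormalizer Q K).subtype_injective
    have h : liftHom φ (E x) = liftHom φ (E y) := by
      ext
      rw [coe_liftHom φ (E x) x rfl, coe_liftHom φ (E y) y rfl, hxy]
    exact E.injective (F.injective h1 h)
  exists_iso := by
    rintro P R φ ⟨h1, ψ, hψ, hψP, α, hα, hψQ⟩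
    have hφ : Function.Injective φ := by
      intro x y hxy
      let E := P.equivMapOfInjective (kNormalizer Q K).subtype (kNormalizer Q K).subtype_injective
      have h : liftHom φ (E x) = liftHom φ (E y) := by
        ext
        rw [coe_liftHom φ (E x) x rfl, coe_liftHom φ (E y) y rfl, hxy]
      exact E.injective (F.injective h1 h)
    let e : P ≃* (R.subtype.comp φ).range :=
      MonoidHom.ofInjective (f := R.subtype.comp φ) (R.subtype_injective.comp hφ)
    have hlift : ∀ x, (liftHom e.toMonoidHom x : S) = liftHom φ x := fun x => by
      obtain ⟨y, hy⟩ := exists_coe_eq x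
      rw [coe_liftHom _ x y hy, coe_liftHom _ x y hy]
      rfl
    have hmem : ∀ x, (ψ x : S) ∈ ((R.subtype.comp φ).range.map (kNormalizer Q K).subtype) ⊔ Q :=
      normalizer_range ψ (fun x => by rw [hψP, ← hlift]; exact (liftHom e.toMonoidHom x).2)
        (fun x => by rw [hψQ]; exact (α x).2)
    let ω : (P.map (kNormalizer Q K).subtype ⊔ Q : Subgroup S) →*
        ((R.subtype.comp φ).range.map (kNormalizer Q K).subtype ⊔ Q : Subgroup S) :=
      ((Subgroup.subtype _).comp ψ).codRestrict _ hmem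
    have hω : ω ∈ F.hom _ _ := F.mem_of_restrict hψ le_rfl ω fun x => rfl
    have hωP : ∀ x, (ω (Subgroup.inclusion le_sup_left x) : S) = liftHom e.toMonoidHom x :=
      fun x => (hψP x).trans (hlift x).symm
    have hωQ : ∀ y : Q, (ω (Subgroup.inclusion le_sup_right y) : S) = α y := hψQ
    have hinv : ∀ x, liftHom e.toMonoidHom (liftHom e.symm.toMonoidHom x) = x := fun x => by
      obtain ⟨y, hy⟩ := exists_coe_eq x
      ext
      rw [coe_liftHom _ _ _ (coe_liftHom _ x y hy), hy]
      exact congrArg (fun z : (R.subtype.comp φ).range => ((z : kNormalizer Q K) : S))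
        (e.apply_symm_apply y)
    have hsurj : Function.Surjective ω := by
      intro z
      have h : ((R.subtype.comp φ).range.map (kNormalizer Q K).subtype) ⊔ Q ≤
          ω.range.map (Subgroup.subtype _) := by
        refine sup_le (fun x hx => ?_) (fun y hy => ?_)
        · refine ⟨_, ⟨Subgroup.inclusion le_sup_left (liftHom e.symm.toMonoidHom ⟨x, hx⟩), rfl⟩, ?_⟩
          change (ω _ : S) = x
          rw [hωP, hinv]
        · refine ⟨_, ⟨Subgroup.inclusion le_sup_right (α.symm ⟨y, hy⟩), rfl⟩, ?_⟩
          change (ω _ : S) = y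
          rw [hωQ, MulEquiv.apply_symm_apply]
      obtain ⟨_, ⟨w, rfl⟩, hw⟩ := h z.2
      exact ⟨w, Subtype.ext hw⟩
    let Ω := MulEquiv.ofBijective ω ⟨F.injective hω, hsurj⟩
    have hΩ : Ω.symm.toMonoidHom ∈ F.hom _ _ := F.symm_mem (e := Ω) hω
    have h1P : ∀ x, (Ω.symm (Subgroup.inclusion le_sup_left x) : S)
        = liftHom e.symm.toMonoidHom x := fun x => by
      have : Ω.symm (Subgroup.inclusion le_sup_left x)
          = Subgroup.inclusion le_sup_left (liftHom e.symm.toMonoidHom x) := by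
        rw [MulEquiv.symm_apply_eq]
        ext
        exact (((hωP _).trans (congrArg _ (hinv x)))).symm
      rw [this]
      rfl
    have h1Q : ∀ y : Q, (Ω.symm (Subgroup.inclusion le_sup_right y) : S) = (α⁻¹ : MulAut Q) y :=
      fun y => by
      have : Ω.symm (Subgroup.inclusion le_sup_right y)
          = Subgroup.inclusion le_sup_right ((α⁻¹ : MulAut Q) y) := by
        rw [MulEquiv.symm_apply_eq]
        ext
        refine ((hωQ _).trans ?_).symm
        exact congrArg _ (MulAut.apply_inv_self Q α y)
      rw [this]
      rfl
    refine ⟨(R.subtype.comp φ).range, ?_, e, ⟨?_, ω, hω, hωP, α, hα, hωQ⟩,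
      ⟨?_, Ω.symm.toMonoidHom, hΩ, h1P, α⁻¹, K.inv_mem hα, h1Q⟩, ?_⟩
    · rintro _ ⟨x, rfl⟩
      exact (φ x).2
    · exact F.mem_of_restrict hω le_sup_left _ fun x => (hωP x).symm
    · exact F.mem_of_restrict hΩ le_sup_left _ fun x => (h1P x).symm
    · ext x
      rfl

end FusionSystem

/-! That $N_S^K(Q)$ is discrete $p$-toral is heredity under injections. Saturation rests on a
criterion: in a saturated system, $Q$ is fully $K$-normalized if and only if it is fully centralized
and $\mathrm{Aut}_S(Q)\cap K$ has index prime to $p$ in $\mathrm{Aut}_F(Q)\cap K$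
(`isFullyCentralized_and_not_dvd`, `isFullyKNormalized_of_not_dvd`). When these conditions hold,
every $F$-isomorphism $R\to Q$, after a twist by an element of $\mathrm{Aut}_F(Q)\cap K$, extends to
the corresponding subgroup of $N_S(R)$ and sends it into $N_S^K(Q)$ (`exists_extend_of_not_dvd`).

A subgroup $P$ of $N=N_S^K(Q)$ is studied through $PQ$. For $L\le\mathrm{Aut}(P)$ let `supAut L K`
consist of the automorphisms of $PQ$ restricting into $L$ and $K$; its normalizer in $S$ is
$N_S^L(P)\cap N$ (`kNormalizer_supAut`). Taking $L=\top$ or $L=\bot$ gives $N_N(P)$ or $C_N(P)$, so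
being fully normalized or centralized in $N_F^K(Q)$ becomes a fully normalized condition on $PQ$ in
$F$ (`isFullyKNormalized_sup`), to which the criterion applies. Axiom (I) follows by restricting
automorphisms of $PQ$ to $P$ (`sylow_normalizer`), axiom (II) by extending morphisms of $PQ$
(`exists_extend_normalizer`).

In axiom (III) the extensions to $P_nQ$ need not be compatible. Their restrictions to $Q$ form
cosets of a descending chain of subgroups of $\mathrm{Aut}_F(Q)$; that chain stabilizes, so a single
restriction serves for all $n$, and the extensions it determines can be glued (`nmor_iSup`).

Since the groups are infinite, Sylow arguments are phrased as "$p$ does not divide the index"; this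
includes finiteness, because infinite index is $0$. Fully normalized conjugates exist because the
orders of the normalizers in a conjugacy class are bounded, which a norm map shows
(`Subgroup.exists_norm`). -/

/-! ### Divisible abelian $p$-groups are determined by their $p$-torsion. -/

theorem AddCommGroup.exists_smul_eq_of_prime {A : Type*} [AddCommGroup A] {p : ℕ} (hp : p.Prime)
    (hd : ∀ x : A, ∃ y, p • y = x) (ht : ∀ x : A, ∃ k : ℕ, p ^ k • x = 0) {n : ℤ} (hn : n ≠ 0)
    (x : A) : ∃ y, n • y = x := by
  have hpow : ∀ (j : ℕ) (x : A), ∃ y, p ^ j • y = x := by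
    intro j
    induction j with
    | zero => exact fun x => ⟨x, by simp⟩
    | succ j ih =>
      intro x
      obtain ⟨y, rfl⟩ := ih x
      obtain ⟨z, rfl⟩ := hd y
      exact ⟨z, by rw [pow_succ, mul_smul]⟩
  have hfin : FiniteMultiplicity (p : ℤ) n := by
    rw [Int.finiteMultiplicity_iff]
    exact ⟨by simpa using hp.ne_one, hn⟩
  obtain ⟨j, m, hm, hpm⟩ : ∃ (j : ℕ) (m : ℤ), n = p ^ j * m ∧ ¬(p : ℤ) ∣ m :=
    ⟨_, hfin.exists_eq_pow_mul_and_not_dvd⟩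
  obtain ⟨y, rfl⟩ := hpow j x
  obtain ⟨k, hk⟩ := ht y
  -- Multiplication by `m`, prime to $p$, is invertible on an element killed by $p^k$; the Bézout
  -- coefficient is the inverse.
  have hcop : IsCoprime m ((p : ℤ) ^ k) :=
    ((Prime.coprime_iff_not_dvd (Nat.prime_iff_prime_int.1 hp)).2 hpm).symm.pow_right
  obtain ⟨a, b, hab⟩ := hcop
  refine ⟨a • y, ?_⟩
  have h1 : (m * a) • y = y := by
    have h2 : (a * m + b * (p : ℤ) ^ k) • y = y := by rw [hab, one_smul]
    rw [add_smul, mul_smul b] at h2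
    have h3 : ((p : ℤ) ^ k) • y = 0 := by rw [← hk]; exact_mod_cast natCast_zsmul y (p ^ k)
    rw [h3, smul_zero, add_zero] at h2
    rw [mul_comm, h2]
  rw [hm, ← mul_smul, mul_assoc, mul_smul, h1]
  exact_mod_cast natCast_zsmul y (p ^ j)

theorem Module.nonempty_addEquiv_of_natCard_eq (k : Type*) {A B : Type*} [Field k] [Finite k]
    [AddCommGroup A] [AddCommGroup B] [Module k A] [Module k B] [Finite A] [Finite B]
    (hAB : Nat.card A = Nat.card B) : Nonempty (A ≃+ B) := by
  have h1 := Module.natCard_eq_pow_finrank (K := k) (V := A)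
  rw [hAB, Module.natCard_eq_pow_finrank (K := k) (V := B)] at h1
  have hrank := Nat.pow_right_injective (Finite.one_lt_card (α := k)) h1
  exact ⟨(LinearEquiv.ofFinrankEq (R := k) A B hrank.symm).toAddEquiv⟩

theorem AddCommGroup.nonempty_addEquiv_of_smul_eq_zero {A B : Type*} [AddCommGroup A]
    [AddCommGroup B] [Finite A] [Finite B] {p : ℕ} (hp : p.Prime) (hA : ∀ x : A, p • x = 0)
    (hB : ∀ x : B, p • x = 0) (hAB : Nat.card A = Nat.card B) : Nonempty (A ≃+ B) := by
  have := Fact.mk hp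
  let _ : Module (ZMod p) A := AddCommGroup.zmodModule hA
  let _ : Module (ZMod p) B := AddCommGroup.zmodModule hB
  exact Module.nonempty_addEquiv_of_natCard_eq (ZMod p) hAB

/-- The two $p$-torsion subgroups are vector spaces over $\mathbb{F}_p$ of equal dimension. Since
`B` is divisible, hence injective, an isomorphism between them extends to `A → B`. It is injective
because it is so on $p$-torsion, and surjective by induction on the exponent, using divisibility of
`A`. -/
theorem AddCommGroup.nonempty_addEquiv_of_card_torsion {A B : Type*} [AddCommGroup A]
    [AddCommGroup B] {p : ℕ} (hp : p.Prime)
    (hdA : ∀ x : A, ∃ y, p • y = x) (htA : ∀ x : A, ∃ k : ℕ, p ^ k • x = 0)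
    (hdB : ∀ x : B, ∃ y, p • y = x) (htB : ∀ x : B, ∃ k : ℕ, p ^ k • x = 0)
    (hA : {x : A | p • x = 0}.Finite)
    (hAB : Nat.card {x : A // p • x = 0} = Nat.card {x : B // p • x = 0}) :
    Nonempty (A ≃+ B) := by
  have := Fact.mk hp
  let TA : AddSubgroup A := (nsmulAddMonoidHom p).ker
  let TB : AddSubgroup B := (nsmulAddMonoidHom p).ker
  have hcard : Nat.card TA = Nat.card TB := hAB
  have : Finite TA := hA
  have : Finite TB := Nat.finite_of_card_ne_zero (by rw [← hcard]; exact Nat.card_pos.ne')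
  obtain ⟨e⟩ := AddCommGroup.nonempty_addEquiv_of_smul_eq_zero hp
    (fun x : TA => Subtype.ext x.2) (fun x : TB => Subtype.ext x.2) hcard
  let _ : DivisibleBy B ℤ := divisibleByOfSMulRightSurj B ℤ
    fun {n} hn x => AddCommGroup.exists_smul_eq_of_prime hp hdB htB hn x
  obtain ⟨h, hh⟩ := Module.Baer.extension_property (Module.Baer.of_divisible B)
    TA.subtype.toIntLinearMap TA.subtype_injective (TB.subtype.comp e.toAddMonoidHom).toIntLinearMap
  have hh' : ∀ x : TA, h x = e x := fun x => LinearMap.congr_fun hh x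
  have hinj : Function.Injective h := by
    rw [injective_iff_map_eq_zero]
    have key : ∀ (k : ℕ) (x : A), p ^ k • x = 0 → h x = 0 → x = 0 := by
      intro k
      induction k with
      | zero => exact fun x hx _ => by simpa using hx
      | succ k ih =>
        intro x hx hhx
        have h1 : p • x = 0 := ih (p • x) (by rwa [← mul_smul, ← pow_succ])
          (by rw [map_nsmul, hhx, smul_zero])
        have h2 := hh' ⟨x, h1⟩
        rw [hhx] at h2
        have h3 : e ⟨x, h1⟩ = 0 := Subtype.ext h2.symm
        have h4 := (map_eq_zero_iff e e.injective).1 h3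
        exact congrArg Subtype.val h4
    intro x hx
    obtain ⟨k, hk⟩ := htA x
    exact key k x hk hx
  have hsurj : Function.Surjective h := by
    have key : ∀ (k : ℕ) (y : B), p ^ k • y = 0 → ∃ x, h x = y := by
      intro k
      induction k with
      | zero => exact fun y hy => ⟨0, by simpa using hy.symm⟩
      | succ k ih =>
        intro y hy
        obtain ⟨x, hx⟩ := ih (p • y) (by rwa [← mul_smul, ← pow_succ])
        obtain ⟨z, rfl⟩ := hdA x
        have h1 : p • (y - h z) = 0 := by rw [smul_sub, ← map_nsmul, hx, sub_self]
        refine ⟨z + e.symm ⟨y - h z, h1⟩, ?_⟩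
        rw [map_add, hh', e.apply_symm_apply]
        simp
    intro y
    obtain ⟨k, hk⟩ := htB y
    exact key k y hk
  exact ⟨AddEquiv.ofBijective h.toAddMonoidHom ⟨hinj, hsurj⟩⟩

/-! ### Torsion and divisibility of $(\mathbb{Z}/p^\infty)^n$. -/

namespace QuasiCyclic

theorem mem_iff {p : ℕ} (x : AddCircle (1 : ℚ)) :
    x ∈ AddCommGroup.primaryComponent (AddCircle (1 : ℚ)) p ↔ ∃ k : ℕ, p ^ k • x = 0 := by
  simp

theorem torsion {p : ℕ} (x : QuasiCyclic p) : ∃ k : ℕ, p ^ k • x = 0 := by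
  obtain ⟨k, hk⟩ := (mem_iff _).1 x.2
  exact ⟨k, Subtype.ext hk⟩

theorem exists_smul_eq {p : ℕ} (hp : p.Prime) (x : QuasiCyclic p) : ∃ y, p • y = x := by
  obtain ⟨y, hy⟩ : ∃ y : AddCircle (1 : ℚ), p • y = x := by
    obtain ⟨q, hq⟩ := QuotientAddGroup.mk_surjective (x : AddCircle (1 : ℚ))
    refine ⟨((q / p : ℚ) : AddCircle (1 : ℚ)), ?_⟩
    rw [← hq]
    have : (p • (q / p : ℚ)) = q := by
      rw [nsmul_eq_mul]
      field_simp [hp.ne_zero]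
    exact congrArg (fun t : ℚ => (t : AddCircle (1 : ℚ))) this
  obtain ⟨k, hk⟩ := torsion x
  refine ⟨⟨y, (mem_iff y).2 ⟨k + 1, ?_⟩⟩, Subtype.ext hy⟩
  rw [pow_succ, mul_smul, hy]
  exact congrArg Subtype.val hk

theorem card_torsion {p : ℕ} (hp : p.Prime) : Nat.card {x : QuasiCyclic p // p • x = 0} = p := by
  have : Fact ((0 : ℚ) < 1) := ⟨zero_lt_one⟩
  have hp0 : (0 : ℚ) < p := by exact_mod_cast hp.pos
  -- The factor `1` is the period of the circle, kept so that the known list of torsion points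
  -- matches definitionally.
  have hz : ∀ m : ℕ, p • (((m / p : ℚ) * 1 : ℚ) : AddCircle (1 : ℚ)) = 0 := by
    intro m
    have : p • ((m / p : ℚ) * 1) = (m : ℚ) := by
      rw [nsmul_eq_mul]; field_simp
    have h2 : ((p • ((m / p : ℚ) * 1) : ℚ) : AddCircle (1 : ℚ)) = 0 := by
      rw [this]
      exact AddCircle.coe_eq_zero_iff 1 |>.2 ⟨m, by simp⟩
    exact h2
  let f : Fin p → {x : QuasiCyclic p // p • x = 0} := fun m =>
    ⟨⟨(((m / p : ℚ) * 1 : ℚ) : AddCircle (1 : ℚ)),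
      (mem_iff _).2 ⟨1, by rw [pow_one]; exact hz m⟩⟩, Subtype.ext (hz m)⟩
  have hf : Function.Bijective f := by
    constructor
    · intro m m' h
      have h1 : (((m / p : ℚ) * 1 : ℚ) : AddCircle (1 : ℚ)) = (((m' / p : ℚ) * 1 : ℚ) :) :=
        congrArg (fun x => (x.1 : AddCircle (1 : ℚ))) h
      have hI : ∀ m : Fin p, ((m / p : ℚ) * 1 : ℚ) ∈ Set.Ico (0 : ℚ) (0 + 1) := fun m => by
        refine ⟨by positivity, ?_⟩
        rw [mul_one, zero_add, div_lt_one hp0]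
        exact_mod_cast m.2
      have h2 := (AddCircle.coe_eq_coe_iff_of_mem_Ico (hI m) (hI m')).1 h1
      rw [mul_one, mul_one, div_left_inj' hp0.ne'] at h2
      exact Fin.ext (by exact_mod_cast h2)
    · rintro ⟨⟨x, hx⟩, hpx⟩
      have h1 : p • x = 0 := congrArg Subtype.val hpx
      obtain ⟨m, hm, rfl⟩ := (AddCircle.nsmul_eq_zero_iff hp.pos).1 h1
      exact ⟨⟨m, hm⟩, rfl⟩
  rw [← Nat.card_eq_of_bijective f hf, Nat.card_fin]

theorem pi_torsion {p : ℕ} {n : ℕ} (x : Fin n → QuasiCyclic p) :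
    ∃ k : ℕ, p ^ k • x = 0 := by
  choose k hk using fun i => torsion (x i)
  refine ⟨∑ i, k i, funext fun i => ?_⟩
  rw [Pi.smul_apply, ← Finset.sum_erase_add _ _ (Finset.mem_univ i), pow_add, mul_smul, hk,
    smul_zero, Pi.zero_apply]

theorem pi_exists_smul_eq {p : ℕ} (hp : p.Prime) {n : ℕ} (x : Fin n → QuasiCyclic p) :
    ∃ y, p • y = x := by
  choose y hy using fun i => exists_smul_eq hp (x i)
  exact ⟨y, funext hy⟩

theorem pi_card_torsion {p : ℕ} (hp : p.Prime) (n : ℕ) :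
    Nat.card {x : Fin n → QuasiCyclic p // p • x = 0} = p ^ n := by
  have e : {x : Fin n → QuasiCyclic p // p • x = 0} ≃
      (Fin n → {x : QuasiCyclic p // p • x = 0}) :=
    (Equiv.subtypeEquivRight fun x => funext_iff).trans
      (Equiv.subtypePiEquivPi (p := fun (_ : Fin n) (x : QuasiCyclic p) => p • x = 0))
  rw [Nat.card_congr e, Nat.card_fun, card_torsion hp, Nat.card_fin]

end QuasiCyclic

/-! ### Tori described by their elements. -/

/-- `T` is an abelian `p`-divisible `p`-group with exactly `p ^ n` elements of order dividing `p`. -/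
structure Subgroup.IsTorus (p : ℕ) {G : Type*} [Group G] (T : Subgroup G) (n : ℕ) : Prop where
  comm : ∀ x ∈ T, ∀ y ∈ T, x * y = y * x
  div : ∀ x ∈ T, ∃ y ∈ T, y ^ p = x
  tors : ∀ x ∈ T, ∃ k : ℕ, x ^ p ^ k = 1
  card : Nat.card {x : G // x ∈ T ∧ x ^ p = 1} = p ^ n

/-- This trades an isomorphism for conditions on elements of `G`, which are easy to compare under
inclusions and to push along homomorphisms. -/
theorem isDiscretePTorusOfRank_iff {p : ℕ} (hp : p.Prime) {G : Type*} [Group G]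
    (T : Subgroup G) (n : ℕ) : IsDiscretePTorusOfRank p T n ↔ T.IsTorus p n := by
  constructor
  · rintro ⟨e⟩
    refine ⟨fun x hx y hy => ?_, fun x hx => ?_, fun x hx => ?_, ?_⟩
    · have h : (⟨x, hx⟩ * ⟨y, hy⟩ : T) = ⟨y, hy⟩ * ⟨x, hx⟩ :=
        e.injective (by rw [map_mul, map_mul, mul_comm])
      exact congrArg Subtype.val h
    · obtain ⟨z, hz⟩ := QuasiCyclic.pi_exists_smul_eq hp (e ⟨x, hx⟩).toAdd
      refine ⟨_, (e.symm (Multiplicative.ofAdd z)).2, ?_⟩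
      have h : (e.symm (Multiplicative.ofAdd z)) ^ p = ⟨x, hx⟩ := by
        rw [← map_pow, ← ofAdd_nsmul, hz, ofAdd_toAdd, e.symm_apply_apply]
      exact congrArg Subtype.val h
    · obtain ⟨k, hk⟩ := QuasiCyclic.pi_torsion (e ⟨x, hx⟩).toAdd
      have h : (⟨x, hx⟩ : T) ^ p ^ k = 1 := e.injective (by
        rw [map_pow, map_one]
        exact congrArg Multiplicative.ofAdd hk)
      exact ⟨k, congrArg Subtype.val h⟩
    · rw [← QuasiCyclic.pi_card_torsion hp n]
      refine Nat.card_congr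
        { toFun := fun x => ⟨(e ⟨x.1, x.2.1⟩).toAdd, ?_⟩
          invFun := fun z => ⟨e.symm (Multiplicative.ofAdd z.1), (e.symm _).2, ?_⟩
          left_inv := fun x => ?_
          right_inv := fun z => ?_ }
      · have h : (⟨x.1, x.2.1⟩ : T) ^ p = 1 := Subtype.ext x.2.2
        have h2 : (e ⟨x.1, x.2.1⟩) ^ p = 1 := by rw [← map_pow, h, map_one]
        exact congrArg Multiplicative.toAdd h2
      · have h : (e.symm (Multiplicative.ofAdd z.1)) ^ p = 1 := by
          rw [← map_pow, ← ofAdd_nsmul, z.2, ofAdd_zero, map_one]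
        exact congrArg Subtype.val h
      · have h := congrArg Subtype.val (e.symm_apply_apply ⟨x.1, x.2.1⟩)
        exact Subtype.ext h
      · exact Subtype.ext (congrArg Multiplicative.toAdd (e.apply_symm_apply _))
  · intro h
    let _ : CommGroup T :=
      { (inferInstance : Group T) with
        mul_comm := fun x y => Subtype.ext (h.comm x x.2 y y.2) }
    have hc : Nat.card {x : Additive T // p • x = 0} = p ^ n := by
      rw [← h.card]
      refine Nat.card_congr
        { toFun := fun x => ⟨(Additive.toMul x.1 : T), (Additive.toMul x.1).2, ?_⟩
          invFun := fun z => ⟨Additive.ofMul ⟨z.1, z.2.1⟩, ?_⟩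
          left_inv := fun x => rfl
          right_inv := fun z => rfl }
      · exact congrArg (fun y => ((Additive.toMul y : T) : G)) x.2
      · exact congrArg Additive.ofMul (Subtype.ext z.2.2 : (⟨z.1, z.2.1⟩ : T) ^ p = 1)
    obtain ⟨e⟩ := AddCommGroup.nonempty_addEquiv_of_card_torsion (A := Additive T)
      (B := Fin n → QuasiCyclic p) hp
      (fun x => by
        obtain ⟨y, hy, hyx⟩ := h.div (Additive.toMul x : T) (Additive.toMul x).2
        exact ⟨Additive.ofMul ⟨y, hy⟩,
          congrArg Additive.ofMul (Subtype.ext hyx : (⟨y, hy⟩ : T) ^ p = Additive.toMul x)⟩)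
      (fun x => by
        obtain ⟨k, hk⟩ := h.tors (Additive.toMul x : T) (Additive.toMul x).2
        exact ⟨k, congrArg Additive.ofMul (Subtype.ext hk : (Additive.toMul x : T) ^ p ^ k = 1)⟩)
      (fun x => QuasiCyclic.pi_exists_smul_eq hp x) (fun x => QuasiCyclic.pi_torsion x)
      (Nat.finite_of_card_ne_zero (by
        change Nat.card {x : Additive T // p • x = 0} ≠ 0
        rw [hc]; exact pow_ne_zero _ hp.ne_zero))
      (by rw [hc, QuasiCyclic.pi_card_torsion hp n])
    exact ⟨(MulEquiv.toAdditive.symm e.symm : Multiplicative (Fin n → QuasiCyclic p) ≃* T).symm⟩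

/-! ### The maximal torus of an abelian $p$-group with finite $p$-torsion. -/

namespace Subgroup

variable {p : ℕ} {G : Type*} [Group G]

/-- The fibres of $x\mapsto x^p$ on `A` are cosets of the finite $p$-torsion. -/
theorem finite_pow_eq_one {A : Subgroup G} (hc : ∀ x ∈ A, ∀ y ∈ A, x * y = y * x)
    (hf : {x | x ∈ A ∧ x ^ p = 1}.Finite) (k : ℕ) : {x | x ∈ A ∧ x ^ p ^ k = 1}.Finite := by
  induction k with
  | zero =>
    refine (Set.finite_singleton (1 : G)).subset fun x hx => ?_
    simpa using hx.2
  | succ k ih =>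
    refine Set.Finite.of_finite_fibers (· ^ p) (ih.subset ?_) ?_
    · rintro _ ⟨x, hx, rfl⟩
      exact ⟨pow_mem hx.1 _, by rw [← pow_mul, ← pow_succ']; exact hx.2⟩
    · rintro _ ⟨x, hx, rfl⟩
      refine (hf.image (x * ·)).subset ?_
      rintro y ⟨hy, hyx⟩
      refine ⟨x⁻¹ * y, ⟨mul_mem (inv_mem hx.1) hy.1, ?_⟩, by simp⟩
      have hyx : y ^ p = x ^ p := hyx
      rw [Commute.mul_pow (hc _ (inv_mem hx.1) _ hy.1), hyx, inv_pow, inv_mul_cancel]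

/-- The $p$-torsion elements of $A^{p^k}$ form a decreasing chain of finite sets. Once this chain is
constant, so is the chain $A^{p^k}$ itself, by induction on the exponent of an element. -/
theorem exists_pow_stable {A : Subgroup G} (hc : ∀ x ∈ A, ∀ y ∈ A, x * y = y * x)
    (ht : ∀ x ∈ A, ∃ k : ℕ, x ^ p ^ k = 1) (hf : {x | x ∈ A ∧ x ^ p = 1}.Finite) :
    ∃ K : ℕ, ∀ a ∈ A, ∃ b ∈ A, b ^ p ^ (K + 1) = a ^ p ^ K := by
  let V : ℕ → Set G := fun k => {x | x ^ p = 1 ∧ ∃ a ∈ A, a ^ p ^ k = x}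
  have hV : Antitone V := antitone_nat_of_succ_le fun k x hx => by
    obtain ⟨h1, a, ha, rfl⟩ := hx
    exact ⟨h1, a ^ p, pow_mem ha _, by rw [← pow_mul, ← pow_succ']⟩
  have hVf : ∀ k, (V k).Finite := fun k => hf.subset fun x hx => by
    obtain ⟨h1, a, ha, rfl⟩ := hx
    exact ⟨pow_mem ha _, h1⟩
  obtain ⟨K, hK⟩ : ∃ K, ∀ j, K ≤ j → V K = V j := by
    have hW : Antitone fun k => (hVf k).toFinset := fun i j hij => by
      simpa using hV hij
    obtain ⟨K, hK⟩ := WellFoundedGT.monotone_chain_condition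
      (⟨fun k => OrderDual.toDual (hVf k).toFinset, hW⟩ : ℕ →o (Finset G)ᵒᵈ)
    refine ⟨K, fun j hj => ?_⟩
    have := hK j hj
    exact Set.Finite.toFinset_inj.1 this
  refine ⟨K, ?_⟩
  have key : ∀ (s j : ℕ) (a : G), a ∈ A → (a ^ p ^ K) ^ p ^ s = 1 → K ≤ j →
      ∃ b ∈ A, b ^ p ^ j = a ^ p ^ K := by
    intro s
    induction s with
    | zero =>
      intro j a ha h _
      exact ⟨1, one_mem _, by rw [one_pow]; simpa using h.symm⟩
    | succ s ih =>
      intro j a ha h hj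
      have h1 : (a ^ p ^ K) ^ p ^ s ∈ V K := by
        refine ⟨by rw [← pow_mul, ← pow_succ]; exact h, a ^ p ^ s, pow_mem ha _, ?_⟩
        rw [← pow_mul, ← pow_mul, mul_comm]
      -- This gives `b` such that `b ^ p ^ j` and `a ^ p ^ K` have the same `p ^ s`-th power; their
      -- quotient has smaller exponent and falls under the induction hypothesis.
      rw [hK (j + s) (by omega)] at h1
      obtain ⟨-, b, hb, hba⟩ := h1
      have hb' : (b⁻¹) ^ p ^ (j - K) ∈ A := pow_mem (inv_mem hb) _
      have hmul : (a * (b⁻¹) ^ p ^ (j - K)) ^ p ^ K = a ^ p ^ K * (b ^ p ^ j)⁻¹ := by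
        rw [Commute.mul_pow (hc _ ha _ hb'), ← pow_mul, ← pow_add, inv_pow]
        congr 4; omega
      have hcomm : Commute (a ^ p ^ K) (b ^ p ^ j)⁻¹ :=
        hc _ (pow_mem ha _) _ (inv_mem (pow_mem hb _))
      obtain ⟨c, hcA, hca⟩ := ih j (a * (b⁻¹) ^ p ^ (j - K)) (mul_mem ha hb')
        (by rw [hmul, Commute.mul_pow hcomm, ← hba, inv_pow, ← pow_mul, ← pow_add,
          mul_inv_cancel]) hj
      refine ⟨c * b, mul_mem hcA hb, ?_⟩
      rw [Commute.mul_pow (hc _ hcA _ hb), hca, hmul, inv_mul_cancel_right]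
  intro a ha
  obtain ⟨s, hs⟩ := ht _ (pow_mem ha (p ^ K))
  exact key s (K + 1) a ha hs (by omega)

/-- The torus is $A^{p^K}$ for the stable exponent `K`. A subgroup of powers is preserved by
whatever conjugation preserves `A`; and since it is divisible, each of its cosets in `A` has a
representative in the finite $p^K$-torsion. -/
theorem exists_isTorus_le (hp : p.Prime) {A : Subgroup G}
    (hc : ∀ x ∈ A, ∀ y ∈ A, x * y = y * x) (ht : ∀ x ∈ A, ∃ k : ℕ, x ^ p ^ k = 1)
    (hf : {x | x ∈ A ∧ x ^ p = 1}.Finite) :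
    ∃ D ≤ A, (∃ n, D.IsTorus p n) ∧ (∃ k : ℕ, D.relIndex A = p ^ k) ∧
      ∀ g : G, (∀ x ∈ A, g * x * g⁻¹ ∈ A) → ∀ x ∈ D, g * x * g⁻¹ ∈ D := by
  have := Fact.mk hp
  obtain ⟨K, hK⟩ := exists_pow_stable hc ht hf
  let D : Subgroup G :=
    { carrier := {x | ∃ a ∈ A, a ^ p ^ K = x}
      one_mem' := ⟨1, one_mem _, one_pow _⟩
      mul_mem' := by
        rintro _ _ ⟨a, ha, rfl⟩ ⟨b, hb, rfl⟩
        exact ⟨a * b, mul_mem ha hb, Commute.mul_pow (hc a ha b hb) _⟩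
      inv_mem' := by
        rintro _ ⟨a, ha, rfl⟩
        exact ⟨a⁻¹, inv_mem ha, inv_pow _ _⟩ }
  have hDA : D ≤ A := by
    rintro _ ⟨a, ha, rfl⟩
    exact pow_mem ha _
  have hdiv : ∀ x ∈ D, ∃ y ∈ D, y ^ p = x := by
    rintro _ ⟨a, ha, rfl⟩
    obtain ⟨b, hb, hba⟩ := hK a ha
    exact ⟨b ^ p ^ K, ⟨b, hb, rfl⟩, by rw [← pow_mul, ← pow_succ, hba]⟩
  have hdivk : ∀ k, ∀ x ∈ D, ∃ y ∈ D, y ^ p ^ k = x := by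
    intro k
    induction k with
    | zero => exact fun x hx => ⟨x, hx, by simp⟩
    | succ k ih =>
      intro x hx
      obtain ⟨y, hy, rfl⟩ := hdiv x hx
      obtain ⟨z, hz, rfl⟩ := ih y hy
      exact ⟨z, hz, by rw [pow_succ, pow_mul]⟩
  have hAp : IsPGroup p A := fun x => by
    obtain ⟨k, hk⟩ := ht x x.2
    exact ⟨k, Subtype.ext hk⟩
  refine ⟨D, hDA, ?_, ?_, ?_⟩
  · let E : Subgroup D :=
      { carrier := {x | x ^ p = 1}
        one_mem' := one_pow _
        mul_mem' := fun {a b} ha hb => by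
          have ha : a ^ p = 1 := ha
          have hb : b ^ p = 1 := hb
          change (a * b) ^ p = 1
          have hab : Commute a b := Subtype.ext (hc a (hDA a.2) b (hDA b.2))
          rw [hab.mul_pow, ha, hb, one_mul]
        inv_mem' := fun {a} ha => by
          have ha : a ^ p = 1 := ha
          change a⁻¹ ^ p = 1
          rw [inv_pow, ha, inv_one] }
    have e : E ≃ {x : G // x ∈ D ∧ x ^ p = 1} :=
      { toFun := fun x => ⟨x.1.1, x.1.2, congrArg Subtype.val x.2⟩
        invFun := fun x => ⟨⟨x.1, x.2.1⟩, Subtype.ext x.2.2⟩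
        left_inv := fun x => rfl
        right_inv := fun x => rfl }
    have : Finite {x : G // x ∈ D ∧ x ^ p = 1} := hf.subset fun x hx => ⟨hDA hx.1, hx.2⟩
    have : Finite E := Finite.of_equiv _ e.symm
    have hE : IsPGroup p E := fun x => ⟨1, by rw [pow_one]; exact Subtype.ext x.2⟩
    obtain ⟨n, hn⟩ := IsPGroup.iff_card.1 hE
    exact ⟨n, fun x hx y hy => hc x (hDA hx) y (hDA hy), hdiv, fun x hx => ht x (hDA hx),
      by rw [← hn, Nat.card_congr e]⟩
  · have hfin : Finite {x : G // x ∈ A ∧ x ^ p ^ K = 1} := finite_pow_eq_one hc hf K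
    have hq : Finite (A ⧸ D.subgroupOf A) := by
      refine Finite.of_surjective (fun x : {x : G // x ∈ A ∧ x ^ p ^ K = 1} =>
        ((⟨x.1, x.2.1⟩ : A) : A ⧸ D.subgroupOf A)) fun q => ?_
      obtain ⟨a, rfl⟩ := QuotientGroup.mk_surjective q
      obtain ⟨d, hd, hda⟩ := hdivk K (a ^ p ^ K) ⟨a, a.2, rfl⟩
      have hcom : Commute (a : G) d⁻¹ := hc _ a.2 _ (inv_mem (hDA hd))
      refine ⟨⟨a * d⁻¹, mul_mem a.2 (inv_mem (hDA hd)), ?_⟩, ?_⟩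
      · rw [hcom.mul_pow, inv_pow, hda, mul_inv_cancel]
      · refine QuotientGroup.eq.2 ?_
        rw [mem_subgroupOf]
        change ((a : G) * d⁻¹)⁻¹ * a ∈ D
        simpa using hd
    have : (D.subgroupOf A).FiniteIndex := finiteIndex_of_finite_quotient
    exact hAp.index _
  · rintro g hg _ ⟨a, ha, rfl⟩
    exact ⟨g * a * g⁻¹, hg a ha, by simp [conj_pow]⟩

end Subgroup

/-! ### Rank and rigidity of tori. -/

namespace Subgroup.IsTorus

variable {p : ℕ} {G : Type*} [Group G] {T : Subgroup G} {n : ℕ}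

theorem exists_pow_eq (h : T.IsTorus p n) (k : ℕ) : ∀ x ∈ T, ∃ y ∈ T, y ^ p ^ k = x := by
  induction k with
  | zero => exact fun x hx => ⟨x, hx, by simp⟩
  | succ k ih =>
    intro x hx
    obtain ⟨y, hy, rfl⟩ := h.div x hx
    obtain ⟨z, hz, rfl⟩ := ih y hy
    exact ⟨z, hz, by rw [pow_succ, pow_mul]⟩

theorem finite_torsion (hp : p.Prime) (h : T.IsTorus p n) (k : ℕ) :
    {x | x ∈ T ∧ x ^ p ^ k = 1}.Finite := by
  refine finite_pow_eq_one h.comm ?_ k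
  have : Nat.card {x : G // x ∈ T ∧ x ^ p = 1} ≠ 0 := by
    rw [h.card]; exact pow_ne_zero _ hp.ne_zero
  exact Nat.finite_of_card_ne_zero this

theorem finite_subtype (hp : p.Prime) (h : T.IsTorus p n) : Finite {x : G // x ∈ T ∧ x ^ p = 1} := by
  have h1 := h.finite_torsion hp 1
  rw [pow_one] at h1
  exact h1

theorem isPGroup (h : T.IsTorus p n) : IsPGroup p T := fun x => by
  obtain ⟨k, hk⟩ := h.tors x x.2
  exact ⟨k, Subtype.ext hk⟩

theorem map {H : Type*} [Group H] (h : T.IsTorus p n) (f : G →* H) (hf : Set.InjOn f T) :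
    (T.map f).IsTorus p n where
  comm := by
    rintro _ ⟨x, hx, rfl⟩ _ ⟨y, hy, rfl⟩
    rw [← map_mul, ← map_mul, h.comm x hx y hy]
  div := by
    rintro _ ⟨x, hx, rfl⟩
    obtain ⟨y, hy, rfl⟩ := h.div x hx
    exact ⟨f y, ⟨y, hy, rfl⟩, (map_pow f y p).symm⟩
  tors := by
    rintro _ ⟨x, hx, rfl⟩
    obtain ⟨k, hk⟩ := h.tors x hx
    exact ⟨k, by rw [← map_pow, hk, map_one]⟩
  card := by
    rw [← h.card]
    symm
    refine Nat.card_eq_of_bijective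
      (fun x => ⟨f x.1, ⟨x.1, x.2.1, rfl⟩, by rw [← map_pow, x.2.2, map_one]⟩) ⟨?_, ?_⟩
    · intro x y hxy
      exact Subtype.ext (hf x.2.1 y.2.1 (congrArg Subtype.val hxy))
    · rintro ⟨_, ⟨x, hx, rfl⟩, hxp⟩
      refine ⟨⟨x, hx, hf (pow_mem hx _) (one_mem _) ?_⟩, rfl⟩
      rw [map_pow, hxp, map_one]

/-- A homomorphism from a torus lands in every normal subgroup of `p`-power index. -/
theorem map_le {H : Type*} [Group H] (h : T.IsTorus p n) (f : T →* H) {U : Subgroup H}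
    (hU : U.Normal) {k : ℕ} (hk : U.index = p ^ k) (x : T) : f x ∈ U := by
  obtain ⟨y, hy, hyx⟩ := h.exists_pow_eq k x x.2
  have : x = (⟨y, hy⟩ : T) ^ p ^ k := Subtype.ext hyx.symm
  rw [this, map_pow, ← hk]
  exact U.pow_index_mem _

theorem rank_le (hp : p.Prime) (h : T.IsTorus p n) {U : Subgroup G} {m : ℕ} (hU : U.IsTorus p m)
    (hTU : T ≤ U) : n ≤ m := by
  have : Finite {x : G // x ∈ U ∧ x ^ p = 1} := hU.finite_subtype hp
  have h1 := Nat.card_le_card_of_injective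
    (fun x : {x : G // x ∈ T ∧ x ^ p = 1} =>
      (⟨x.1, hTU x.2.1, x.2.2⟩ : {x : G // x ∈ U ∧ x ^ p = 1}))
    fun x y hxy => Subtype.ext (congrArg (fun z => z.1) hxy)
  rw [h.card, hU.card] at h1
  exact (Nat.pow_le_pow_iff_right hp.one_lt).1 h1

/-- Equal rank means that `T` contains all the $p$-torsion of `U`; divisibility of `T` then captures
elements of higher order one power of $p$ at a time. -/
theorem eq_of_le (hp : p.Prime) (h : T.IsTorus p n) {U : Subgroup G} (hU : U.IsTorus p n)
    (hTU : T ≤ U) : T = U := by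
  have : Finite {x : G // x ∈ U ∧ x ^ p = 1} := hU.finite_subtype hp
  have : Finite {x : G // x ∈ T ∧ x ^ p = 1} := h.finite_subtype hp
  let f : {x : G // x ∈ T ∧ x ^ p = 1} → {x : G // x ∈ U ∧ x ^ p = 1} :=
    fun x => ⟨x.1, hTU x.2.1, x.2.2⟩
  have hf : Function.Bijective f := by
    refine (Nat.bijective_iff_injective_and_card f).2 ⟨fun x y hxy => ?_, ?_⟩
    · exact Subtype.ext (congrArg (fun z => z.1) hxy)
    · rw [h.card, hU.card]
  refine le_antisymm hTU fun x hx => ?_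
  have key : ∀ (k : ℕ), ∀ x ∈ U, x ^ p ^ k = 1 → x ∈ T := by
    intro k
    induction k with
    | zero =>
      intro x _ hx
      have : x = 1 := by simpa using hx
      exact this ▸ one_mem _
    | succ k ih =>
      intro x hxU hx
      obtain ⟨y, hy, hyx⟩ := h.div _ (ih (x ^ p) (pow_mem hxU _) (by rwa [← pow_mul, ← pow_succ']))
      have hcom : Commute x y⁻¹ := hU.comm _ hxU _ (inv_mem (hTU hy))
      obtain ⟨z, hz⟩ := hf.2 ⟨x * y⁻¹, mul_mem hxU (inv_mem (hTU hy)), by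
        rw [hcom.mul_pow, inv_pow, hyx, mul_inv_cancel]⟩
      have hz' : (z : G) = x * y⁻¹ := congrArg Subtype.val hz
      have : x = z * y := by rw [hz', inv_mul_cancel_right]
      exact this ▸ mul_mem z.2.1 hy
  obtain ⟨k, hk⟩ := hU.tors x hx
  exact key k x hx hk

end Subgroup.IsTorus

theorem IsPGroup.of_normal_index {p : ℕ} {G : Type*} [Group G] {T : Subgroup G} (hT : T.Normal)
    (h : IsPGroup p T) {k : ℕ} (hk : T.index = p ^ k) : IsPGroup p G := fun g => by
  obtain ⟨j, hj⟩ := h ⟨g ^ p ^ k, hk ▸ T.pow_index_mem g⟩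
  exact ⟨k + j, by rw [pow_add, pow_mul]; exact congrArg Subtype.val hj⟩

/-! ### Uniqueness of the identity component. -/

namespace IsIdentityComponent

variable {p : ℕ} {G : Type*} [Group G] {T : Subgroup G} {n : ℕ}

theorem isTorus (hp : p.Prime) (h : IsIdentityComponent p T n) : T.IsTorus p n :=
  (isDiscretePTorusOfRank_iff hp T n).1 h.torus

/-- Identity components are functorial for all homomorphisms, because divisible elements die in the
finite $p$-group `H/U`. Uniqueness and the comparison of orders rest on this. -/
theorem map_le (hp : p.Prime) (h : IsIdentityComponent p T n) {H : Type*} [Group H]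
    {U : Subgroup H} {m : ℕ} (hU : IsIdentityComponent p U m) (f : G →* H) : T.map f ≤ U := by
  rintro _ ⟨x, hx, rfl⟩
  obtain ⟨k, hk⟩ := hU.index_eq
  exact (h.isTorus hp).map_le (f.comp T.subtype) hU.normal hk ⟨x, hx⟩

theorem eq_and_eq (hp : p.Prime) (h : IsIdentityComponent p T n) {U : Subgroup G} {m : ℕ}
    (hU : IsIdentityComponent p U m) : T = U ∧ n = m := by
  have h1 : T ≤ U := by simpa using h.map_le hp hU (MonoidHom.id G)
  have h2 : U ≤ T := by simpa using hU.map_le hp h (MonoidHom.id G)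
  exact ⟨le_antisymm h1 h2, le_antisymm ((h.isTorus hp).rank_le hp (hU.isTorus hp) h1)
    ((hU.isTorus hp).rank_le hp (h.isTorus hp) h2)⟩

theorem order_eq (hp : p.Prime) (h : IsIdentityComponent p T n) :
    pToralOrder p G = toLex (n, T.index) := by
  have h1 : {n | ∃ T : Subgroup G, IsIdentityComponent p T n} = {n} := by
    ext m
    constructor
    · rintro ⟨U, hU⟩
      exact (h.eq_and_eq hp hU).2.symm
    · rintro rfl
      exact ⟨T, h⟩
  have h2 : {m | ∃ (T : Subgroup G) (n : ℕ), IsIdentityComponent p T n ∧ T.index = m}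
      = {T.index} := by
    ext m
    constructor
    · rintro ⟨U, k, hU, rfl⟩
      rw [(h.eq_and_eq hp hU).1]
      rfl
    · rintro rfl
      exact ⟨T, n, h, rfl⟩
  rw [pToralOrder, h1, h2, csInf_singleton, csInf_singleton]

theorem finiteIndex (hp : p.Prime) (h : IsIdentityComponent p T n) : T.FiniteIndex := by
  obtain ⟨k, hk⟩ := h.index_eq
  exact ⟨by rw [hk]; exact pow_ne_zero _ hp.ne_zero⟩

end IsIdentityComponent

/-! ### Heredity, monotonicity of the order, and the descending chain condition. -/

namespace IsDiscretePToral

variable {p : ℕ} {G H : Type*} [Group G] [Group H]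

theorem isPGroup (hp : p.Prime) (h : IsDiscretePToral p G) : IsPGroup p G := by
  obtain ⟨T, n, hT⟩ := h
  obtain ⟨k, hk⟩ := hT.index_eq
  exact (hT.isTorus hp).isPGroup.of_normal_index hT.normal hk

/-- The preimage of the torus need not be divisible, but it is abelian with finite $p$-torsion; its
maximal torus is invariant under conjugation, hence normal in `G`. -/
theorem of_injective (hp : p.Prime) (h : IsDiscretePToral p H) (f : G →* H)
    (hf : Function.Injective f) : IsDiscretePToral p G := by
  obtain ⟨T, n, hT⟩ := h
  have hTt := hT.isTorus hp
  have := hT.normal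
  obtain ⟨D, hDA, ⟨m, hD⟩, ⟨k, hk⟩, hconj⟩ := Subgroup.exists_isTorus_le (A := T.comap f) hp
    (fun x hx y hy => hf (by rw [map_mul, map_mul]; exact hTt.comm _ hx _ hy))
    (fun x hx => by
      obtain ⟨k, hk⟩ := hTt.tors _ hx
      exact ⟨k, hf (by rw [map_pow, hk, map_one])⟩)
    (by
      have h1 : {x | x ∈ T ∧ x ^ p = 1}.Finite := by simpa using hTt.finite_torsion hp 1
      refine (h1.preimage hf.injOn).subset fun x hx => ⟨hx.1, ?_⟩
      rw [← map_pow, hx.2, map_one])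
  obtain ⟨j, hj⟩ := hT.index_eq
  have hdvd : (T.comap f).index ∣ p ^ j := by
    rw [Subgroup.index_comap, ← hj]
    exact T.relIndex_dvd_index_of_normal _
  obtain ⟨i, -, hi⟩ := (Nat.dvd_prime_pow hp).1 hdvd
  refine ⟨D, m, ⟨fun x hx g => hconj g (fun y hy => ?_) x hx⟩,
    (isDiscretePTorusOfRank_iff hp D m).2 hD, k + i, ?_⟩
  · exact (inferInstance : (T.comap f).Normal).conj_mem y hy g
  · rw [← Subgroup.relIndex_mul_index hDA, hk, hi, pow_add]

theorem subgroup (hp : p.Prime) (h : IsDiscretePToral p G) (K : Subgroup G) :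
    IsDiscretePToral p K :=
  h.of_injective hp K.subtype K.subtype_injective

/-- The identity component `T` embeds in `U`, so the rank cannot drop. If the ranks agree, then `T`
maps onto `U` and the component count of `G` is $[f(G):U]$, a divisor of $[H:U]$; equality forces
$f(G)=H$. -/
theorem order_le_and_surjective (hp : p.Prime) (h : IsDiscretePToral p H) (f : G →* H)
    (hf : Function.Injective f) : pToralOrder p G ≤ pToralOrder p H ∧
      (pToralOrder p H ≤ pToralOrder p G → Function.Surjective f) := by
  obtain ⟨T, n, hT⟩ := h.of_injective hp f hf
  obtain ⟨U, m, hU⟩ := h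
  have hle := hT.map_le hp hU f
  have hmap := (hT.isTorus hp).map f hf.injOn
  have hnm := hmap.rank_le hp (hU.isTorus hp) hle
  have := hU.normal
  have := hU.finiteIndex hp
  rw [hT.order_eq hp, hU.order_eq hp]
  rcases hnm.lt_or_eq with hlt | rfl
  · refine ⟨Prod.Lex.le_iff.2 (Or.inl hlt), fun h => ?_⟩
    rcases Prod.Lex.le_iff.1 h with h | h
    · exact absurd h (by simpa using hlt.le)
    · exact absurd h.1 (by simpa using hlt.ne')
  · have heq : T.map f = U := hmap.eq_of_le hp (hU.isTorus hp) hle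
    have hT' : T = U.comap f := by rw [← heq, Subgroup.comap_map_eq_self_of_injective hf]
    have hidx : T.index = U.relIndex f.range := by rw [hT', Subgroup.index_comap]
    have hUr : U ≤ f.range := by rw [← heq]; exact Subgroup.map_le_range f T
    have hmul := Subgroup.relIndex_mul_index hUr
    refine ⟨Prod.Lex.le_iff.2 (Or.inr ⟨rfl, ?_⟩), fun h => ?_⟩
    · change T.index ≤ U.index
      rw [hidx]
      exact Nat.le_of_dvd (Nat.pos_of_ne_zero Subgroup.FiniteIndex.index_ne_zero)
        (Dvd.intro _ hmul)
    · have h2 : U.index ≤ T.index := by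
        rcases Prod.Lex.le_iff.1 h with h | h
        · exact absurd h (lt_irrefl _)
        · exact h.2
      rw [hidx, ← hmul] at h2
      have h0 : U.relIndex f.range * f.range.index ≠ 0 := by
        rw [hmul]; exact Subgroup.FiniteIndex.index_ne_zero
      have h3 : f.range.index = 1 := by
        have ha : 0 < U.relIndex f.range := Nat.pos_of_ne_zero (left_ne_zero_of_mul h0)
        have hb := right_ne_zero_of_mul h0
        have hc : f.range.index ≤ 1 := by
          by_contra hcon
          have := Nat.mul_lt_mul_of_pos_left (not_le.1 hcon) ha
          omega
        omega
      exact MonoidHom.range_eq_top.1 (Subgroup.index_eq_one.1 h3)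

theorem order_le (hp : p.Prime) (h : IsDiscretePToral p H) (f : G →* H)
    (hf : Function.Injective f) : pToralOrder p G ≤ pToralOrder p H :=
  (h.order_le_and_surjective hp f hf).1

theorem surjective_of_order_le (hp : p.Prime) (h : IsDiscretePToral p H) (f : G →* H)
    (hf : Function.Injective f) (hle : pToralOrder p H ≤ pToralOrder p G) :
    Function.Surjective f :=
  (h.order_le_and_surjective hp f hf).2 hle

theorem order_congr (hp : p.Prime) (h : IsDiscretePToral p H) (e : G ≃* H) :
    pToralOrder p G = pToralOrder p H :=
  le_antisymm (h.order_le hp e.toMonoidHom e.injective)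
    ((h.of_injective hp e.toMonoidHom e.injective).order_le hp e.symm.toMonoidHom
      e.symm.injective)

/-- The orders decrease in a well-ordered set, and an inclusion between groups of equal order is
onto. -/
theorem antitone_stabilizes (hp : p.Prime) (h : IsDiscretePToral p G) (A : ℕ → Subgroup G)
    (hA : Antitone A) : ∃ n, ∀ m, n ≤ m → A m = A n := by
  have hmono : Antitone fun n => pToralOrder p (A n) := fun i j hij =>
    (h.subgroup hp (A i)).order_le hp (Subgroup.inclusion (hA hij))
      (Subgroup.inclusion_injective _)
  obtain ⟨n, hn⟩ := WellFoundedGT.monotone_chain_condition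
    (⟨fun n => OrderDual.toDual (pToralOrder p (A n)), hmono⟩ : ℕ →o (ℕ ×ₗ ℕ)ᵒᵈ)
  refine ⟨n, fun m hm => le_antisymm (hA hm) fun x hx => ?_⟩
  have hnm : pToralOrder p (A n) = pToralOrder p (A m) := hn m hm
  obtain ⟨y, hy⟩ := (h.subgroup hp (A n)).surjective_of_order_le hp
    (Subgroup.inclusion (hA hm)) (Subgroup.inclusion_injective _) hnm.le ⟨x, hx⟩
  have : (y : G) = x := congrArg Subtype.val hy
  exact this ▸ y.2

end IsDiscretePToral

/-! ### The norm map and the existence of fully normalized conjugates. -/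

/-- `P` acts on `T` through a finite group whose order divides `T.index`, since $T\cap P$ acts
trivially. The map `ν` is the norm of this action, raised to the power `d` that makes the exponents
add up to `T.index`. Its values are fixed by `P`. If `t` normalizes `P`, then $t^{[G:T]}\nu(t)^{-1}$
is a product of commutators $[t,g]$ with $g\in P$, which lie in `P`. -/
theorem Subgroup.exists_norm {G : Type*} [Group G] {T : Subgroup G} (hT : T.Normal)
    (hc : ∀ x ∈ T, ∀ y ∈ T, x * y = y * x) (hT0 : T.index ≠ 0) (P : Subgroup G) :
    ∃ ν : T →* T, (∀ t : T, ∀ g ∈ P, g * (ν t : G) * g⁻¹ = ν t) ∧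
      ∀ t : T, (∀ g ∈ P, (t : G) * g * (t : G)⁻¹ ∈ P) →
        (t : G) ^ T.index * (ν t : G)⁻¹ ∈ P := by
  let c : P →* MulAut T := MulAut.conjNormal.comp P.subtype
  have hker : T.subgroupOf P ≤ c.ker := by
    intro x hx
    rw [MonoidHom.mem_ker]
    ext t
    change (x : G) * t * (x : G)⁻¹ = t
    rw [hc x hx t t.2, mul_inv_cancel_right]
  have hdvd : Nat.card c.range ∣ T.index := by
    rw [← Subgroup.index_ker]
    exact (Subgroup.index_dvd_of_le hker).trans (T.relIndex_dvd_index_of_normal P)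
  obtain ⟨d, hd⟩ := hdvd
  have hfin : Finite c.range := Nat.finite_of_card_ne_zero fun h0 => hT0 (by rw [hd, h0, zero_mul])
  let _ : Fintype c.range := Fintype.ofFinite _
  let _ : CommGroup T :=
    { (inferInstance : Group T) with
      mul_comm := fun x y => Subtype.ext (hc x x.2 y y.2) }
  let N : T →* T :=
    { toFun := fun t => ∏ γ : c.range, (γ : MulAut T) t
      map_one' := by simp
      map_mul' := fun x y => by simp [Finset.prod_mul_distrib] }
  have hN : ∀ t, ∀ γ : c.range, (γ : MulAut T) (N t) = N t := by
    intro t γ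
    change (γ : MulAut T) (∏ δ : c.range, (δ : MulAut T) t) = ∏ δ : c.range, (δ : MulAut T) t
    rw [map_prod]
    exact Fintype.prod_equiv (Equiv.mulLeft γ) _ _ fun δ => rfl
  refine ⟨(powMonoidHom d).comp N, fun t g hg => ?_, fun t ht => ?_⟩
  · have h1 := hN t ⟨c ⟨g, hg⟩, ⟨_, rfl⟩⟩
    have h2 : c ⟨g, hg⟩ (N t ^ d) = N t ^ d := by
      rw [map_pow]
      exact congrArg (· ^ d) h1
    exact congrArg Subtype.val h2
  · have h1 : t ^ T.index * (N t ^ d)⁻¹ = (∏ γ : c.range, t * ((γ : MulAut T) t)⁻¹) ^ d := by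
      rw [Finset.prod_mul_distrib, Finset.prod_inv_distrib, Finset.prod_const, Finset.card_univ,
        mul_pow, ← pow_mul, inv_pow, hd, Nat.card_eq_fintype_card]
      rfl
    have h2 : ∏ γ : c.range, t * ((γ : MulAut T) t)⁻¹ ∈ P.subgroupOf T := by
      refine Subgroup.prod_mem _ fun γ _ => ?_
      obtain ⟨γ, g, rfl⟩ := γ
      rw [Subgroup.mem_subgroupOf]
      change (t : G) * ((g : G) * t * (g : G)⁻¹)⁻¹ ∈ P
      have : (t : G) * ((g : G) * t * (g : G)⁻¹)⁻¹ = (t * g * (t : G)⁻¹) * (g : G)⁻¹ := by group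
      rw [this]
      exact mul_mem (ht g g.2) (inv_mem g.2)
    have h3 := pow_mem h2 d
    rw [← h1] at h3
    exact h3

namespace FusionSystem

variable {p : ℕ} {S : Type*} [Group S]

/-- Each element of the identity component of $N_S(P)$ is a power $b^{p^k}$, and the norm writes it
as an element of $P$ times one that centralizes $P$. So the identity component acts on $P$ by inner
automorphisms. -/
theorem inn_relIndex_autS_ne_zero (hp : p.Prime) (hS : IsDiscretePToral p S) (P : Subgroup S) :
    (inn P).relIndex (autS P) ≠ 0 := by
  obtain ⟨T, n, hT⟩ := hS.subgroup hp (Subgroup.normalizer (P : Set S))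
  have hTt := hT.isTorus hp
  have hT0 : T.index ≠ 0 := (hT.finiteIndex hp).index_ne_zero
  obtain ⟨ν, hν1, hν2⟩ := Subgroup.exists_norm hT.normal hTt.comm hT0
    (P.subgroupOf (Subgroup.normalizer (P : Set S)))
  obtain ⟨k, hk⟩ := hT.index_eq
  have hle : T ≤ (inn P).comap P.normalizerMonoidHom := by
    intro x hx
    obtain ⟨b, hb, rfl⟩ := hTt.exists_pow_eq k x hx
    have h1 := hν2 ⟨b, hb⟩ fun g hg => (Subgroup.mem_normalizer_iff.1 b.2 g).1 hg
    rw [hk] at h1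
    set c := b ^ p ^ k * (ν ⟨b, hb⟩ : Subgroup.normalizer (P : Set S))⁻¹ with hcdef
    have hx : b ^ p ^ k = c * (ν ⟨b, hb⟩ : Subgroup.normalizer (P : Set S)) := by
      rw [hcdef, inv_mul_cancel_right]
    refine ⟨⟨c, h1⟩, ?_⟩
    ext y
    have h2 := hν1 ⟨b, hb⟩ ⟨y, Subgroup.le_normalizer y.2⟩ y.2
    have h3 : (y : S) * (ν ⟨b, hb⟩ : Subgroup.normalizer (P : Set S)) * (y : S)⁻¹
        = (ν ⟨b, hb⟩ : Subgroup.normalizer (P : Set S)) := congrArg Subtype.val h2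
    rw [hx]
    change (c : S) * y * (c : S)⁻¹ =
      ((c : S) * (ν ⟨b, hb⟩ : Subgroup.normalizer (P : Set S))) * y *
        ((c : S) * (ν ⟨b, hb⟩ : Subgroup.normalizer (P : Set S)))⁻¹
    have h4 := mul_inv_eq_iff_eq_mul.1 h3
    rw [mul_assoc (c : S) _ (y : S), ← h4]
    group
  rw [autS, ← Subgroup.index_comap]
  exact fun h0 => hT0 (Nat.eq_zero_of_zero_dvd (h0 ▸ Subgroup.index_dvd_of_le hle))

/-- The rank is at most that of `S`. For the component count, the norm shows that $p^{k+j}$-th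
powers of elements of $T\cap N_S(R)$ lie in the identity component `U` of $N_S(R)$. Hence the cosets
of `U` in $T\cap N_S(R)$ are represented by $p^{k+j}$-torsion of `T`, a finite set that does not
depend on `R`. -/
theorem exists_order_normalizer_bound (hp : p.Prime) (hS : IsDiscretePToral p S)
    (P : Subgroup S) : ∃ r B : ℕ, ∀ R : Subgroup S, Nonempty (P ≃* R) → ∃ n ≤ r, ∃ m ≤ B,
      pToralOrder p (Subgroup.normalizer (R : Set S)) = toLex (n, m) := by
  obtain ⟨T, r, hT⟩ := hS
  have hTt := hT.isTorus hp
  have hTn := hT.normal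
  have hT0 : T.index ≠ 0 := (hT.finiteIndex hp).index_ne_zero
  obtain ⟨k, hk⟩ := hT.index_eq
  obtain ⟨P₀, s, hP₀⟩ := IsDiscretePToral.subgroup hp ⟨T, r, hT⟩ P
  have hP₀n := hP₀.normal
  obtain ⟨j, hj⟩ := hP₀.index_eq
  have hXfin := hTt.finite_torsion hp (k + j)
  refine ⟨r, Nat.card {x | x ∈ T ∧ x ^ p ^ (k + j) = 1} * p ^ k, fun R ⟨e⟩ => ?_⟩
  have hN := IsDiscretePToral.subgroup hp ⟨T, r, hT⟩ (Subgroup.normalizer (R : Set S))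
  obtain ⟨U, n, hU⟩ := hN
  have hUt := hU.isTorus hp
  have hUT : U.map (Subgroup.subtype _) ≤ T := hU.map_le hp hT (Subgroup.subtype _)
  obtain ⟨l, hl⟩ := hU.index_eq
  refine ⟨n, (hUt.map (Subgroup.subtype _) (Subgroup.subtype_injective _).injOn).rank_le hp hTt
    hUT, U.index, ?_, hU.order_eq hp⟩
  obtain ⟨ν, hν1, hν2⟩ := Subgroup.exists_norm hTn hTt.comm hT0 R
  let A : Subgroup (Subgroup.normalizer (R : Set S)) := T.subgroupOf _
  have hUA : U ≤ A := fun x hx => hUT ⟨x, hx, rfl⟩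
  have hνN : ∀ t, (ν t : S) ∈ Subgroup.normalizer (R : Set S) := fun t => by
    refine Subgroup.centralizer_le_normalizer _ (Subgroup.mem_centralizer_iff.2 fun g hg => ?_)
    exact mul_inv_eq_iff_eq_mul.1 (hν1 t g hg)
  -- The norm is a homomorphism from a torus to $N_S(R)$, so it lands in the identity component.
  have hνU : ∀ t, (⟨ν t, hνN t⟩ : Subgroup.normalizer (R : Set S)) ∈ U := fun t =>
    hTt.map_le ((T.subtype.comp ν).codRestrict _ hνN) hU.normal hl t
  have hpow : ∀ t ∈ A, t ^ p ^ (k + j) ∈ U := by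
    intro t ht
    have h1 := hν2 ⟨t, ht⟩ fun g hg => (Subgroup.mem_normalizer_iff.1 t.2 g).1 hg
    rw [hk] at h1
    have hq : e (e.symm ⟨_, h1⟩ ^ p ^ j) = (⟨_, h1⟩ : R) ^ p ^ j := by
      rw [map_pow, e.apply_symm_apply]
    have h2 : Subgroup.inclusion Subgroup.le_normalizer ((⟨_, h1⟩ : R) ^ p ^ j) ∈ U := by
      rw [← hq]
      refine hP₀.map_le hp hU ((Subgroup.inclusion (Subgroup.le_normalizer (H := R))).comp
        e.toMonoidHom) ⟨_, ?_, rfl⟩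
      rw [← hj]
      exact P₀.pow_index_mem _
    have h3 := mul_mem h2 (pow_mem (hνU ⟨t, ht⟩) (p ^ j))
    convert h3 using 1
    ext
    change (t : S) ^ p ^ (k + j) =
      ((t : S) ^ p ^ k * (ν ⟨t, ht⟩ : S)⁻¹) ^ p ^ j * (ν ⟨t, ht⟩ : S) ^ p ^ j
    have hcom : Commute ((t : S) ^ p ^ k) (ν ⟨t, ht⟩ : S)⁻¹ :=
      hTt.comm _ (pow_mem ht _) _ (inv_mem (ν ⟨t, ht⟩).2)
    rw [hcom.mul_pow, inv_pow, inv_mul_cancel_right, ← pow_mul, ← pow_add]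
  have hAidx : A.index ≤ p ^ k := by
    rw [← hk]
    exact Nat.le_of_dvd (Nat.pos_of_ne_zero hT0) (T.relIndex_dvd_index_of_normal _)
  rw [← Subgroup.relIndex_mul_index hUA]
  refine Nat.mul_le_mul ?_ hAidx
  have hX : Finite {x | x ∈ T ∧ x ^ p ^ (k + j) = 1} := hXfin
  let Y := {x : Subgroup.normalizer (R : Set S) // x ∈ A ∧ x ^ p ^ (k + j) = 1}
  let i : Y → {x | x ∈ T ∧ x ^ p ^ (k + j) = 1} := fun y =>
    ⟨y.1, y.2.1, congrArg Subtype.val y.2.2⟩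
  have hi : Function.Injective i := fun y z hyz => by
    have h : ((i y : S)) = i z := by rw [hyz]
    exact Subtype.ext (Subtype.ext h)
  have hYfin : Finite Y := Finite.of_injective i hi
  refine le_trans (Nat.card_le_card_of_surjective
    (fun y : Y => ((⟨y.1, y.2.1⟩ : A) : A ⧸ U.subgroupOf A)) fun q => ?_)
    (Nat.card_le_card_of_injective i hi)
  obtain ⟨a, rfl⟩ := QuotientGroup.mk_surjective q
  obtain ⟨d, hd, hda⟩ := hUt.exists_pow_eq (k + j) _ (hpow a a.2)
  have hcom : Commute (a : Subgroup.normalizer (R : Set S)) d⁻¹ :=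
    Subtype.ext (hTt.comm _ a.2 _ (inv_mem (hUA hd)))
  refine ⟨⟨a * d⁻¹, mul_mem a.2 (inv_mem (hUA hd)), ?_⟩, ?_⟩
  · rw [hcom.mul_pow, inv_pow, hda, mul_inv_cancel]
  · refine QuotientGroup.eq.2 ?_
    rw [Subgroup.mem_subgroupOf]
    change ((a : Subgroup.normalizer (R : Set S)) * d⁻¹)⁻¹ * a ∈ U
    simpa using hd

theorem IsConj.refl (F : FusionSystem S) (P : Subgroup S) : F.IsConj P P :=
  ⟨MulEquiv.refl P, F.inclusion_mem le_rfl, F.inclusion_mem le_rfl⟩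

theorem IsConj.trans {F : FusionSystem S} {P Q R : Subgroup S} (h : F.IsConj P Q)
    (h' : F.IsConj Q R) : F.IsConj P R := by
  obtain ⟨e, he, he'⟩ := h
  obtain ⟨f, hf, hf'⟩ := h'
  exact ⟨e.trans f, F.comp_mem he hf, F.comp_mem hf' he'⟩

/-- A conjugacy class may be infinite, and bounded rank alone would not give a lexicographic
maximum; the bound on both coordinates leaves finitely many orders. -/
theorem exists_isFullyNormalized (hp : p.Prime) (hS : IsDiscretePToral p S) (F : FusionSystem S)
    (P : Subgroup S) : ∃ R, F.IsConj P R ∧ F.IsFullyNormalized p R := by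
  obtain ⟨r, B, hrB⟩ := exists_order_normalizer_bound hp hS P
  let X : Set (ℕ ×ₗ ℕ) :=
    (fun R : Subgroup S => pToralOrder p (Subgroup.normalizer (R : Set S))) '' {R | F.IsConj P R}
  have hX : X.Finite := by
    refine ((Set.finite_Iic r).prod (Set.finite_Iic B)).image toLex |>.subset ?_
    rintro _ ⟨R, ⟨e, -⟩, rfl⟩
    obtain ⟨n, hn, m, hm, h⟩ := hrB R ⟨e⟩
    exact ⟨(n, m), ⟨hn, hm⟩, h.symm⟩
  obtain ⟨x, ⟨R, hR, rfl⟩, hmax⟩ := Set.exists_max_image X id hX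
    ⟨_, P, IsConj.refl F P, rfl⟩
  exact ⟨R, hR, fun R' hR' => hmax _ ⟨R', hR.trans hR', rfl⟩⟩

end FusionSystem

/-! ### Sylow arguments for subgroups of index prime to $p$. -/

namespace Subgroup

variable {p : ℕ} {G : Type*} [Group G]

/-- An abstract form of Sylow's conjugacy theorem. -/
theorem exists_smul_mem_of_isPGroup (hp : p.Prime) {U H V : Subgroup G} (hVH : V ≤ H)
    (hV : IsPGroup p V) (hU : ¬p ∣ U.relIndex H) :
    ∃ h ∈ H, ∀ v ∈ V, h * v * h⁻¹ ∈ U := by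
  have := Fact.mk hp
  have hact : IsPGroup p (V.subgroupOf H) := hV.of_equiv (Subgroup.subgroupOfEquivOfLe hVH).symm
  obtain ⟨x, hx⟩ := hact.nonempty_fixed_point_of_prime_not_dvd_card (H ⧸ U.subgroupOf H) hU
  obtain ⟨h, rfl⟩ := QuotientGroup.mk_surjective x
  refine ⟨h⁻¹, inv_mem h.2, fun v hv => ?_⟩
  have h1 := hx ⟨⟨v, hVH hv⟩, hv⟩
  have h2 : ((⟨v, hVH hv⟩ * h : H) : H ⧸ U.subgroupOf H) = h := h1
  have h3 := QuotientGroup.eq.1 h2.symm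
  rw [mem_subgroupOf] at h3
  simpa [mul_assoc] using h3

/-- If `U` has index prime to `p` in `G`, then so has some conjugate of `U` in `H ≤ G`. -/
theorem exists_not_dvd_relIndex {U : Subgroup G} (hU : ¬p ∣ U.index)
    (H : Subgroup G) : ∃ g : G, ¬p ∣ (U.comap (MulAut.conj g).toMonoidHom).relIndex H := by
  by_contra! hcon
  have hfin : Finite (G ⧸ U) := Nat.finite_of_card_ne_zero fun h0 => hU (by
    change p ∣ Nat.card (G ⧸ U)
    rw [h0]; exact dvd_zero p)
  refine hU ?_
  change p ∣ Nat.card (G ⧸ U)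
  let _ : Fintype (MulAction.orbitRel.Quotient H (G ⧸ U)) :=
    @Fintype.ofFinite _ (Quotient.finite _)
  -- The set $G/U$ splits into `H`-orbits, each of size the relative index in `H` of a conjugate of
  -- `U`; if $p$ divided all of them it would divide $[G:U]$.
  rw [Nat.card_congr (MulAction.selfEquivSigmaOrbits H (G ⧸ U)), Nat.card_sigma]
  refine Finset.dvd_sum fun ω _ => ?_
  obtain ⟨g, hg⟩ := QuotientGroup.mk_surjective ω.out
  rw [← hg, Nat.card_coe_set_eq, ← MulAction.index_stabilizer]
  have hst : MulAction.stabilizer H (g : G ⧸ U) =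
      (U.comap (MulAut.conj g⁻¹).toMonoidHom).subgroupOf H := ?_
  · rw [hst]
    exact hcon g⁻¹
  ext h
  rw [MulAction.mem_stabilizer_iff, mem_subgroupOf, mem_comap]
  change ((((h : G) * g : G)) : G ⧸ U) = g ↔ _
  rw [eq_comm, QuotientGroup.eq]
  simp [mul_assoc]

/-- A first element of `A` arranges the index condition. Sylow conjugation inside `H` then moves `V`
into place by an element of `H`, which normalizes `H` and so leaves that index unchanged. -/
theorem exists_conj_le_and_not_dvd (hp : p.Prime) {U A H V : Subgroup G} (hVH : V ≤ H)
    (hHA : H ≤ A) (hV : IsPGroup p V) (hU : ¬p ∣ U.relIndex A) :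
    ∃ g ∈ A, (∀ v ∈ V, g * v * g⁻¹ ∈ U) ∧
      ¬p ∣ (U.comap (MulAut.conj g).toMonoidHom).relIndex H := by
  obtain ⟨a, ha⟩ := exists_not_dvd_relIndex (U := U.subgroupOf A) hU (H.subgroupOf A)
  have ha' : ¬p ∣ (U.comap (MulAut.conj (a : G)).toMonoidHom).relIndex H := by
    convert ha using 2
    have h1 : (U.subgroupOf A).comap (MulAut.conj a).toMonoidHom
        = (U.comap (MulAut.conj (a : G)).toMonoidHom).subgroupOf A := by
      ext x
      simp [mem_subgroupOf, mem_comap]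
    rw [h1, relIndex_subgroupOf hHA]
  obtain ⟨h, hh, hhV⟩ := exists_smul_mem_of_isPGroup hp hVH hV ha'
  refine ⟨a * h, mul_mem a.2 (hHA hh), fun v hv => ?_, ?_⟩
  · have := hhV v hv
    rw [mem_comap] at this
    simpa [mul_assoc] using this
  · convert ha' using 2
    have h2 : U.comap (MulAut.conj ((a : G) * h)).toMonoidHom
        = (U.comap (MulAut.conj (a : G)).toMonoidHom).comap (MulAut.conj h).toMonoidHom := by
      ext x
      simp [mem_comap, mul_assoc]
    have h3 : H.map (MulAut.conj h).toMonoidHom = H := by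
      ext x
      rw [mem_map]
      constructor
      · rintro ⟨y, hy, rfl⟩
        exact mul_mem (mul_mem hh hy) (inv_mem hh)
      · intro hx
        exact ⟨h⁻¹ * x * h, mul_mem (mul_mem (inv_mem hh) hx) hh, by simp [mul_assoc]⟩
    rw [h2]
    conv_rhs => rw [← h3]
    exact relIndex_comap _ _ _

/-- If `B = A D`, then the index of `A` in `B` is the index of `A ∩ D` in `D`. -/
theorem relIndex_eq_of_forall_exists_mul {A B D : Subgroup G} (hDB : D ≤ B)
    (h : ∀ b ∈ B, ∃ d ∈ D, d⁻¹ * b ∈ A) : A.relIndex B = A.relIndex D := by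
  have ht : MulAction.IsPretransitive (D.subgroupOf B) (B ⧸ A.subgroupOf B) := by
    rw [MulAction.isPretransitive_iff_base (((1 : B) : B ⧸ A.subgroupOf B))]
    intro y
    obtain ⟨b, rfl⟩ := QuotientGroup.mk_surjective y
    obtain ⟨d, hd, hda⟩ := h b b.2
    refine ⟨⟨⟨d, hDB hd⟩, hd⟩, ?_⟩
    change (((⟨d, hDB hd⟩ * 1 : B)) : B ⧸ A.subgroupOf B) = b
    rw [mul_one]
    exact QuotientGroup.eq.2 hda
  have h1 := MulAction.index_stabilizer_of_transitive (D.subgroupOf B)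
    (((1 : B) : B ⧸ A.subgroupOf B))
  have h2 : MulAction.stabilizer (D.subgroupOf B) (((1 : B) : B ⧸ A.subgroupOf B))
      = (A.subgroupOf B).subgroupOf (D.subgroupOf B) := by
    ext d
    rw [MulAction.mem_stabilizer_iff, mem_subgroupOf]
    change (((d : B) * 1 : B) : B ⧸ A.subgroupOf B) = (1 : B) ↔ _
    rw [mul_one, eq_comm, QuotientGroup.eq, inv_one, one_mul]
  rw [h2] at h1
  change _ = A.relIndex B at h1
  rw [← h1]
  change (A.subgroupOf B).relIndex (D.subgroupOf B) = _
  rw [relIndex_subgroupOf hDB]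

/-- If `A ≤ B` has index prime to `p` and `D ≤ B` is normalized by `A`, then `A ∩ D` has index
prime to `p` in `D`. -/
theorem not_dvd_relIndex_of_normal {A B D : Subgroup G} (hAB : A ≤ B) (hDB : D ≤ B)
    (hn : ∀ a ∈ A, ∀ d ∈ D, a * d * a⁻¹ ∈ D) (h : ¬p ∣ A.relIndex B) : ¬p ∣ A.relIndex D := by
  have h1 : A ≤ Subgroup.normalizer (D : Set G) := fun a ha => by
    rw [mem_normalizer_iff]
    refine fun x => ⟨fun hx => hn a ha x hx, fun hx => ?_⟩
    have := hn a⁻¹ (inv_mem ha) _ hx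
    simpa [mul_assoc] using this
  -- Since `A` normalizes `D`, the join is the product `D A`; its index over `A` divides that of
  -- `B`.
  have h2 : A.relIndex (D ⊔ A) = A.relIndex D := by
    refine relIndex_eq_of_forall_exists_mul le_sup_left fun b hb => ?_
    have hb' : b ∈ ((D ⊔ A : Subgroup G) : Set G) := hb
    rw [coe_mul_of_right_le_normalizer_left _ _ h1] at hb'
    obtain ⟨d, hd, a, ha, rfl⟩ := hb'
    exact ⟨d, hd, by simpa using ha⟩
  rw [← h2]
  exact fun hdvd => h (hdvd.trans (Dvd.intro _
    (relIndex_mul_relIndex _ _ _ le_sup_right (sup_le hDB hAB))))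

end Subgroup

/-! ### Morphisms as functions on $S$, and axioms (I) and (II) in terms of indices and isomorphisms.
-/

namespace FusionSystem

variable {p : ℕ} {S : Type*} [Group S] {F : FusionSystem S}

/-- The function `f : S → S` restricts to a morphism of `F` on `P`. -/
def Mor (F : FusionSystem S) (P : Subgroup S) (f : S → S) : Prop :=
  ∃ φ ∈ F.hom P ⊤, ∀ x : P, (φ x : S) = f x

theorem Mor.mem {P Q : Subgroup S} {f : S → S} (hf : F.Mor P f) {φ : P →* Q}
    (h : ∀ x : P, (φ x : S) = f x) : φ ∈ F.hom P Q := by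
  obtain ⟨ψ, hψ, hψf⟩ := hf
  exact F.mem_of_restrict hψ le_rfl φ fun x => (h x).trans (hψf x).symm

theorem mor_of_mem {P Q : Subgroup S} {φ : P →* Q} (hφ : φ ∈ F.hom P Q) {f : S → S}
    (h : ∀ x : P, (φ x : S) = f x) : F.Mor P f :=
  ⟨_, F.comp_mem hφ (F.inclusion_mem le_top), h⟩

namespace Mor

variable {P : Subgroup S} {f : S → S}

theorem map_mul (hf : F.Mor P f) {x y : S} (hx : x ∈ P) (hy : y ∈ P) :
    f (x * y) = f x * f y := by
  obtain ⟨φ, -, h⟩ := hf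
  have := congrArg Subtype.val (_root_.map_mul φ ⟨x, hx⟩ ⟨y, hy⟩)
  rw [Subgroup.coe_mul, h, h, h] at this
  exact this

theorem map_inv (hf : F.Mor P f) {x : S} (hx : x ∈ P) : f x⁻¹ = (f x)⁻¹ := by
  obtain ⟨φ, -, h⟩ := hf
  have := congrArg Subtype.val (_root_.map_inv φ ⟨x, hx⟩)
  rw [Subgroup.coe_inv, h, h] at this
  exact this

theorem map_conj (hf : F.Mor P f) {x y : S} (hx : x ∈ P) (hy : y ∈ P) :
    f (x * y * x⁻¹) = f x * f y * (f x)⁻¹ := by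
  rw [hf.map_mul (mul_mem hx hy) (inv_mem hx), hf.map_mul hx hy, hf.map_inv hx]

theorem mono (hf : F.Mor P f) {P' : Subgroup S} (h : P' ≤ P) : F.Mor P' f := by
  obtain ⟨φ, hφ, hφf⟩ := hf
  exact ⟨_, F.comp_mem (F.inclusion_mem h) hφ, fun x => hφf _⟩

theorem congr (hf : F.Mor P f) {g : S → S} (h : ∀ x ∈ P, f x = g x) : F.Mor P g := by
  obtain ⟨φ, hφ, hφf⟩ := hf
  exact ⟨φ, hφ, fun x => (hφf x).trans (h x x.2)⟩

theorem exists_hom (hf : F.Mor P f) {Q : Subgroup S} (h : ∀ x ∈ P, f x ∈ Q) :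
    ∃ φ ∈ F.hom P Q, ∀ x : P, (φ x : S) = f x := by
  have hf' := hf
  obtain ⟨φ, hφ, hφf⟩ := hf
  let ψ : P →* Q := ((⊤ : Subgroup S).subtype.comp φ).codRestrict Q fun x => by
    change (φ x : S) ∈ Q
    rw [hφf]
    exact h x x.2
  exact ⟨ψ, hf'.mem hφf, hφf⟩

theorem comp (hf : F.Mor P f) {Q : Subgroup S} {g : S → S} (hg : F.Mor Q g)
    (h : ∀ x ∈ P, f x ∈ Q) : F.Mor P (fun x => g (f x)) := by
  obtain ⟨φ, hφ, hφf⟩ := hf.exists_hom h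
  obtain ⟨ψ, hψ, hψg⟩ := hg
  exact ⟨_, F.comp_mem hφ hψ, fun x => (hψg _).trans (by rw [hφf])⟩

theorem exists_equiv (hf : F.Mor P f) : ∃ (R : Subgroup S) (e : P ≃* R),
    e.toMonoidHom ∈ F.hom P R ∧ ∀ x : P, (e x : S) = f x := by
  obtain ⟨φ, hφ, hφf⟩ := hf
  obtain ⟨R, hR, e, he, -, h⟩ := F.exists_iso hφ
  refine ⟨R, e, he, fun x => ?_⟩
  rw [← hφf, h]
  rfl

theorem sup_mem (hf : F.Mor P f) {A B C : Subgroup S} (hAB : A ⊔ B ≤ P)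
    (hA : ∀ x ∈ A, f x ∈ C) (hB : ∀ x ∈ B, f x ∈ C) : ∀ x ∈ A ⊔ B, f x ∈ C := by
  obtain ⟨φ, hφ, hφf⟩ := hf
  have h : A ⊔ B ≤ (C.comap ((⊤ : Subgroup S).subtype.comp φ)).map P.subtype := by
    refine sup_le (fun x hx => ?_) (fun x hx => ?_)
    · refine ⟨⟨x, hAB (Subgroup.mem_sup_left hx)⟩, ?_, rfl⟩
      change (φ _ : S) ∈ C
      rw [hφf]
      exact hA x hx
    · refine ⟨⟨x, hAB (Subgroup.mem_sup_right hx)⟩, ?_, rfl⟩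
      change (φ _ : S) ∈ C
      rw [hφf]
      exact hB x hx
  intro x hx
  obtain ⟨y, hy, rfl⟩ := h hx
  have : (φ y : S) ∈ C := hy
  rwa [hφf] at this

theorem eqOn_sup {g : S → S} {A B : Subgroup S} (hf : F.Mor (A ⊔ B) f) (hg : F.Mor (A ⊔ B) g)
    (hA : ∀ x ∈ A, f x = g x) (hB : ∀ x ∈ B, f x = g x) : ∀ x ∈ A ⊔ B, f x = g x := by
  obtain ⟨φ, hφ, hφf⟩ := hf
  obtain ⟨ψ, hψ, hψg⟩ := hg
  have h : A ⊔ B ≤ (φ.eqLocus ψ).map (A ⊔ B).subtype := by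
    refine sup_le (fun x hx => ?_) (fun x hx => ?_)
    · refine ⟨⟨x, Subgroup.mem_sup_left hx⟩, Subtype.ext ?_, rfl⟩
      rw [hφf, hψg]
      exact hA x hx
    · refine ⟨⟨x, Subgroup.mem_sup_right hx⟩, Subtype.ext ?_, rfl⟩
      rw [hφf, hψg]
      exact hB x hx
  intro x hx
  obtain ⟨y, hy, rfl⟩ := h hx
  have : φ y = ψ y := hy
  change f y = g y
  rw [← hφf, ← hψg, this]

end Mor

theorem mor_conj (F : FusionSystem S) (P : Subgroup S) (g : S) :
    F.Mor P (fun x => g * x * g⁻¹) :=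
  ⟨conjHom g (Q := ⊤) (fun _ _ => trivial), F.conj_mem _ _, fun _ => rfl⟩

theorem mor_id (F : FusionSystem S) (P : Subgroup S) : F.Mor P (fun x => x) :=
  (F.mor_conj P 1).congr fun x _ => by simp

theorem exists_mor_of_mem {P Q : Subgroup S} {φ : P →* Q} (hφ : φ ∈ F.hom P Q) :
    ∃ f : S → S, F.Mor P f ∧ ∀ x : P, (φ x : S) = f x := by
  classical
  let f : S → S := fun y => if hy : y ∈ P then (φ ⟨y, hy⟩ : S) else 1
  have h : ∀ x : P, (φ x : S) = f x := fun x => by simp [f]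
  exact ⟨f, mor_of_mem hφ h, h⟩

theorem mem_autF_iff {P : Subgroup S} {α : MulAut P} :
    α ∈ F.autF P ↔ α.toMonoidHom ∈ F.hom P P :=
  ⟨fun h => h.1, fun h => ⟨h, F.symm_mem h⟩⟩

theorem mem_kNormalizer {P : Subgroup S} {K : Subgroup (MulAut P)} {g : S} :
    g ∈ kNormalizer P K ↔ ∃ α ∈ K, ∀ x : P, g * x * g⁻¹ = α x := by
  constructor
  · rintro ⟨a, ha, rfl⟩
    exact ⟨_, ha, fun x => rfl⟩
  · rintro ⟨α, hα, h⟩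
    have hg : g ∈ Subgroup.normalizer (P : Set S) := by
      rw [Subgroup.mem_normalizer_iff]
      refine fun x => ⟨fun hx => ?_, fun hx => ?_⟩
      · rw [h ⟨x, hx⟩]
        exact (α _).2
      · have h1 := h (α.symm ⟨_, hx⟩)
        rw [α.apply_symm_apply] at h1
        have h2 : (α.symm ⟨_, hx⟩ : S) = x := by simpa using h1
        exact h2 ▸ (α.symm ⟨_, hx⟩).2
    refine ⟨⟨g, hg⟩, ?_, rfl⟩
    have : P.normalizerMonoidHom ⟨g, hg⟩ = α := by
      ext x
      exact h x
    change P.normalizerMonoidHom ⟨g, hg⟩ ∈ K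
    rwa [this]

theorem mem_autS_iff {P : Subgroup S} {α : MulAut P} :
    α ∈ autS P ↔ ∃ g : S, ∀ x : P, g * x * g⁻¹ = α x := by
  constructor
  · rintro ⟨g, rfl⟩
    exact ⟨g, fun x => rfl⟩
  · rintro ⟨g, hg⟩
    obtain ⟨a, -, rfl⟩ : g ∈ kNormalizer P ⊤ := mem_kNormalizer.2 ⟨α, trivial, hg⟩
    refine ⟨a, ?_⟩
    ext x
    exact hg x

theorem mem_extender {P R : Subgroup S} {e : P ≃* R} {g h : S} {α : MulAut P}
    (hg : ∀ x : P, g * x * g⁻¹ = α x) (hh : ∀ x : P, h * e x * h⁻¹ = e (α x)) :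
    g ∈ extender e := by
  refine mem_kNormalizer.2 ⟨α, ?_, hg⟩
  refine mem_autS_iff.2 ⟨h, fun y => ?_⟩
  obtain ⟨x, rfl⟩ := e.surjective y
  rw [hh]
  change _ = (e (α (e.symm (e x))) : S)
  rw [e.symm_apply_apply]

theorem autS_le_autF (P : Subgroup S) : autS P ≤ F.autF P := by
  intro α hα
  obtain ⟨g, hg⟩ := mem_autS_iff.1 hα
  exact mem_autF_iff.2 ((F.mor_conj P g).mem fun x => (hg x).symm)

theorem inn_le_autS (P : Subgroup S) : inn P ≤ autS P := by
  rintro _ ⟨x, rfl⟩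
  exact mem_autS_iff.2 ⟨x, fun y => rfl⟩

theorem isPGroup_autS (hp : p.Prime) (hS : IsDiscretePToral p S) (P : Subgroup S) :
    IsPGroup p (autS P) := by
  intro α
  obtain ⟨α, g, rfl⟩ := α
  obtain ⟨k, hk⟩ := (hS.subgroup hp (Subgroup.normalizer (P : Set S))).isPGroup hp g
  exact ⟨k, Subtype.ext (by
    change P.normalizerMonoidHom g ^ p ^ k = 1
    rw [← map_pow, hk, map_one])⟩

theorem map_congr_autF {P R : Subgroup S} {e : P ≃* R} (he : e.toMonoidHom ∈ F.hom P R) :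
    (F.autF P).map (MulAut.congr e).toMonoidHom = F.autF R := by
  have he' := F.symm_mem he
  ext β
  constructor
  · rintro ⟨α, hα, rfl⟩
    exact mem_autF_iff.2 (F.comp_mem (F.comp_mem he' hα.1) he)
  · intro hβ
    refine ⟨(MulAut.congr e).symm β, mem_autF_iff.2 (F.comp_mem (F.comp_mem he hβ.1) he'), ?_⟩
    exact (MulAut.congr e).apply_symm_apply β

theorem map_congr_inn {P R : Subgroup S} (e : P ≃* R) :
    (inn P).map (MulAut.congr e).toMonoidHom = inn R := by
  have h : ∀ x, MulAut.congr e (MulAut.conj x) = MulAut.conj (e x) := fun x => by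
    ext y
    simp [MulAut.congr]
  ext β
  constructor
  · rintro ⟨_, ⟨x, rfl⟩, rfl⟩
    exact ⟨e x, (h x).symm⟩
  · rintro ⟨y, rfl⟩
    exact ⟨_, ⟨e.symm y, rfl⟩, (h _).trans (by rw [e.apply_symm_apply])⟩

theorem outS_index (P : Subgroup S) : (F.outS P).index = (autS P).relIndex (F.autF P) := by
  have h : (F.outS P).comap (QuotientGroup.mk' ((inn P).subgroupOf (F.autF P)))
      = (autS P).subgroupOf (F.autF P) := by
    rw [outS, Subgroup.comap_map_eq, QuotientGroup.ker_mk', sup_eq_left]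
    exact fun x hx => inn_le_autS P hx
  rw [← Subgroup.index_comap_of_surjective _ (QuotientGroup.mk'_surjective _), h]
  rfl

theorem IsSaturated.not_dvd_of_isFullyNormalized (hp : p.Prime) (hF : F.IsSaturated p)
    {P : Subgroup S} (hP : F.IsFullyNormalized p P) : ¬p ∣ (autS P).relIndex (F.autF P) := by
  have := Fact.mk hp
  obtain ⟨-, hfin, T, hT⟩ := hF.sylow P hP
  rw [← outS_index, ← hT]
  exact T.not_dvd_index

/-- Axiom (I) gives finiteness of $\mathrm{Out}_F$ only for fully normalized subgroups; it is
transported along an isomorphism to a fully normalized conjugate. -/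
theorem IsSaturated.inn_relIndex_autF_ne_zero (hp : p.Prime) (hS : IsDiscretePToral p S)
    (hF : F.IsSaturated p) (P : Subgroup S) : (inn P).relIndex (F.autF P) ≠ 0 := by
  obtain ⟨R, ⟨e, he, -⟩, hR⟩ := exists_isFullyNormalized hp hS F P
  obtain ⟨-, hfin, -⟩ := hF.sylow R hR
  rw [← Subgroup.relIndex_map_map_of_injective (f := (MulAut.congr e).toMonoidHom) _ _
    (MulAut.congr e).injective, map_congr_inn, map_congr_autF he]
  exact Nat.card_pos.ne'

/-- Index prime to $p$ is nonzero, and $\mathrm{Inn}(P)$ always has finite index in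
$\mathrm{Aut}_S(P)$. So the index condition alone recovers this part of axiom (I), with no
saturation assumed. -/
theorem finite_outF_and_sylow (hp : p.Prime) (hS : IsDiscretePToral p S) {P : Subgroup S}
    (h : ¬p ∣ (autS P).relIndex (F.autF P)) :
    Finite (F.OutF P) ∧ ∃ T : Sylow p (F.OutF P), (T : Subgroup (F.OutF P)) = F.outS P := by
  have := Fact.mk hp
  constructor
  · refine Nat.finite_of_card_ne_zero ?_
    change (inn P).relIndex (F.autF P) ≠ 0
    rw [← Subgroup.relIndex_mul_relIndex _ _ _ (inn_le_autS P) (autS_le_autF P)]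
    exact mul_ne_zero (inn_relIndex_autS_ne_zero hp hS P)
      fun h0 => h (h0 ▸ dvd_zero p)
  · have hpg : IsPGroup p (F.outS P) := by
      refine IsPGroup.map ?_ _
      intro x
      obtain ⟨k, hk⟩ := isPGroup_autS hp hS P ⟨x.1.1, x.2⟩
      have hk' : (x.1.1 : MulAut P) ^ p ^ k = 1 := congrArg Subtype.val hk
      exact ⟨k, Subtype.ext (Subtype.ext hk')⟩
    exact ⟨hpg.toSylow (by rw [outS_index]; exact h), rfl⟩

theorem extender_eq {P R R' : Subgroup S} (e : P ≃* R) (e' : P ≃* R')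
    (h : ∀ x, (e x : S) = e' x) : extender e = extender e' := by
  have hR : R = R' := by
    ext y
    constructor
    · intro hy
      obtain ⟨x, hx⟩ := e.surjective ⟨y, hy⟩
      have h1 := h x
      rw [hx] at h1
      have h2 : y = e' x := h1
      exact h2 ▸ (e' x).2
    · intro hy
      obtain ⟨x, hx⟩ := e'.surjective ⟨y, hy⟩
      have h1 := h x
      rw [hx] at h1
      have h2 : (e x : S) = y := h1
      exact h2 ▸ (e x).2
  subst hR
  congr 1
  ext x
  exact h x

theorem range_eq {P R : Subgroup S} (e : P ≃* R) (φ : P →* (⊤ : Subgroup S))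
    (h : ∀ x, (φ x : S) = e x) : ((⊤ : Subgroup S).subtype.comp φ).range = R := by
  ext y
  constructor
  · rintro ⟨x, rfl⟩
    change (φ x : S) ∈ R
    rw [h]
    exact (e x).2
  · intro hy
    refine ⟨e.symm ⟨y, hy⟩, ?_⟩
    change (φ _ : S) = y
    rw [h, e.apply_symm_apply]

theorem IsSaturated.exists_extend (hF : F.IsSaturated p) {P R : Subgroup S} {e : P ≃* R}
    (he : e.toMonoidHom ∈ F.hom P R) (hR : F.IsFullyCentralized p R) :
    ∃ f, F.Mor (extender e) f ∧ ∀ x : P, f x = e x := by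
  let φ : P →* (⊤ : Subgroup S) := (Subgroup.inclusion le_top).comp e.toMonoidHom
  have hφ : φ ∈ F.hom P ⊤ := F.comp_mem he (F.inclusion_mem le_top)
  have hr := range_eq e φ fun x => rfl
  obtain ⟨ψ, hψ, h⟩ := hF.extend P φ hφ (by rw [hr]; exact hR)
  have hext : extender (isoImage φ (F.injective hφ)) = extender e :=
    extender_eq _ _ fun x => rfl
  obtain ⟨f, hf, hψf⟩ := exists_mor_of_mem hψ
  refine ⟨f, hext ▸ hf, fun x => ?_⟩
  have h1 := congrArg (fun χ : P →* (⊤ : Subgroup S) => (χ x : S)) h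
  exact (hψf (Subgroup.inclusion (le_extender _) x)).symm.trans h1

/-- Pushing `K` forward along morphisms out of `Q` is replaced by pulling it back along isomorphisms
into `Q`, the direction in which morphisms get extended. -/
theorem isFullyKNormalized_iff {Q : Subgroup S} {K : Subgroup (MulAut Q)} :
    F.IsFullyKNormalized p Q K ↔ ∀ (R : Subgroup S) (e : R ≃* Q), e.toMonoidHom ∈ F.hom R Q →
      pToralOrder p (kNormalizer R (K.comap (MulAut.congr e).toMonoidHom)) ≤
        pToralOrder p (kNormalizer Q K) := by
  have key : ∀ (R R' : Subgroup S) (e : R ≃* Q) (e' : Q ≃* R'),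
      (∀ x, (e.symm x : S) = e' x) → kNormalizer R (K.comap (MulAut.congr e).toMonoidHom) =
        kNormalizer R' (K.map (MulAut.congr e').toMonoidHom) := by
    intro R R' e e' h
    have hR : R = R' := by
      have h1 := range_eq e'
        ((Subgroup.inclusion le_top).comp e.symm.toMonoidHom) h
      have h2 := range_eq e.symm
        ((Subgroup.inclusion le_top).comp e.symm.toMonoidHom) fun x => rfl
      exact h2.symm.trans h1
    subst hR
    have he : e.symm = e' := by ext x; exact h x
    subst he
    congr 1
    exact (Subgroup.map_equiv_eq_comap_symm (MulAut.congr e.symm) K).symm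
  constructor
  · intro h R e he
    have he' := F.symm_mem he
    have h1 := h ((Subgroup.inclusion le_top).comp e.symm.toMonoidHom)
      (F.comp_mem he' (F.inclusion_mem le_top))
    rwa [← key R _ e (isoImage _ (F.injective (F.comp_mem he' (F.inclusion_mem le_top))))
      fun x => rfl] at h1
  · intro h φ hφ
    obtain ⟨f, hf, hφf⟩ := exists_mor_of_mem hφ
    rw [← key _ _ (isoImage φ (F.injective hφ)).symm (isoImage φ (F.injective hφ)) fun x => rfl]
    exact h _ _ (F.symm_mem (hf.mem hφf))

end FusionSystem

/-! ### The criterion for being fully $K$-normalized. -/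

namespace FusionSystem

variable {p : ℕ} {S : Type*} [Group S] {F : FusionSystem S}

theorem map_congr_autS_inf_le {P R : Subgroup S} {e : P ≃* R} (he : e.toMonoidHom ∈ F.hom P R)
    (K : Subgroup (MulAut R)) :
    (autS P ⊓ K.comap (MulAut.congr e).toMonoidHom).map (MulAut.congr e).toMonoidHom ≤
      F.autF R ⊓ K := by
  rintro _ ⟨α, ⟨hα, hαK⟩, rfl⟩
  refine ⟨?_, hαK⟩
  rw [← map_congr_autF he]
  exact ⟨α, autS_le_autF P hα, rfl⟩

theorem isPGroup_map_congr_autS_inf (hp : p.Prime) (hS : IsDiscretePToral p S)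
    {P R : Subgroup S} (e : P ≃* R) (K : Subgroup (MulAut P)) :
    IsPGroup p ((autS P ⊓ K).map (MulAut.congr e).toMonoidHom) :=
  ((isPGroup_autS hp hS P).to_le inf_le_left).map _

/-- The automorphisms of `R` induced by its $K$-normalizer transport to a $p$-subgroup of
$\mathrm{Aut}_F(Q)\cap K$, which some `χ` conjugates into $\mathrm{Aut}_S(Q)\cap K$. The extender of
`χ ∘ e` then contains that normalizer, and axiom (II) applies. -/
theorem IsSaturated.exists_extend_of_not_dvd (hp : p.Prime) (hS : IsDiscretePToral p S)
    (hF : F.IsSaturated p) {Q : Subgroup S} {K : Subgroup (MulAut Q)}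
    (hQ : F.IsFullyCentralized p Q) (hK : ¬p ∣ (autS Q ⊓ K).relIndex (F.autF Q ⊓ K))
    {R : Subgroup S} {e : R ≃* Q} (he : e.toMonoidHom ∈ F.hom R Q) :
    ∃ χ ∈ F.autF Q ⊓ K, ∃ f,
      F.Mor (kNormalizer R (K.comap (MulAut.congr e).toMonoidHom) ⊔ R) f ∧
        (∀ x : R, f x = χ (e x)) ∧
        ∀ g ∈ kNormalizer R (K.comap (MulAut.congr e).toMonoidHom), f g ∈ kNormalizer Q K := by
  obtain ⟨χ, hχ, hχV⟩ := Subgroup.exists_smul_mem_of_isPGroup hp (map_congr_autS_inf_le he K)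
    (isPGroup_map_congr_autS_inf hp hS e _) hK
  have he' : (e.trans χ).toMonoidHom ∈ F.hom R Q := F.comp_mem he hχ.1.1
  obtain ⟨f, hf, hfe⟩ := hF.exists_extend he' hQ
  have hle : kNormalizer R (K.comap (MulAut.congr e).toMonoidHom) ≤ extender (e.trans χ) := by
    intro g hg
    obtain ⟨α, hα, hgα⟩ := mem_kNormalizer.1 hg
    have hαS : α ∈ autS R := mem_autS_iff.2 ⟨g, hgα⟩
    obtain ⟨h, hh⟩ := mem_autS_iff.1 (hχV _ ⟨α, ⟨hαS, hα⟩, rfl⟩).1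
    refine mem_extender hgα (h := h) fun x => ?_
    rw [hh]
    change (χ (e (α (e.symm (χ⁻¹ (χ (e x)))))) : S) = χ (e (α x))
    rw [MulAut.inv_apply_self, e.symm_apply_apply]
  refine ⟨χ, hχ, f, hf.mono (sup_le hle (le_extender _)), hfe, fun g hg => ?_⟩
  obtain ⟨α, hα, hgα⟩ := mem_kNormalizer.1 hg
  refine mem_kNormalizer.2 ⟨χ * MulAut.congr e α * χ⁻¹,
    mul_mem (mul_mem hχ.2 hα) (inv_mem hχ.2), fun y => ?_⟩
  obtain ⟨x, rfl⟩ := (e.trans χ).surjective y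
  rw [← hfe, ← hf.map_conj (hle hg) (le_extender _ x.2), hgα, hfe]
  change (χ (e (α x)) : S) = χ (e (α (e.symm (χ⁻¹ (χ (e x))))))
  rw [MulAut.inv_apply_self, e.symm_apply_apply]

theorem order_le_of_mor (hp : p.Prime) (hS : IsDiscretePToral p S) {A B : Subgroup S}
    {f : S → S} (hf : F.Mor A f) (h : ∀ x ∈ A, f x ∈ B) : pToralOrder p A ≤ pToralOrder p B := by
  obtain ⟨φ, hφ, -⟩ := hf.exists_hom h
  exact (hS.subgroup hp B).order_le hp φ (F.injective hφ)

theorem exists_eq_of_order_le (hp : p.Prime) (hS : IsDiscretePToral p S) {A B : Subgroup S}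
    {f : S → S} (hf : F.Mor A f) (h : ∀ x ∈ A, f x ∈ B)
    (hle : pToralOrder p B ≤ pToralOrder p A) : ∀ y ∈ B, ∃ x ∈ A, f x = y := by
  obtain ⟨φ, hφ, hφf⟩ := hf.exists_hom h
  intro y hy
  obtain ⟨x, hx⟩ := (hS.subgroup hp B).surjective_of_order_le hp φ (F.injective hφ) hle ⟨y, hy⟩
  exact ⟨x, x.2, by rw [← hφf, hx]⟩

theorem IsSaturated.isFullyKNormalized_of_not_dvd (hp : p.Prime) (hS : IsDiscretePToral p S)
    (hF : F.IsSaturated p) {Q : Subgroup S} {K : Subgroup (MulAut Q)}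
    (hQ : F.IsFullyCentralized p Q) (hK : ¬p ∣ (autS Q ⊓ K).relIndex (F.autF Q ⊓ K)) :
    F.IsFullyKNormalized p Q K := by
  refine isFullyKNormalized_iff.2 fun R e he => ?_
  obtain ⟨χ, -, f, hf, -, hfN⟩ := hF.exists_extend_of_not_dvd hp hS hQ hK he
  exact order_le_of_mor hp hS (hf.mono le_sup_left) hfN

theorem centralizer_le_kNormalizer (P : Subgroup S) (K : Subgroup (MulAut P)) :
    Subgroup.centralizer (P : Set S) ≤ kNormalizer P K := by
  intro g hg
  refine mem_kNormalizer.2 ⟨1, one_mem _, fun x => ?_⟩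
  rw [← Subgroup.mem_centralizer_iff.1 hg x x.2, mul_inv_cancel_right]
  rfl

/-- Compare `Q` with a fully normalized conjugate `R`. A suitable isomorphism $Q\to R$ extends to
$N_S^K(Q)$, with values in the corresponding normalizer of `R`; maximality of $|N_S^K(Q)|$ makes
this extension onto. Both the order of the centralizer and the index condition can then be pulled
back from `R`. -/
theorem IsSaturated.isFullyCentralized_and_not_dvd (hp : p.Prime) (hS : IsDiscretePToral p S)
    (hF : F.IsSaturated p) {Q : Subgroup S} {K : Subgroup (MulAut Q)}
    (hQ : F.IsFullyKNormalized p Q K) :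
    F.IsFullyCentralized p Q ∧ ¬p ∣ (autS Q ⊓ K).relIndex (F.autF Q ⊓ K) := by
  rw [isFullyKNormalized_iff] at hQ
  obtain ⟨R, ⟨e, he, -⟩, hR⟩ := exists_isFullyNormalized hp hS F Q
  have hRc := (hF.sylow R hR).1
  let c := (MulAut.congr e).toMonoidHom
  have hHA : (F.autF Q ⊓ K).map c ≤ F.autF R := by
    rw [← map_congr_autF he]
    exact Subgroup.map_mono inf_le_left
  -- One `χ` serves two purposes: `hχV` makes the isomorphism extend, and `hχH` carries the Sylow
  -- property of `R` to the transported $\mathrm{Aut}_F(Q)\cap K$.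
  obtain ⟨χ, hχ, hχV, hχH⟩ := Subgroup.exists_conj_le_and_not_dvd hp
    (Subgroup.map_mono (f := c) (inf_le_inf_right K (autS_le_autF (F := F) Q))) hHA
    (isPGroup_map_congr_autS_inf hp hS e K) (hF.not_dvd_of_isFullyNormalized hp hR)
  let e' : Q ≃* R := e.trans χ
  have he' : e'.toMonoidHom ∈ F.hom Q R := F.comp_mem he hχ.1
  obtain ⟨f, hf, hfe⟩ := hF.exists_extend he' hRc
  let K' : Subgroup (MulAut R) := K.comap (MulAut.congr e'.symm).toMonoidHom
  have hle : kNormalizer Q K ≤ extender e' := by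
    intro g hg
    obtain ⟨α, hα, hgα⟩ := mem_kNormalizer.1 hg
    have hαS : α ∈ autS Q := mem_autS_iff.2 ⟨g, hgα⟩
    obtain ⟨h, hh⟩ := mem_autS_iff.1 (hχV _ ⟨α, ⟨hαS, hα⟩, rfl⟩)
    refine mem_extender hgα (h := h) fun x => ?_
    rw [hh]
    change (χ (e (α (e.symm (χ⁻¹ (χ (e x)))))) : S) = χ (e (α x))
    rw [MulAut.inv_apply_self, e.symm_apply_apply]
  have hconj : ∀ g ∈ kNormalizer Q K, ∀ x : Q, ∀ α : MulAut Q, (∀ x : Q, g * x * g⁻¹ = α x) →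
      f g * e' x * (f g)⁻¹ = e' (α x) := by
    intro g hg x α hgα
    rw [← hfe, ← hf.map_conj (hle hg) (le_extender _ x.2), hgα, hfe]
  have hfN : ∀ g ∈ kNormalizer Q K, f g ∈ kNormalizer R K' := by
    intro g hg
    obtain ⟨α, hα, hgα⟩ := mem_kNormalizer.1 hg
    refine mem_kNormalizer.2 ⟨MulAut.congr e' α, ?_, fun y => ?_⟩
    · change (MulAut.congr e').symm (MulAut.congr e' α) ∈ K
      rwa [MulEquiv.symm_apply_apply]
    · obtain ⟨x, rfl⟩ := e'.surjective y
      rw [hconj g hg x α hgα]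
      change _ = (e' (α (e'.symm (e' x))) : S)
      rw [e'.symm_apply_apply]
  have hsurj := exists_eq_of_order_le hp hS (hf.mono hle) hfN (hQ R e'.symm (F.symm_mem he'))
  constructor
  · intro Q' hQ'
    have h1 : pToralOrder p (Subgroup.centralizer (Q' : Set S)) ≤
        pToralOrder p (Subgroup.centralizer (R : Set S)) := by
      refine hRc Q' (IsConj.trans ⟨e'.symm, F.symm_mem he', ?_⟩ hQ')
      exact he'
    refine h1.trans ?_
    -- The inverse of the extension embeds $C_S(R)$ in $C_S(Q)$.
    obtain ⟨R₁, ε, hε, hεf⟩ := (hf.mono hle).exists_equiv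
    have hmem : ∀ c ∈ Subgroup.centralizer (R : Set S), c ∈ R₁ := by
      intro c hc
      obtain ⟨g, hg, rfl⟩ := hsurj c (centralizer_le_kNormalizer R K' hc)
      rw [show f g = ε ⟨g, hg⟩ from (hεf ⟨g, hg⟩).symm]
      exact (ε _).2
    obtain ⟨f', hf', hf'ε⟩ := exists_mor_of_mem (F.symm_mem hε)
    refine order_le_of_mor hp hS (hf'.mono hmem) fun c hc => ?_
    obtain ⟨g, hg, rfl⟩ := hsurj c (centralizer_le_kNormalizer R K' hc)
    have hfg : f' (f g) = g := by
      have h2 := hf'ε (ε ⟨g, hg⟩)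
      rw [hεf] at h2
      rw [← h2]
      exact congrArg Subtype.val (ε.symm_apply_apply ⟨g, hg⟩)
    rw [hfg]
    obtain ⟨α, hα, hgα⟩ := mem_kNormalizer.1 hg
    rw [Subgroup.mem_centralizer_iff]
    intro x hx
    have h3 := hconj g hg ⟨x, hx⟩ α hgα
    rw [← Subgroup.mem_centralizer_iff.1 hc _ (e' ⟨x, hx⟩).2, mul_inv_cancel_right] at h3
    have h4 : x = g * x * g⁻¹ := by
      rw [hgα ⟨x, hx⟩]
      exact congrArg Subtype.val (e'.injective (Subtype.ext h3))
    exact (mul_inv_eq_iff_eq_mul.1 h4.symm).symm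
  · intro hdvd
    rw [← Subgroup.relIndex_map_map_of_injective (f := c) _ _ (MulAut.congr e).injective] at hdvd
    -- It remains to see that an element of $\mathrm{Aut}_F(Q)\cap K$ whose transport is induced by
    -- `S` is itself induced by `S`; surjectivity of the extension supplies the inducing element.
    refine hχH (hdvd.trans ?_)
    rw [← Subgroup.inf_relIndex_right (Subgroup.comap _ _)]
    refine Subgroup.relIndex_dvd_of_le_left _ ?_
    rintro _ ⟨hβ, α, hα, rfl⟩
    refine ⟨α, ⟨?_, hα.2⟩, rfl⟩
    obtain ⟨h, hh⟩ := mem_autS_iff.1 hβ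
    have hh' : ∀ x : Q, h * e' x * h⁻¹ = e' (α x) := fun x => by
      rw [hh]
      change (χ (e (α (e.symm (χ⁻¹ (χ (e x)))))) : S) = χ (e (α x))
      rw [MulAut.inv_apply_self, e.symm_apply_apply]
    have hhK : h ∈ kNormalizer R K' := by
      refine mem_kNormalizer.2 ⟨MulAut.congr e' α, ?_, fun y => ?_⟩
      · change (MulAut.congr e').symm (MulAut.congr e' α) ∈ K
        rw [MulEquiv.symm_apply_apply]
        exact hα.2
      · obtain ⟨x, rfl⟩ := e'.surjective y
        rw [hh']
        change _ = (e' (α (e'.symm (e' x))) : S)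
        rw [e'.symm_apply_apply]
    obtain ⟨g, hg, rfl⟩ := hsurj h hhK
    obtain ⟨α', hα', hgα'⟩ := mem_kNormalizer.1 hg
    refine mem_autS_iff.2 ⟨g, fun x => ?_⟩
    have h1 := hh' x
    rw [hconj g hg x α' hgα'] at h1
    rw [hgα', e'.injective (Subtype.ext h1)]

end FusionSystem

/-! ### Passing from $P$ to $PQ$. -/

namespace FusionSystem

variable {p : ℕ} {S : Type*} [Group S] {F : FusionSystem S}

/-- The automorphisms of `B` which restrict to an element of `L` on `A`. -/
def resAut {A B : Subgroup S} (h : A ≤ B) (L : Subgroup (MulAut A)) : Subgroup (MulAut B) where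
  carrier := {β | ∃ α ∈ L, ∀ x : A, β (Subgroup.inclusion h x) = Subgroup.inclusion h (α x)}
  one_mem' := ⟨1, one_mem _, fun _ => rfl⟩
  mul_mem' := by
    rintro β β' ⟨α, hα, h1⟩ ⟨α', hα', h2⟩
    exact ⟨α * α', mul_mem hα hα', fun x => by
      rw [MulAut.mul_apply, h2, h1, MulAut.mul_apply]⟩
  inv_mem' := by
    rintro β ⟨α, hα, h1⟩
    refine ⟨α⁻¹, inv_mem hα, fun x => ?_⟩
    apply β.injective
    rw [h1, MulAut.apply_inv_self, MulAut.apply_inv_self]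

theorem mem_resAut {A B : Subgroup S} {h : A ≤ B} {L : Subgroup (MulAut A)} {β : MulAut B} :
    β ∈ resAut h L ↔ ∃ α ∈ L, ∀ x : A, (β (Subgroup.inclusion h x) : S) = α x :=
  exists_congr fun _ => and_congr_right fun _ => forall_congr' fun _ => Subtype.ext_iff

/-- The restriction homomorphism. -/
noncomputable def resHom {A B : Subgroup S} (h : A ≤ B) : resAut h (⊤ : Subgroup (MulAut A)) →*
    MulAut A where
  toFun β := β.2.choose
  map_one' := by
    ext x
    have h1 := (1 : resAut h (⊤ : Subgroup (MulAut A))).2.choose_spec.2 x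
    exact (congrArg Subtype.val h1).symm
  map_mul' β β' := by
    ext x
    have h1 := congrArg Subtype.val ((β * β').2.choose_spec.2 x)
    refine h1.symm.trans ?_
    change ((β : MulAut B) ((β' : MulAut B) (Subgroup.inclusion h x)) : S) = _
    rw [β'.2.choose_spec.2, β.2.choose_spec.2]
    rfl

theorem coe_resHom {A B : Subgroup S} {h : A ≤ B} (β : resAut h (⊤ : Subgroup (MulAut A)))
    (x : A) : (resHom h β x : S) = (β : MulAut B) (Subgroup.inclusion h x) :=
  (congrArg Subtype.val (β.2.choose_spec.2 x)).symm

theorem kNormalizer_mono {P : Subgroup S} {K L : Subgroup (MulAut P)} (h : K ≤ L) :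
    kNormalizer P K ≤ kNormalizer P L :=
  Subgroup.map_mono (Subgroup.comap_mono h)

/-- The automorphisms of `PQ` which restrict to elements of `L` on `P` and of `K` on `Q`. -/
def supAut {P Q : Subgroup S} (L : Subgroup (MulAut P)) (K : Subgroup (MulAut Q)) :
    Subgroup (MulAut (P ⊔ Q : Subgroup S)) :=
  resAut le_sup_left L ⊓ resAut le_sup_right K

theorem exists_mulAut_of_mem_normalizer {P : Subgroup S} {g : S}
    (hg : g ∈ Subgroup.normalizer (P : Set S)) : ∃ α : MulAut P, ∀ x : P, g * x * g⁻¹ = α x :=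
  ⟨P.normalizerMonoidHom ⟨g, hg⟩, fun _ => rfl⟩

theorem kNormalizer_le_normalizer (P : Subgroup S) (K : Subgroup (MulAut P)) :
    kNormalizer P K ≤ Subgroup.normalizer (P : Set S) := by
  rintro _ ⟨x, -, rfl⟩
  exact x.2

theorem mem_supAut_of_conj {P Q : Subgroup S} {L : Subgroup (MulAut P)} {K : Subgroup (MulAut Q)}
    {g : S} (hP : g ∈ kNormalizer P L) (hQ : g ∈ kNormalizer Q K)
    {β : MulAut (P ⊔ Q : Subgroup S)} (hβ : ∀ x : (P ⊔ Q : Subgroup S), g * x * g⁻¹ = β x) :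
    β ∈ supAut L K := by
  obtain ⟨α, hα, hgα⟩ := mem_kNormalizer.1 hP
  obtain ⟨κ, hκ, hgκ⟩ := mem_kNormalizer.1 hQ
  exact ⟨mem_resAut.2 ⟨α, hα, fun x => by rw [← hβ]; exact hgα x⟩,
    mem_resAut.2 ⟨κ, hκ, fun x => by rw [← hβ]; exact hgκ x⟩⟩

theorem exists_mulAut_sup {P Q : Subgroup S} {L : Subgroup (MulAut P)} {K : Subgroup (MulAut Q)}
    {g : S} (hP : g ∈ kNormalizer P L) (hQ : g ∈ kNormalizer Q K) :
    ∃ β ∈ supAut L K, ∀ x : (P ⊔ Q : Subgroup S), g * x * g⁻¹ = β x := by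
  obtain ⟨β, hβ⟩ := exists_mulAut_of_mem_normalizer
    (Subgroup.normalizer_inf_normalizer_le_normalizer_sup P Q
      ⟨kNormalizer_le_normalizer _ _ hP, kNormalizer_le_normalizer _ _ hQ⟩)
  exact ⟨β, mem_supAut_of_conj hP hQ hβ, hβ⟩

/-- This turns questions inside $N_S^K(Q)$ into questions about `P ⊔ Q` in `F`: `L = ⊤` yields the
normalizer of `P` there, and `L = ⊥` its centralizer. -/
theorem kNormalizer_supAut {P Q : Subgroup S} (L : Subgroup (MulAut P))
    (K : Subgroup (MulAut Q)) :
    kNormalizer (P ⊔ Q) (supAut L K) = kNormalizer P L ⊓ kNormalizer Q K := by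
  refine le_antisymm (fun g hg => ?_) fun g hg => ?_
  · obtain ⟨β, ⟨hβL, hβK⟩, hgβ⟩ := mem_kNormalizer.1 hg
    obtain ⟨α, hα, hβα⟩ := mem_resAut.1 hβL
    obtain ⟨κ, hκ, hβκ⟩ := mem_resAut.1 hβK
    exact ⟨mem_kNormalizer.2 ⟨α, hα, fun x => by
        rw [← hβα]; exact hgβ (Subgroup.inclusion le_sup_left x)⟩,
      mem_kNormalizer.2 ⟨κ, hκ, fun x => by
        rw [← hβκ]; exact hgβ (Subgroup.inclusion le_sup_right x)⟩⟩
  · exact mem_kNormalizer.2 (exists_mulAut_sup hg.1 hg.2)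

/-- `f` restricts to a morphism of `F` on `PQ` and to an element of `K` on `Q`. -/
def NMor (F : FusionSystem S) {Q : Subgroup S} (K : Subgroup (MulAut Q)) (P : Subgroup S)
    (f : S → S) : Prop :=
  F.Mor (P ⊔ Q) f ∧ ∃ κ ∈ K, ∀ y : Q, f y = κ y

variable {Q : Subgroup S} {K : Subgroup (MulAut Q)}

theorem NMor.exists_equiv_sup {P R : Subgroup S} {f : S → S} (hf : F.NMor K P f) (e : P ≃* R)
    (he : ∀ x : P, (e x : S) = f x) :
    ∃ ε : (P ⊔ Q : Subgroup S) ≃* (R ⊔ Q : Subgroup S),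
      ε.toMonoidHom ∈ F.hom (P ⊔ Q) (R ⊔ Q) ∧ ∀ x, (ε x : S) = f x := by
  obtain ⟨hfm, κ, hκ, hfκ⟩ := hf
  obtain ⟨X, ε, hε, hεf⟩ := hfm.exists_equiv
  have hX : X = R ⊔ Q := by
    refine le_antisymm (fun x hx => ?_) (sup_le (fun x hx => ?_) fun x hx => ?_)
    · obtain ⟨z, hz⟩ := ε.surjective ⟨x, hx⟩
      have h1 : f z = x := by rw [← hεf, hz]
      rw [← h1]
      refine hfm.sup_mem le_rfl (fun a ha => ?_) (fun a ha => ?_) z z.2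
      · rw [← he ⟨a, ha⟩]
        exact Subgroup.mem_sup_left (e _).2
      · rw [hfκ ⟨a, ha⟩]
        exact Subgroup.mem_sup_right (κ _).2
    · obtain ⟨a, ha⟩ := e.surjective ⟨x, hx⟩
      have h1 : f a = x := by rw [← he, ha]
      have h2 : (ε (Subgroup.inclusion le_sup_left a) : S) = f a := hεf _
      rw [← h1, ← h2]
      exact (ε _).2
    · obtain ⟨a, ha⟩ := κ.surjective ⟨x, hx⟩
      have h1 : f a = x := by rw [hfκ, ha]
      have h2 : (ε (Subgroup.inclusion le_sup_right a) : S) = f a := hεf _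
      rw [← h1, ← h2]
      exact (ε _).2
  subst hX
  exact ⟨ε, hε, hεf⟩

/-- The hypothesis `hL` bounds only conjugates by morphisms that preserve `Q`, whereas the
conclusion concerns all $F$-conjugates `X` of `P ⊔ Q`. Such an `X` contains a conjugate `Q'` of `Q`;
the extension lemma for `Q' → Q` moves `Q'` back to `Q` and embeds the normalizer of `X` into one
bounded by `hL`. -/
theorem IsSaturated.isFullyKNormalized_sup (hp : p.Prime) (hS : IsDiscretePToral p S)
    (hF : F.IsSaturated p) (hQ : F.IsFullyKNormalized p Q K) {P : Subgroup S}
    (hP : P ≤ kNormalizer Q K) (L : Subgroup (MulAut P))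
    (hL : ∀ R ≤ kNormalizer Q K, ∀ f, F.NMor K P f → ∀ e : P ≃* R, (∀ x, (e x : S) = f x) →
      pToralOrder p
          (kNormalizer R (L.comap (MulAut.congr e.symm).toMonoidHom) ⊓ kNormalizer Q K :
            Subgroup S) ≤
        pToralOrder p (kNormalizer P L ⊓ kNormalizer Q K : Subgroup S)) :
    F.IsFullyKNormalized p (P ⊔ Q) (supAut L K) := by
  obtain ⟨hQc, hQs⟩ := hF.isFullyCentralized_and_not_dvd hp hS hQ
  refine isFullyKNormalized_iff.2 fun X e he => ?_
  rw [kNormalizer_supAut]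
  obtain ⟨f₀, hf₀, hef₀⟩ := exists_mor_of_mem (F.symm_mem he)
  have hef₀' : ∀ z : (P ⊔ Q : Subgroup S), (e.symm z : S) = f₀ z := hef₀
  obtain ⟨Q', ε, hε, hεf⟩ := (hf₀.mono le_sup_right).exists_equiv
  obtain ⟨χ, hχ, f, hf, hfχ, hfN⟩ := hF.exists_extend_of_not_dvd hp hS hQc hQs (F.symm_mem hε)
  have hfε : ∀ y : Q, f (f₀ y) = χ y := fun y => by
    rw [← hεf, hfχ, ε.symm_apply_apply]
  have hN' : ∀ g : S, ∀ κ ∈ K, (∀ y : Q, g * f₀ y * g⁻¹ = f₀ (κ y)) →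
      g ∈ kNormalizer Q' (K.comap (MulAut.congr ε.symm).toMonoidHom) := by
    intro g κ hκ hg
    refine mem_kNormalizer.2 ⟨MulAut.congr ε κ, ?_, fun z => ?_⟩
    · change (MulAut.congr ε).symm (MulAut.congr ε κ) ∈ K
      rwa [MulEquiv.symm_apply_apply]
    · obtain ⟨y, rfl⟩ := ε.surjective z
      change _ = (ε (κ (ε.symm (ε y))) : S)
      rw [ε.symm_apply_apply, hεf, hεf, hg]
  have hPN' : ∀ x ∈ P, f₀ x ∈ kNormalizer Q' (K.comap (MulAut.congr ε.symm).toMonoidHom) := by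
    intro x hx
    obtain ⟨κ, hκ, hxκ⟩ := mem_kNormalizer.1 (hP hx)
    refine hN' _ κ hκ fun y => ?_
    rw [← hf₀.map_conj (Subgroup.mem_sup_left hx) (Subgroup.mem_sup_right y.2), hxκ]
  have hmaps : ∀ z ∈ P ⊔ Q,
      f₀ z ∈ kNormalizer Q' (K.comap (MulAut.congr ε.symm).toMonoidHom) ⊔ Q' := by
    refine hf₀.sup_mem le_rfl (fun x hx => Subgroup.mem_sup_left (hPN' x hx)) fun y hy => ?_
    rw [← hεf ⟨y, hy⟩]
    exact Subgroup.mem_sup_right (ε _).2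
  -- On `Q` the composite is the twist `χ`, which lies in `K`; so it is a morphism of the normalizer
  -- system.
  have hh : F.NMor K P fun x => f (f₀ x) := ⟨hf₀.comp hf hmaps, χ, hχ.2, hfε⟩
  obtain ⟨R, e', he', he'h⟩ := (hh.1.mono le_sup_left).exists_equiv
  have hR : R ≤ kNormalizer Q K := by
    intro r hr
    obtain ⟨x, hx⟩ := e'.surjective ⟨r, hr⟩
    have h1 := he'h x
    rw [hx] at h1
    have h2 : r = f (f₀ x) := h1
    rw [h2]
    exact hfN _ (hPN' x x.2)
  refine le_trans ?_ (hL R hR _ hh e' he'h)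
  have hX : ∀ g ∈ kNormalizer X ((supAut L K).comap (MulAut.congr e).toMonoidHom),
      ∃ β ∈ supAut L K, ∀ z : (P ⊔ Q : Subgroup S), g * f₀ z * g⁻¹ = f₀ (β z) := by
    intro g hg
    obtain ⟨γ, hγ, hgγ⟩ := mem_kNormalizer.1 hg
    refine ⟨MulAut.congr e γ, hγ, fun z => ?_⟩
    rw [← hef₀', ← hef₀', hgγ]
    change _ = (e.symm (e (γ (e.symm z))) : S)
    rw [e.symm_apply_apply]
  have hXN : ∀ g ∈ kNormalizer X ((supAut L K).comap (MulAut.congr e).toMonoidHom),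
      g ∈ kNormalizer Q' (K.comap (MulAut.congr ε.symm).toMonoidHom) := by
    intro g hg
    obtain ⟨β, ⟨-, hβ⟩, hgβ⟩ := hX g hg
    obtain ⟨κ, hκ, hβκ⟩ := mem_resAut.1 hβ
    refine hN' g κ hκ fun y => ?_
    rw [← hβκ]
    exact hgβ (Subgroup.inclusion le_sup_right y)
  refine order_le_of_mor hp hS (hf.mono fun g hg => Subgroup.mem_sup_left (hXN g hg))
    fun g hg => ⟨?_, hfN g (hXN g hg)⟩
  obtain ⟨β, ⟨hβ, -⟩, hgβ⟩ := hX g hg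
  obtain ⟨α, hα, hβα⟩ := mem_resAut.1 hβ
  refine mem_kNormalizer.2 ⟨MulAut.congr e' α, ?_, fun r => ?_⟩
  · change (MulAut.congr e').symm (MulAut.congr e' α) ∈ L
    rwa [MulEquiv.symm_apply_apply]
  · obtain ⟨x, rfl⟩ := e'.surjective r
    change _ = (e' (α (e'.symm (e' x))) : S)
    rw [e'.symm_apply_apply, he'h, he'h]
    rw [← hf.map_conj (Subgroup.mem_sup_left (hXN g hg))
      (hmaps x (Subgroup.mem_sup_left x.2)), ← hβα]
    exact congrArg f (hgβ (Subgroup.inclusion le_sup_left x))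

/-- The converse passage: a morphism of the normalizer system is an isomorphism $PQ\to RQ$ whose
restriction to `Q` lies in `K`, so conjugation by it preserves the condition at `Q` and only
transports `L`. -/
theorem order_le_of_isFullyKNormalized_sup (hp : p.Prime) (hS : IsDiscretePToral p S)
    {P : Subgroup S} {L : Subgroup (MulAut P)}
    (h : F.IsFullyKNormalized p (P ⊔ Q) (supAut L K)) {R : Subgroup S} {f : S → S}
    (hf : F.NMor K P f) (e : P ≃* R) (he : ∀ x, (e x : S) = f x) :
    pToralOrder p
        (kNormalizer R (L.comap (MulAut.congr e.symm).toMonoidHom) ⊓ kNormalizer Q K :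
          Subgroup S) ≤
      pToralOrder p (kNormalizer P L ⊓ kNormalizer Q K : Subgroup S) := by
  obtain ⟨ε, hε, hεf⟩ := hf.exists_equiv_sup e he
  obtain ⟨-, κ, hκ, hfκ⟩ := hf
  have h1 := isFullyKNormalized_iff.1 h _ ε.symm (F.symm_mem hε)
  rw [kNormalizer_supAut] at h1
  refine le_trans ?_ h1
  rw [← kNormalizer_supAut]
  have hle : supAut (L.comap (MulAut.congr e.symm).toMonoidHom) K ≤
      (supAut L K).comap (MulAut.congr ε.symm).toMonoidHom := by
    rintro β ⟨hβL, hβK⟩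
    obtain ⟨α, hα, hβα⟩ := mem_resAut.1 hβL
    obtain ⟨κ', hκ', hβκ⟩ := mem_resAut.1 hβK
    refine ⟨mem_resAut.2 ⟨_, hα, fun x => ?_⟩, mem_resAut.2
      ⟨κ⁻¹ * κ' * κ, mul_mem (mul_mem (inv_mem hκ) hκ') hκ, fun y => ?_⟩⟩
    · have hex : ∀ x : P, ε (Subgroup.inclusion le_sup_left x)
          = Subgroup.inclusion le_sup_left (e x) := fun x => Subtype.ext (by
        rw [hεf]; exact (he x).symm)
      have h2 : β (ε (Subgroup.inclusion le_sup_left x)) =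
          ε (Subgroup.inclusion le_sup_left (e.symm (α (e x)))) := by
        rw [hex, hex, e.apply_symm_apply]
        exact Subtype.ext (hβα _)
      change (ε.symm (β (ε (Subgroup.inclusion le_sup_left x))) : S) = e.symm (α (e x))
      rw [h2, ε.symm_apply_apply]
      rfl
    · have hey : ∀ y : Q, ε (Subgroup.inclusion le_sup_right y)
          = Subgroup.inclusion le_sup_right (κ y) := fun y => Subtype.ext (by
        rw [hεf]; exact hfκ y)
      have h2 : β (ε (Subgroup.inclusion le_sup_right y)) =
          ε (Subgroup.inclusion le_sup_right (κ⁻¹ (κ' (κ y)))) := by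
        rw [hey, hey, MulAut.apply_inv_self]
        exact Subtype.ext (hβκ _)
      change (ε.symm (β (ε (Subgroup.inclusion le_sup_right y))) : S) = κ⁻¹ (κ' (κ y))
      rw [h2, ε.symm_apply_apply]
      rfl
  exact (hS.subgroup hp _).order_le hp (Subgroup.inclusion (kNormalizer_mono hle))
    (Subgroup.inclusion_injective _)

end FusionSystem

/-! ### Axiom (I) for the normalizer system. -/

namespace FusionSystem

variable {p : ℕ} {S : Type*} [Group S] {F : FusionSystem S} {Q : Subgroup S}
  {K : Subgroup (MulAut Q)}

theorem map_subtype_le_kNormalizer (P : Subgroup (kNormalizer Q K)) :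
    P.map (kNormalizer Q K).subtype ≤ kNormalizer Q K := by
  rintro _ ⟨x, -, rfl⟩
  exact x.2

/-- A subgroup of `N_S^K(Q)` as a subgroup of `S`. -/
noncomputable abbrev mapEquiv (P : Subgroup (kNormalizer Q K)) :
    P ≃* P.map (kNormalizer Q K).subtype :=
  P.equivMapOfInjective (kNormalizer Q K).subtype (kNormalizer Q K).subtype_injective

theorem coe_mapEquiv_symm (P : Subgroup (kNormalizer Q K))
    (x : P.map (kNormalizer Q K).subtype) : (((mapEquiv P).symm x : kNormalizer Q K) : S) = x :=
  congrArg Subtype.val ((mapEquiv P).apply_symm_apply x)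

/-- Membership becomes a property of one function on `S`, so the nested subgroup types need not be
handled again. -/
theorem mem_normalizer_hom {P R : Subgroup (kNormalizer Q K)} {φ : P →* R} :
    φ ∈ (F.normalizer Q K).hom P R ↔
      ∃ f, F.NMor K (P.map (kNormalizer Q K).subtype) f ∧
        ∀ x : P, ((φ x : kNormalizer Q K) : S) = f x := by
  constructor
  · rintro ⟨-, ψ, hψ, hψP, κ, hκ, hψQ⟩
    obtain ⟨f, hf, hψf⟩ := exists_mor_of_mem hψ
    refine ⟨f, ⟨hf, κ, hκ, fun y => ?_⟩, fun x => ?_⟩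
    · rw [← hψQ y]
      exact (hψf (Subgroup.inclusion le_sup_right y)).symm
    · have h1 := hψP (mapEquiv P x)
      rw [coe_liftHom φ (mapEquiv P x) x rfl] at h1
      rw [← h1]
      exact hψf _
  · rintro ⟨f, ⟨hf, κ, hκ, hfκ⟩, hφ⟩
    have hlift : ∀ x, (liftHom φ x : S) = f x := fun x => by
      obtain ⟨y, hy⟩ := exists_coe_eq x
      rw [coe_liftHom φ x y hy, hφ, hy]
    obtain ⟨ψ, hψ, hψf⟩ := hf.exists_hom (Q := R.map (kNormalizer Q K).subtype ⊔ Q)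
      (hf.sup_mem le_rfl
        (fun x hx => by
          rw [← hlift ⟨x, hx⟩]
          exact Subgroup.mem_sup_left (liftHom φ _).2)
        (fun y hy => by
          rw [hfκ ⟨y, hy⟩]
          exact Subgroup.mem_sup_right (κ _).2))
    refine ⟨(hf.mono le_sup_left).mem hlift, ψ, hψ, fun x => ?_, κ, hκ, fun y => ?_⟩
    · rw [hψf, hlift]
      rfl
    · rw [hψf, ← hfκ]
      rfl

theorem NMor.exists_normalizer_hom {P : Subgroup (kNormalizer Q K)} {f : S → S}
    (hf : F.NMor K (P.map (kNormalizer Q K).subtype) f)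
    (h : ∀ x ∈ P, f x ∈ kNormalizer Q K) :
    ∃ φ ∈ (F.normalizer Q K).hom P ⊤, ∀ x : P, ((φ x : kNormalizer Q K) : S) = f x := by
  have hm : ∀ x ∈ P, (x : S) ∈ P.map (kNormalizer Q K).subtype := fun x hx => ⟨x, hx, rfl⟩
  let φ : P →* (⊤ : Subgroup (kNormalizer Q K)) :=
    { toFun := fun x => ⟨⟨f x, h x x.2⟩, trivial⟩
      map_one' := Subtype.ext (Subtype.ext (by
        have h1 := hf.1.map_mul (one_mem _) (one_mem _)
        rw [mul_one] at h1
        exact left_eq_mul.1 h1))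
      map_mul' := fun x y => Subtype.ext (Subtype.ext (hf.1.map_mul
        (Subgroup.mem_sup_left (hm x x.2)) (Subgroup.mem_sup_left (hm y y.2)))) }
  exact ⟨φ, mem_normalizer_hom.2 ⟨f, hf, fun x => rfl⟩, fun x => rfl⟩

theorem isConj_normalizer_iff {P R : Subgroup (kNormalizer Q K)} :
    (F.normalizer Q K).IsConj P R ↔ ∃ f, F.NMor K (P.map (kNormalizer Q K).subtype) f ∧
      ∃ e : P.map (kNormalizer Q K).subtype ≃* R.map (kNormalizer Q K).subtype,
        ∀ x, (e x : S) = f x := by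
  constructor
  · rintro ⟨e, he, -⟩
    obtain ⟨f, hf, hef⟩ := mem_normalizer_hom.1 he
    refine ⟨f, hf, (mapEquiv P).symm.trans (e.trans (mapEquiv R)), fun x => ?_⟩
    have h1 := hef ((mapEquiv P).symm x)
    rw [coe_mapEquiv_symm] at h1
    exact h1
  · rintro ⟨f, hf, e, he⟩
    have h1 : ((mapEquiv P).trans (e.trans (mapEquiv R).symm)).toMonoidHom ∈
        (F.normalizer Q K).hom P R := by
      refine mem_normalizer_hom.2 ⟨f, hf, fun x => ?_⟩
      exact (coe_mapEquiv_symm R (e (mapEquiv P x))).trans (he _)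
    exact ⟨_, h1, (F.normalizer Q K).symm_mem h1⟩

theorem map_normalizer (P : Subgroup (kNormalizer Q K)) :
    (Subgroup.normalizer (P : Set (kNormalizer Q K))).map (kNormalizer Q K).subtype =
      kNormalizer (P.map (kNormalizer Q K).subtype) ⊤ ⊓ kNormalizer Q K := by
  ext g
  constructor
  · rintro ⟨n, hn, rfl⟩
    refine ⟨?_, n.2⟩
    obtain ⟨α, hα⟩ := exists_mulAut_of_mem_normalizer hn
    refine mem_kNormalizer.2 ⟨MulAut.congr (mapEquiv P) α, trivial, fun x => ?_⟩
    obtain ⟨y, rfl⟩ := (mapEquiv P).surjective x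
    change _ = (mapEquiv P (α ((mapEquiv P).symm (mapEquiv P y))) : S)
    rw [(mapEquiv P).symm_apply_apply]
    exact congrArg Subtype.val (hα y)
  · rintro ⟨hg, hgN⟩
    obtain ⟨α, -, hα⟩ := mem_kNormalizer.1 hg
    refine ⟨⟨g, hgN⟩, ?_, rfl⟩
    refine kNormalizer_le_normalizer P ⊤
      (mem_kNormalizer.2 ⟨(MulAut.congr (mapEquiv P)).symm α, trivial, fun x => ?_⟩)
    refine Subtype.ext ((hα (mapEquiv P x)).trans ?_)
    exact (coe_mapEquiv_symm P _).symm

theorem map_centralizer (P : Subgroup (kNormalizer Q K)) :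
    (Subgroup.centralizer (P : Set (kNormalizer Q K))).map (kNormalizer Q K).subtype =
      kNormalizer (P.map (kNormalizer Q K).subtype) ⊥ ⊓ kNormalizer Q K := by
  ext g
  constructor
  · rintro ⟨n, hn, rfl⟩
    refine ⟨mem_kNormalizer.2 ⟨1, one_mem _, fun x => ?_⟩, n.2⟩
    obtain ⟨_, y, hy, rfl⟩ := x
    change ((n * y * n⁻¹ : kNormalizer Q K) : S) = y
    rw [← Subgroup.mem_centralizer_iff.1 hn y hy, mul_inv_cancel_right]
  · rintro ⟨hg, hgN⟩
    obtain ⟨α, hα, hgα⟩ := mem_kNormalizer.1 hg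
    rw [Subgroup.mem_bot.1 hα] at hgα
    refine ⟨⟨g, hgN⟩, Subgroup.mem_centralizer_iff.2 fun y hy => ?_, rfl⟩
    have h1 : g * y * g⁻¹ = y := hgα (mapEquiv P ⟨y, hy⟩)
    exact Subtype.ext (mul_inv_eq_iff_eq_mul.1 h1).symm

theorem order_normalizer (hp : p.Prime) (hS : IsDiscretePToral p S)
    (P : Subgroup (kNormalizer Q K)) :
    pToralOrder p (Subgroup.normalizer (P : Set (kNormalizer Q K))) =
      pToralOrder p (kNormalizer (P.map (kNormalizer Q K).subtype) ⊤ ⊓ kNormalizer Q K :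
        Subgroup S) := by
  rw [← map_normalizer]
  exact (hS.subgroup hp _).order_congr hp
    (Subgroup.equivMapOfInjective _ _ (kNormalizer Q K).subtype_injective)

theorem order_centralizer (hp : p.Prime) (hS : IsDiscretePToral p S)
    (P : Subgroup (kNormalizer Q K)) :
    pToralOrder p (Subgroup.centralizer (P : Set (kNormalizer Q K))) =
      pToralOrder p (kNormalizer (P.map (kNormalizer Q K).subtype) ⊥ ⊓ kNormalizer Q K :
        Subgroup S) := by
  rw [← map_centralizer]
  exact (hS.subgroup hp _).order_congr hp
    (Subgroup.equivMapOfInjective _ _ (kNormalizer Q K).subtype_injective)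

theorem IsSaturated.isFullyKNormalized_sup_top (hp : p.Prime) (hS : IsDiscretePToral p S)
    (hF : F.IsSaturated p) (hQ : F.IsFullyKNormalized p Q K) {P : Subgroup (kNormalizer Q K)}
    (hP : (F.normalizer Q K).IsFullyNormalized p P) :
    F.IsFullyKNormalized p (P.map (kNormalizer Q K).subtype ⊔ Q) (supAut ⊤ K) := by
  refine hF.isFullyKNormalized_sup hp hS hQ (map_subtype_le_kNormalizer P) ⊤
    fun R hR f hf e he => ?_
  obtain ⟨R, rfl⟩ : ∃ R' : Subgroup (kNormalizer Q K), R'.map (kNormalizer Q K).subtype = R :=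
    ⟨R.subgroupOf _, Subgroup.map_subgroupOf_eq_of_le hR⟩
  have h1 := hP R (isConj_normalizer_iff.2 ⟨f, hf, e, he⟩)
  rwa [order_normalizer hp hS, order_normalizer hp hS] at h1

theorem IsSaturated.isFullyKNormalized_sup_bot (hp : p.Prime) (hS : IsDiscretePToral p S)
    (hF : F.IsSaturated p) (hQ : F.IsFullyKNormalized p Q K) {P : Subgroup (kNormalizer Q K)}
    (hP : (F.normalizer Q K).IsFullyCentralized p P) :
    F.IsFullyKNormalized p (P.map (kNormalizer Q K).subtype ⊔ Q) (supAut ⊥ K) := by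
  refine hF.isFullyKNormalized_sup hp hS hQ (map_subtype_le_kNormalizer P) ⊥
    fun R hR f hf e he => ?_
  obtain ⟨R, rfl⟩ : ∃ R' : Subgroup (kNormalizer Q K), R'.map (kNormalizer Q K).subtype = R :=
    ⟨R.subgroupOf _, Subgroup.map_subgroupOf_eq_of_le hR⟩
  have h1 := hP R (isConj_normalizer_iff.2 ⟨f, hf, e, he⟩)
  rw [order_centralizer hp hS, order_centralizer hp hS] at h1
  rwa [MonoidHom.comap_bot, (MonoidHom.ker_eq_bot_iff _).2 (MulAut.congr e.symm).injective]

theorem isFullyCentralized_normalizer (hp : p.Prime) (hS : IsDiscretePToral p S)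
    {P : Subgroup (kNormalizer Q K)}
    (h : F.IsFullyKNormalized p (P.map (kNormalizer Q K).subtype ⊔ Q) (supAut ⊥ K)) :
    (F.normalizer Q K).IsFullyCentralized p P := by
  intro R hR
  obtain ⟨f, hf, e, he⟩ := isConj_normalizer_iff.1 hR
  have h1 := order_le_of_isFullyKNormalized_sup hp hS h hf e he
  rw [MonoidHom.comap_bot, (MonoidHom.ker_eq_bot_iff _).2 (MulAut.congr e.symm).injective] at h1
  rwa [order_centralizer hp hS, order_centralizer hp hS]

theorem supAut_mono {P : Subgroup S} {L L' : Subgroup (MulAut P)} (h : L ≤ L') :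
    supAut L K ≤ supAut L' K :=
  inf_le_inf_right _ fun _ ⟨α, hα, h1⟩ => ⟨α, h hα, h1⟩

theorem conj_mem_supAut_bot {P : Subgroup S} {β γ : MulAut (P ⊔ Q : Subgroup S)}
    (hβ : β ∈ supAut (⊤ : Subgroup (MulAut P)) K) (hγ : γ ∈ supAut (⊥ : Subgroup (MulAut P)) K) :
    β * γ * β⁻¹ ∈ supAut (⊥ : Subgroup (MulAut P)) K := by
  obtain ⟨hβP, hβQ⟩ := Subgroup.mem_inf.1 hβ
  obtain ⟨hγP, hγQ⟩ := Subgroup.mem_inf.1 hγ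
  refine Subgroup.mem_inf.2 ⟨?_, mul_mem (mul_mem hβQ hγQ) (inv_mem hβQ)⟩
  obtain ⟨α', hα', h2⟩ := hγP
  obtain ⟨α'', -, h3⟩ := inv_mem hβP
  refine ⟨1, one_mem _, fun x => ?_⟩
  rw [MulAut.mul_apply, MulAut.mul_apply, h3, h2, Subgroup.mem_bot.1 hα', MulAut.one_apply,
    ← h3, MulAut.apply_inv_self, MulAut.one_apply]

/-- The criterion gives the Sylow property for `M = supAut ⊤ K` on $PQ$. It descends to the subgroup
`C = supAut ⊥ K`, normal in `M`, so the criterion in reverse shows that `P` is fully centralized.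
Restriction from $PQ$ to `P` carries the Sylow property of `M` to the automorphisms of `P`. -/
theorem IsSaturated.sylow_normalizer (hp : p.Prime) (hS : IsDiscretePToral p S)
    (hF : F.IsSaturated p) (hQ : F.IsFullyKNormalized p Q K) {P : Subgroup (kNormalizer Q K)}
    (hP : (F.normalizer Q K).IsFullyNormalized p P) :
    (F.normalizer Q K).IsFullyCentralized p P ∧
      ¬p ∣ (autS P).relIndex ((F.normalizer Q K).autF P) := by
  let N := kNormalizer Q K
  let P' := P.map N.subtype
  let M : Subgroup (MulAut (P' ⊔ Q : Subgroup S)) := supAut ⊤ K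
  let C : Subgroup (MulAut (P' ⊔ Q : Subgroup S)) := supAut ⊥ K
  have hCM : C ≤ M := supAut_mono bot_le
  obtain ⟨hc, hs⟩ := hF.isFullyCentralized_and_not_dvd hp hS
    (hF.isFullyKNormalized_sup_top hp hS hQ hP)
  constructor
  · have h1 := Subgroup.not_dvd_relIndex_of_normal (inf_le_inf_right M (autS_le_autF (P' ⊔ Q)))
      (D := F.autF (P' ⊔ Q) ⊓ C) (inf_le_inf_left _ hCM) (fun a ha d hd => by
        have ha' : a ∈ F.autF (P' ⊔ Q) := autS_le_autF _ (Subgroup.mem_inf.1 ha).1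
        obtain ⟨hd1, hd2⟩ := Subgroup.mem_inf.1 hd
        exact Subgroup.mem_inf.2 ⟨mul_mem (mul_mem ha' hd1) (inv_mem ha'),
          conj_mem_supAut_bot (Subgroup.mem_inf.1 ha).2 hd2⟩) hs
    refine isFullyCentralized_normalizer hp hS (hF.isFullyKNormalized_of_not_dvd hp hS hc ?_)
    rw [← Subgroup.inf_relIndex_right] at h1 ⊢
    convert h1 using 3
    refine le_antisymm ?_ ?_
    · exact fun x hx => ⟨⟨hx.1.1, hCM hx.1.2⟩, hx.2⟩
    · exact fun x hx => ⟨⟨hx.1.1, hx.2.2⟩, hx.2⟩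
  · let ρ : M →* MulAut P := (MulAut.congr (mapEquiv P).symm).toMonoidHom.comp
      ((resHom le_sup_left).comp (Subgroup.inclusion inf_le_left))
    have hρ : ∀ (β : M) (x : P), ((ρ β x : N) : S) =
        (β : MulAut (P' ⊔ Q : Subgroup S)) (Subgroup.inclusion le_sup_left (mapEquiv P x)) := by
      intro β x
      have h1 := coe_resHom (Subgroup.inclusion inf_le_left β) (mapEquiv P x)
      rw [← coe_mapEquiv_symm] at h1
      exact h1
    -- By construction of the normalizer system, its automorphisms of `P` are exactly the
    -- restrictions from $PQ$.
    have hB : (F.normalizer Q K).autF P = ((F.autF (P' ⊔ Q) ⊓ M).subgroupOf M).map ρ := by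
      ext α
      constructor
      · intro hα
        obtain ⟨f, hf, hαf⟩ := mem_normalizer_hom.1 hα.1
        obtain ⟨ε, hε, hεf⟩ := hf.exists_equiv_sup (MulAut.congr (mapEquiv P) α) fun x => by
          have h1 := hαf ((mapEquiv P).symm x)
          rw [coe_mapEquiv_symm] at h1
          exact h1
        obtain ⟨-, κ, hκ, hfκ⟩ := hf
        have hεM : ε ∈ M := by
          refine ⟨mem_resAut.2 ⟨MulAut.congr (mapEquiv P) α, trivial, fun x => ?_⟩,
            mem_resAut.2 ⟨κ, hκ, fun y => (hεf _).trans (hfκ y)⟩⟩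
          have h1 := hαf ((mapEquiv P).symm x)
          rw [coe_mapEquiv_symm] at h1
          exact (hεf _).trans h1.symm
        refine ⟨⟨ε, hεM⟩, ⟨mem_autF_iff.2 hε, hεM⟩, ?_⟩
        ext x
        rw [hρ]
        exact (hεf _).trans (hαf x).symm
      · rintro ⟨β, hβ, rfl⟩
        have hβ' : (β : MulAut (P' ⊔ Q : Subgroup S)) ∈ F.autF (P' ⊔ Q) := hβ.1
        obtain ⟨f, hf, hβf⟩ := exists_mor_of_mem hβ'.1
        obtain ⟨κ, hκ, hβκ⟩ := mem_resAut.1 β.2.2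
        refine mem_autF_iff.2 (mem_normalizer_hom.2 ⟨f, ⟨hf, κ, hκ, fun y => ?_⟩, fun x => ?_⟩)
        · rw [← hβκ]
          exact (hβf (Subgroup.inclusion le_sup_right y)).symm
        · exact (hρ β x).trans (hβf _)
    have hA : (autS (P' ⊔ Q) ⊓ M).subgroupOf M ≤ (autS P).comap ρ := by
      intro β hβ
      obtain ⟨g, hg⟩ := mem_autS_iff.1 hβ.1
      have hgN : g ∈ N := by
        have h1 : g ∈ kNormalizer (P' ⊔ Q) M := mem_kNormalizer.2 ⟨_, β.2, hg⟩
        rw [kNormalizer_supAut] at h1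
        exact h1.2
      refine mem_autS_iff.2 ⟨⟨g, hgN⟩, fun x => Subtype.ext ?_⟩
      rw [hρ]
      exact hg (Subgroup.inclusion le_sup_left (mapEquiv P x))
    rw [hB, ← Subgroup.relIndex_comap]
    intro hdvd
    refine hs ?_
    rw [← Subgroup.relIndex_subgroupOf (L := M) inf_le_right]
    exact hdvd.trans (Subgroup.relIndex_dvd_of_le_left _ hA)

end FusionSystem

/-! ### Axiom (II) for the normalizer system. -/

namespace FusionSystem

variable {p : ℕ} {S : Type*} [Group S] {F : FusionSystem S} {Q : Subgroup S}
  {K : Subgroup (MulAut Q)}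

/-- If `supAut ⊥ K` has the Sylow property, then so has `supAut L K` for every `L` all of whose
elements are induced by elements of `N_S^K(Q)`. -/
theorem not_dvd_relIndex_supAut {R : Subgroup S} {L : Subgroup (MulAut R)}
    (hL : ∀ α ∈ L, ∃ g ∈ kNormalizer Q K, ∀ x : R, g * x * g⁻¹ = α x)
    (h : ¬p ∣ (autS (R ⊔ Q) ⊓ supAut (⊥ : Subgroup (MulAut R)) K).relIndex
      (F.autF (R ⊔ Q) ⊓ supAut (⊥ : Subgroup (MulAut R)) K)) :
    ¬p ∣ (autS (R ⊔ Q) ⊓ supAut L K).relIndex (F.autF (R ⊔ Q) ⊓ supAut L K) := by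
  have hle : supAut (⊥ : Subgroup (MulAut R)) K ≤ supAut L K := supAut_mono bot_le
  rw [Subgroup.relIndex_eq_of_forall_exists_mul
    (D := F.autF (R ⊔ Q) ⊓ supAut (⊥ : Subgroup (MulAut R)) K) (inf_le_inf_left _ hle)]
  · rw [← Subgroup.inf_relIndex_right] at h ⊢
    convert h using 3
    refine le_antisymm ?_ ?_
    · exact fun x hx => ⟨⟨hx.1.1, hx.2.2⟩, hx.2⟩
    · exact fun x hx => ⟨⟨hx.1.1, hle hx.1.2⟩, hx.2⟩
  · intro b hb
    obtain ⟨hbF, hbL⟩ := Subgroup.mem_inf.1 hb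
    obtain ⟨hb1, hb2⟩ := Subgroup.mem_inf.1 hbL
    obtain ⟨α, hα, hbα⟩ := hb1
    -- On `R`, the automorphism `b` is conjugation by `g`; dividing by the automorphism `a` that `g`
    -- induces on $RQ$ leaves one that is trivial on `R`.
    obtain ⟨g, hg, hgα⟩ := hL α hα
    obtain ⟨a, ha, hga⟩ := exists_mulAut_sup (mem_kNormalizer.2 ⟨α, hα, hgα⟩) hg
    have haS : a ∈ autS (R ⊔ Q) := mem_autS_iff.2 ⟨g, hga⟩
    obtain ⟨ha1, ha2⟩ := Subgroup.mem_inf.1 ha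
    have haα : ∀ x : R, a (Subgroup.inclusion le_sup_left x) =
        Subgroup.inclusion le_sup_left (α x) := fun x =>
      Subtype.ext ((hga (Subgroup.inclusion le_sup_left x)).symm.trans (hgα x))
    refine ⟨b * a⁻¹, Subgroup.mem_inf.2 ⟨mul_mem hbF (inv_mem (autS_le_autF _ haS)),
      Subgroup.mem_inf.2 ⟨⟨1, one_mem _, fun x => ?_⟩, mul_mem hb2 (inv_mem ha2)⟩⟩, ?_⟩
    · have h1 : a⁻¹ (Subgroup.inclusion le_sup_left x) =
          Subgroup.inclusion le_sup_left (α⁻¹ x) := by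
        apply a.injective
        rw [haα, MulAut.apply_inv_self, MulAut.apply_inv_self]
      rw [MulAut.mul_apply, h1, hbα, MulAut.apply_inv_self, MulAut.one_apply]
    · have h1 : (b * a⁻¹)⁻¹ * b = a := by group
      rw [h1]
      exact Subgroup.mem_inf.2 ⟨haS, ha⟩

/-- Take `L` to be the automorphisms of `R` induced by $N_S^K(Q)$. The Sylow property for `⊥` lifts
to `L`, and the extender of `e` lies in the normalizer on which the extension lemma for $PQ\to RQ$
is available. The twist it introduces is, on `R`, conjugation by some `h` in $N_S^K(Q)$, and is
undone by $h^{-1}$. -/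
theorem IsSaturated.exists_extend_normalizer (hp : p.Prime) (hS : IsDiscretePToral p S)
    (hF : F.IsSaturated p) (hQ : F.IsFullyKNormalized p Q K) {P R : Subgroup (kNormalizer Q K)}
    {e : P ≃* R} (he : e.toMonoidHom ∈ (F.normalizer Q K).hom P R)
    (hR : (F.normalizer Q K).IsFullyCentralized p R) :
    ∃ ψ ∈ (F.normalizer Q K).hom (extender e) ⊤,
      ∀ x : P, (ψ (Subgroup.inclusion (le_extender e) x) : kNormalizer Q K) = e x := by
  obtain ⟨hRc, hRs⟩ := hF.isFullyCentralized_and_not_dvd hp hS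
    (hF.isFullyKNormalized_sup_bot hp hS hQ hR)
  let R' := R.map (kNormalizer Q K).subtype
  let P' := P.map (kNormalizer Q K).subtype
  let L : Subgroup (MulAut R') := (autS R).map (MulAut.congr (mapEquiv R)).toMonoidHom
  have hLs := not_dvd_relIndex_supAut (L := L) (fun α hα => by
    obtain ⟨α, hα, rfl⟩ := hα
    obtain ⟨g, hg⟩ := mem_autS_iff.1 hα
    refine ⟨g, g.2, fun x => ?_⟩
    obtain ⟨y, rfl⟩ := (mapEquiv R).surjective x
    change _ = (mapEquiv R (α ((mapEquiv R).symm (mapEquiv R y))) : S)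
    rw [(mapEquiv R).symm_apply_apply]
    exact congrArg Subtype.val (hg y)) hRs
  obtain ⟨f₀, hf₀, hef₀⟩ := mem_normalizer_hom.1 he
  have hef₀' : ∀ x : P, (((e x : R) : kNormalizer Q K) : S) = f₀ x := hef₀
  obtain ⟨ε, hε, hεf⟩ := hf₀.exists_equiv_sup ((mapEquiv P).symm.trans (e.trans (mapEquiv R)))
    fun x => by
      have h1 := hef₀ ((mapEquiv P).symm x)
      rw [coe_mapEquiv_symm] at h1
      exact h1
  obtain ⟨-, κ₀, hκ₀, hfκ₀⟩ := hf₀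
  obtain ⟨χ, hχ, f, hf, hfχ, hfN⟩ := hF.exists_extend_of_not_dvd hp hS hRc hLs hε
  obtain ⟨hχ1, hχ2⟩ := Subgroup.mem_inf.1 (Subgroup.mem_inf.1 hχ).2
  obtain ⟨_, ⟨δ, hδ, rfl⟩, hχδ⟩ := mem_resAut.1 hχ1
  obtain ⟨κ₁, hκ₁, hχκ⟩ := mem_resAut.1 hχ2
  obtain ⟨h, hh⟩ := mem_autS_iff.1 hδ
  obtain ⟨κ₂, hκ₂, hhκ⟩ := mem_kNormalizer.1 (inv_mem h.2)
  have hεQ : ∀ y : Q, ε (Subgroup.inclusion le_sup_right y) =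
      Subgroup.inclusion le_sup_right (κ₀ y) := fun y =>
    Subtype.ext ((hεf _).trans (hfκ₀ y))
  have hεP : ∀ x : P, ε (Subgroup.inclusion le_sup_left (mapEquiv P x)) =
      Subgroup.inclusion le_sup_left (mapEquiv R (e x)) := fun x =>
    Subtype.ext ((hεf _).trans (hef₀ x).symm)
  have hle : (extender e).map (kNormalizer Q K).subtype ≤
      kNormalizer (P' ⊔ Q) ((supAut L K).comap (MulAut.congr ε).toMonoidHom) := by
    rintro _ ⟨g, hg, rfl⟩
    obtain ⟨α, hα, hgα⟩ := mem_kNormalizer.1 hg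
    obtain ⟨κ, hκ, hgκ⟩ := mem_kNormalizer.1 g.2
    have hgP : (g : S) ∈ kNormalizer P' ⊤ := by
      have h1 : (g : S) ∈ kNormalizer P' ⊤ ⊓ kNormalizer Q K := by
        rw [← map_normalizer]
        exact ⟨g, kNormalizer_le_normalizer _ _ hg, rfl⟩
      exact h1.1
    obtain ⟨γ, -, hγ⟩ := exists_mulAut_sup hgP g.2
    refine mem_kNormalizer.2 ⟨γ, Subgroup.mem_inf.2 ⟨mem_resAut.2
      ⟨MulAut.congr (mapEquiv R) (MulAut.congr e α), ⟨_, hα, rfl⟩, fun z => ?_⟩,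
      mem_resAut.2 ⟨κ₀ * κ * κ₀⁻¹, mul_mem (mul_mem hκ₀ hκ) (inv_mem hκ₀), fun y => ?_⟩⟩, hγ⟩
    · obtain ⟨r, rfl⟩ := (mapEquiv R).surjective z
      obtain ⟨x, rfl⟩ := e.surjective r
      have h1 : ε.symm (Subgroup.inclusion le_sup_left (mapEquiv R (e x))) =
          Subgroup.inclusion le_sup_left (mapEquiv P x) := by
        rw [← hεP, ε.symm_apply_apply]
      have h2 : γ (Subgroup.inclusion le_sup_left (mapEquiv P x)) =
          Subgroup.inclusion le_sup_left (mapEquiv P (α x)) :=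
        Subtype.ext ((hγ _).symm.trans (congrArg Subtype.val (hgα x)))
      change (ε (γ (ε.symm (Subgroup.inclusion le_sup_left (mapEquiv R (e x))))) : S) =
        mapEquiv R (e (α (e.symm ((mapEquiv R).symm (mapEquiv R (e x))))))
      rw [h1, h2, hεP, (mapEquiv R).symm_apply_apply, e.symm_apply_apply]
      rfl
    · obtain ⟨y, rfl⟩ := κ₀.surjective y
      have h1 : ε.symm (Subgroup.inclusion le_sup_right (κ₀ y)) =
          Subgroup.inclusion le_sup_right y := by
        rw [← hεQ, ε.symm_apply_apply]
      have h2 : γ (Subgroup.inclusion le_sup_right y) = Subgroup.inclusion le_sup_right (κ y) :=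
        Subtype.ext ((hγ _).symm.trans (hgκ y))
      change (ε (γ (ε.symm (Subgroup.inclusion le_sup_right (κ₀ y)))) : S) =
        κ₀ (κ (κ₀⁻¹ (κ₀ y)))
      rw [h1, h2, hεQ, MulAut.inv_apply_self]
      rfl
  -- Conjugating by `h⁻¹` restores `e` on `P`; on `Q` it contributes only the further factor `κ₂`
  -- from `K`.
  have hfh : F.Mor (kNormalizer (P' ⊔ Q) ((supAut L K).comap (MulAut.congr ε).toMonoidHom) ⊔
      (P' ⊔ Q)) fun x => (h : S)⁻¹ * f x * ((h : S)⁻¹)⁻¹ :=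
    hf.comp (F.mor_conj ⊤ (h : S)⁻¹) fun _ _ => trivial
  have hfhQ : ∀ y : Q, (h : S)⁻¹ * f y * ((h : S)⁻¹)⁻¹ = κ₂ (κ₁ (κ₀ y)) := fun y => by
    have h1 : f y = κ₁ (κ₀ y) := by
      refine (hfχ (Subgroup.inclusion le_sup_right y)).trans ?_
      rw [hεQ]
      exact hχκ _
    rw [h1, hhκ]
  have hfhP : ∀ x : P, (h : S)⁻¹ * f x * ((h : S)⁻¹)⁻¹ = (e x : kNormalizer Q K) := fun x => by
    have h1 : f x = (δ (e x) : kNormalizer Q K) := by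
      refine (hfχ (Subgroup.inclusion le_sup_left (mapEquiv P x))).trans ?_
      rw [hεP]
      refine (hχδ _).trans ?_
      change (mapEquiv R (δ ((mapEquiv R).symm (mapEquiv R (e x)))) : S) = _
      rw [(mapEquiv R).symm_apply_apply]
      rfl
    have h2 : (h : S) * (e x : kNormalizer Q K) * (h : S)⁻¹ = (δ (e x) : kNormalizer Q K) :=
      congrArg Subtype.val (hh (e x))
    rw [h1, ← h2]
    group
  obtain ⟨ψ, hψ, hψf⟩ := NMor.exists_normalizer_hom (P := extender e) (F := F)
    (f := fun x => (h : S)⁻¹ * f x * ((h : S)⁻¹)⁻¹)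
    ⟨hfh.mono (sup_le (hle.trans le_sup_left) (le_sup_right.trans le_sup_right)),
      κ₂ * κ₁ * κ₀, mul_mem (mul_mem hκ₂ hκ₁) hκ₀, hfhQ⟩ (fun g hg => by
      have h1 : f g ∈ kNormalizer (R' ⊔ Q) (supAut L K) := hfN _ (hle ⟨g, hg, rfl⟩)
      rw [kNormalizer_supAut] at h1
      exact mul_mem (mul_mem (inv_mem h.2) h1.2) (inv_mem (inv_mem h.2)))
  exact ⟨ψ, hψ, fun x => Subtype.ext ((hψf _).trans (hfhP x))⟩

end FusionSystem

/-! ### Axiom (III) for the normalizer system. -/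

namespace FusionSystem

variable {p : ℕ} {S : Type*} [Group S] {F : FusionSystem S} {Q : Subgroup S}
  {K : Subgroup (MulAut Q)}

theorem IsSaturated.mor_iSup (hF : F.IsSaturated p) {P : ℕ → Subgroup S} (hP : Monotone P)
    {f : S → S} (hf : ∀ n, F.Mor (P n) f) : F.Mor (⨆ n, P n) f := by
  have hmem : ∀ x ∈ ⨆ n, P n, ∃ n, x ∈ P n := fun x hx =>
    (Subgroup.mem_iSup_of_directed hP.directed_le).1 hx
  let φ : (⨆ n, P n : Subgroup S) →* (⊤ : Subgroup S) := MonoidHom.mk'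
    (fun x => ⟨f x, trivial⟩) fun x y => Subtype.ext (by
      obtain ⟨n, hn⟩ := hmem x x.2
      obtain ⟨m, hm⟩ := hmem y y.2
      exact (hf (max n m)).map_mul (hP (le_max_left n m) hn) (hP (le_max_right n m) hm))
  exact ⟨φ, hF.union P hP φ fun n => (hf n).mem fun x => rfl, fun x => rfl⟩

/-- $\mathrm{Aut}_F(Q)$ is an extension of a finite group by a quotient of the discrete $p$-toral
group `Q`. The intersections with $\mathrm{Inn}(Q)$ stabilize by the chain condition in `Q`, and the
indices over them are decreasing natural numbers. -/
theorem antitone_autF_stabilizes (hp : p.Prime) (hS : IsDiscretePToral p S)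
    (hF : F.IsSaturated p) {A : ℕ → Subgroup (MulAut Q)} (hA : Antitone A)
    (hAF : ∀ n, A n ≤ F.autF Q) : ∃ n, ∀ m, n ≤ m → A m = A n := by
  obtain ⟨n₁, h₁⟩ := (hS.subgroup hp Q).antitone_stabilizes hp
    (fun n => (A n).comap MulAut.conj) fun i j hij => Subgroup.comap_mono (hA hij)
  have hne : ∀ n, (inn Q).relIndex (A n) ≠ 0 := fun n h0 =>
    hF.inn_relIndex_autF_ne_zero hp hS Q (Subgroup.relIndex_eq_zero_of_le_right (hAF n) h0)
  have hmono : Antitone fun n => (inn Q).relIndex (A n) := fun i j hij => by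
    exact Subgroup.relIndex_le_of_le_right (hA hij) (hne i)
  obtain ⟨n₂, h₂⟩ := WellFoundedGT.monotone_chain_condition
    (⟨fun n => OrderDual.toDual ((inn Q).relIndex (A n)), hmono⟩ : ℕ →o ℕᵒᵈ)
  refine ⟨max n₁ n₂, fun m hm => le_antisymm (hA hm) ?_⟩
  have hinn : ∀ m, max n₁ n₂ ≤ m → inn Q ⊓ A m = inn Q ⊓ A n₁ := fun m hm => by
    have h3 := h₁ m ((le_max_left _ _).trans hm)
    have h4 : ∀ n, inn Q ⊓ A n = ((A n).comap MulAut.conj).map MulAut.conj := fun n => by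
      rw [Subgroup.map_comap_eq]
      rfl
    rw [h4, h4, h3]
  have hidx : (inn Q).relIndex (A m) = (inn Q).relIndex (A (max n₁ n₂)) := by
    have h5 : (inn Q).relIndex (A n₂) = (inn Q).relIndex (A m) :=
      h₂ m ((le_max_right _ _).trans hm)
    have h6 : (inn Q).relIndex (A n₂) = (inn Q).relIndex (A (max n₁ n₂)) :=
      h₂ _ (le_max_right _ _)
    rw [← h5, ← h6]
  -- Equal intersections with $\mathrm{Inn}(Q)$ and equal indices over them force the index of `A m`
  -- to be $1$.
  have hmul := Subgroup.relIndex_mul_relIndex (inn Q ⊓ A m) (A m) (A (max n₁ n₂)) inf_le_right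
    (hA hm)
  rw [Subgroup.inf_relIndex_right, hinn m hm, ← hinn _ le_rfl, Subgroup.inf_relIndex_right,
    hidx] at hmul
  exact Subgroup.relIndex_eq_one.1 (Nat.eq_of_mul_eq_mul_left (Nat.pos_of_ne_zero (hne _))
    (hmul.trans (mul_one _).symm))

/-- The automorphisms in `K` which, together with `f` on `P`, extend to a morphism on `PQ`. -/
def extensions (F : FusionSystem S) (K : Subgroup (MulAut Q)) (P : Subgroup S) (f : S → S) :
    Set (MulAut Q) :=
  {α | α ∈ K ∧ ∃ g, F.Mor (P ⊔ Q) g ∧ (∀ x ∈ P, g x = f x) ∧ ∀ y : Q, g y = α y}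

theorem extensions_anti {P P' : Subgroup S} (h : P ≤ P') (f : S → S) :
    F.extensions K P' f ⊆ F.extensions K P f := by
  rintro α ⟨hα, g, hg, hgf, hgα⟩
  exact ⟨hα, g, hg.mono (sup_le_sup_right h Q), fun x hx => hgf x (h hx), hgα⟩

theorem mul_mem_extensions {P : Subgroup S} {f : S → S} {α β : MulAut Q}
    (hα : α ∈ F.extensions K P f) (hβ : β ∈ F.extensions K P id) :
    α * β ∈ F.extensions K P f := by
  obtain ⟨hα, g, hg, hgf, hgα⟩ := hα
  obtain ⟨hβ, h, hh, hhf, hhβ⟩ := hβ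
  refine ⟨mul_mem hα hβ, fun x => g (h x), hh.comp hg ?_, fun x hx => ?_, fun y => ?_⟩
  · refine hh.sup_mem le_rfl (fun x hx => ?_) fun y hy => ?_
    · rw [hhf x hx]
      exact Subgroup.mem_sup_left hx
    · rw [hhβ ⟨y, hy⟩]
      exact Subgroup.mem_sup_right (β _).2
  · beta_reduce
    rw [hhf x hx]
    exact hgf x hx
  · beta_reduce
    rw [hhβ, hgα, MulAut.mul_apply]

/-- Following one extension by the inverse of another gives the identity on `P`. With
`mul_mem_extensions`, a nonempty set of extensions is a left coset of those of the identity. -/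
theorem inv_mul_mem_extensions {P : Subgroup S} {f : S → S} {α β : MulAut Q}
    (hα : α ∈ F.extensions K P f) (hβ : β ∈ F.extensions K P f) :
    α⁻¹ * β ∈ F.extensions K P id := by
  obtain ⟨hα, g, hg, hgf, hgα⟩ := hα
  obtain ⟨hβ, h, hh, hhf, hhβ⟩ := hβ
  obtain ⟨X, e, he, heg⟩ := hg.exists_equiv
  obtain ⟨k, hk, hek⟩ := exists_mor_of_mem (F.symm_mem he)
  have hkg : ∀ x (hx : x ∈ P ⊔ Q), k (g x) = x := fun x hx => by
    have h1 := hek (e ⟨x, hx⟩)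
    rw [heg] at h1
    rw [← h1]
    exact congrArg Subtype.val (e.symm_apply_apply ⟨x, hx⟩)
  have hgX : ∀ x ∈ P ⊔ Q, g x ∈ X := fun x hx => by
    have h1 : (e ⟨x, hx⟩ : S) = g x := heg ⟨x, hx⟩
    rw [← h1]
    exact (e _).2
  have hQ : ∀ y : Q, h y = g (α⁻¹ (β y) : Q) := fun y => by
    rw [hgα, MulAut.apply_inv_self, hhβ]
  refine ⟨mul_mem (inv_mem hα) hβ, fun x => k (h x), hh.comp hk ?_, fun x hx => ?_, fun y => ?_⟩
  · refine hh.sup_mem le_rfl (fun x hx => ?_) fun y hy => ?_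
    · rw [hhf x hx, ← hgf x hx]
      exact hgX x (Subgroup.mem_sup_left hx)
    · rw [hQ ⟨y, hy⟩]
      exact hgX _ (Subgroup.mem_sup_right (α⁻¹ _).2)
  · beta_reduce
    rw [hhf x hx, ← hgf x hx]
    exact hkg x (Subgroup.mem_sup_left hx)
  · beta_reduce
    rw [hQ]
    exact hkg _ (Subgroup.mem_sup_right (α⁻¹ _).2)

/-- The automorphisms in `K` which extend to `PQ` by the identity on `P`. -/
def extensionsOfId (F : FusionSystem S) (K : Subgroup (MulAut Q)) (P : Subgroup S) :
    Subgroup (MulAut Q) where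
  carrier := F.extensions K P id
  one_mem' := ⟨one_mem _, id, F.mor_id _, fun _ _ => rfl, fun _ => rfl⟩
  mul_mem' := mul_mem_extensions
  inv_mem' {α} hα := by
    have h1 : (1 : MulAut Q) ∈ F.extensions K P id :=
      ⟨one_mem _, id, F.mor_id _, fun _ _ => rfl, fun _ => rfl⟩
    have h2 := inv_mul_mem_extensions hα h1
    rwa [mul_one] at h2

theorem extensionsOfId_le_autF (P : Subgroup S) : extensionsOfId F K P ≤ F.autF Q := by
  rintro α ⟨-, g, hg, -, hgα⟩
  exact mem_autF_iff.2 ((hg.mono le_sup_right).mem fun y => (hgα y).symm)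

/-- The possible restrictions to `Q` form a decreasing chain of nonempty cosets whose underlying
subgroups of $\mathrm{Aut}_F(Q)$ stabilize, so the cosets stabilize too and share an element `α`.
Prescribing `f` and `α` determines the extension on each $P_nQ$. -/
theorem IsSaturated.nmor_iSup (hp : p.Prime) (hS : IsDiscretePToral p S)
    (hF : F.IsSaturated p) {P : ℕ → Subgroup S} (hP : Monotone P) {f : S → S}
    (hf : ∀ n, ∃ g, F.NMor K (P n) g ∧ ∀ x ∈ P n, g x = f x) :
    ∃ g, F.NMor K (⨆ n, P n) g ∧ ∀ n, ∀ x ∈ P n, g x = f x := by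
  have hne : ∀ n, (F.extensions K (P n) f).Nonempty := fun n => by
    obtain ⟨g, ⟨hg, κ, hκ, hgκ⟩, hgf⟩ := hf n
    exact ⟨κ, hκ, g, hg, hgf, hgκ⟩
  obtain ⟨n₀, hn₀⟩ := antitone_autF_stabilizes hp hS hF
    (A := fun n => extensionsOfId F K (P n)) (fun i j hij => extensions_anti (hP hij) _)
    fun n => extensionsOfId_le_autF _
  obtain ⟨α, hα⟩ := hne n₀
  have hall : ∀ n, α ∈ F.extensions K (P n) f := by
    intro n
    obtain ⟨β, hβ⟩ := hne (max n₀ n)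
    have h1 : β⁻¹ * α ∈ extensionsOfId F K (P n₀) :=
      -- At stage `n₀`, `α` and `β` differ by an extension of the identity; by stability that
      -- difference also extends at the later stage, so `α` does as well.
      inv_mul_mem_extensions (extensions_anti (hP (le_max_left _ _)) f hβ) hα
    rw [← hn₀ (max n₀ n) (le_max_left _ _)] at h1
    have h2 := mul_mem_extensions hβ h1
    rw [mul_inv_cancel_left] at h2
    exact extensions_anti (hP (le_max_right _ _)) f h2
  choose hαK g hg hgf hgα using hall
  have hcompat : ∀ n m, n ≤ m → ∀ x ∈ P n ⊔ Q, g n x = g m x := fun n m hnm =>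
    (hg n).eqOn_sup ((hg m).mono (sup_le_sup_right (hP hnm) Q))
      (fun x hx => (hgf n x hx).trans (hgf m x (hP hnm hx)).symm)
      fun y hy => (hgα n ⟨y, hy⟩).trans (hgα m ⟨y, hy⟩).symm
  classical
  -- By compatibility any stage may be used; the value off the union is irrelevant.
  let k : S → S := fun x => if hx : ∃ n, x ∈ P n ⊔ Q then g (Nat.find hx) x else 1
  have hk : ∀ n, ∀ x ∈ P n ⊔ Q, k x = g n x := by
    intro n x hx
    have hex : ∃ n, x ∈ P n ⊔ Q := ⟨n, hx⟩
    simp only [k, dif_pos hex]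
    exact hcompat _ _ (Nat.find_min' hex hx) x (Nat.find_spec hex)
  have hsup : (⨆ n, P n) ⊔ Q = ⨆ n, P n ⊔ Q := by rw [iSup_sup]
  refine ⟨k, ⟨?_, α, hαK 0, fun y => ?_⟩, fun n x hx => ?_⟩
  · rw [hsup]
    exact hF.mor_iSup (fun i j hij => sup_le_sup_right (hP hij) Q)
      fun n => (hg n).congr fun x hx => (hk n x hx).symm
  · rw [hk 0 y (Subgroup.mem_sup_right y.2), hgα]
  · rw [hk n x (Subgroup.mem_sup_left hx), hgf n x hx]

theorem IsSaturated.normalizer (hp : p.Prime) (hS : IsDiscretePToral p S)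
    (hF : F.IsSaturated p) (hQ : F.IsFullyKNormalized p Q K) :
    (F.normalizer Q K).IsSaturated p where
  sylow P hP := by
    obtain ⟨h1, h2⟩ := hF.sylow_normalizer hp hS hQ hP
    exact ⟨h1, finite_outF_and_sylow hp (hS.subgroup hp _) h2⟩
  extend P φ hφ hR := by
    obtain ⟨f, hf, hφf⟩ := exists_mor_of_mem hφ
    obtain ⟨ψ, hψ, h⟩ := hF.exists_extend_normalizer hp hS hQ
      (e := isoImage φ ((F.normalizer Q K).injective hφ)) (hf.mem hφf) hR
    refine ⟨ψ, hψ, ?_⟩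
    ext x
    exact congrArg Subtype.val (h x)
  union P hP φ h := by
    have hφ : ∃ f : S → S, ∀ x, ((φ x : kNormalizer Q K) : S) = f x := by
      classical
      let f : S → S := fun y =>
        if hy : ∃ x : (⨆ n, P n : Subgroup (kNormalizer Q K)), ((x : kNormalizer Q K) : S) = y
          then (φ hy.choose : kNormalizer Q K) else 1
      refine ⟨f, fun x => ?_⟩
      have hex : ∃ z : (⨆ n, P n : Subgroup (kNormalizer Q K)),
          ((z : kNormalizer Q K) : S) = (x : kNormalizer Q K) := ⟨x, rfl⟩
      simp only [f, dif_pos hex]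
      rw [Subtype.ext (Subtype.ext hex.choose_spec)]
    obtain ⟨f, hφf⟩ := hφ
    obtain ⟨g, hg, hgf⟩ := hF.nmor_iSup (K := K) (f := f) hp hS
      (P := fun n => (P n).map (kNormalizer Q K).subtype)
      (fun i j hij => Subgroup.map_mono (hP hij)) (fun n => by
        obtain ⟨g, hg, hgφ⟩ := mem_normalizer_hom.1 (h n)
        refine ⟨g, hg, ?_⟩
        rintro _ ⟨x, hx, rfl⟩
        exact (hgφ ⟨x, hx⟩).symm.trans (hφf _))
    refine mem_normalizer_hom.2 ⟨g, by rwa [Subgroup.map_iSup], fun x => ?_⟩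
    obtain ⟨n, hn⟩ := (Subgroup.mem_iSup_of_directed hP.directed_le).1 x.2
    rw [hφf, hgf n x ⟨x, hn, rfl⟩]

end FusionSystem

theorem theorem2p3 (p : ℕ) (hp : p.Prime) {S : Type*} [Group S] (hS : IsDiscretePToral p S)
    (F : FusionSystem S) (hF : F.IsSaturated p) (Q : Subgroup S) (K : Subgroup (MulAut Q))
    (hQ : F.IsFullyKNormalized p Q K) :
    IsDiscretePToral p (FusionSystem.kNormalizer Q K) ∧ (F.normalizer Q K).IsSaturated p :=
  ⟨hS.subgroup hp _, hF.normalizer hp hS hQ⟩
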